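/- Let $\lambda\in\mathbb{R}$, $\langle x\rangle=(1+|x|^2)^{1/2}$, $\square=\partial_t^2-\partial_x^2$, $N(u)=\lambda|u|^2u$, and $\|f\|_{H^{2,5/2}}=\sum_{j=0}^{2}\|\langle x\rangle^{5/2}\partial_x^jf\|_{L^2(\mathbb{R})}$ (weak derivatives); $H^{2,5/2}(\mathbb{R})$ is the space of complex-valued $f\in L^2(\mathbb{R})$ for which this is finite. For $A_1,B_1\in H^{2,5/2}(\mathbb{R})$ put $$S_A=\tfrac{\lambda}{2}\langle z\rangle^{-1}(|A_1|^2+2|B_1|^2),\quad S_B=-\tfrac{\lambda}{2}\langle z\rangle^{-1}(2|A_1|^2+|B_1|^2),\quad A_2=-\tfrac{\lambda}{8}A_1^2\overline{B_1},\quad B_2=-\tfrac{\lambda}{8}\overline{A_1}B_1^2$$ as functions of $z\in\mathbb{R}$, and, with $\theta=-\sqrt{t^2-x^2}$ and $\mu=x/\sqrt{t^2-x^2}$ for $|x|<t$, let $\tilde u=u_{\mathrm{ap}}+v_{\mathrm{ap}}$, where $$u_{\mathrm{ap}}(t,x)=t^{-1/2}\mathbf 1_{\{|x|<t\}}\big[A_1(\mu)e^{i\theta+iS_A(\mu)\log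 t}+B_1(\mu)e^{-i\theta+iS_B(\mu)\log t}\big],$$ $$v_{\mathrm{ap}}(t,x)=t^{-3/2}\mathbf 1_{\{|x|<t\}}\big[A_2(\mu)e^{3i\theta+i(2S_A(\mu)-S_B(\mu))\log t}+B_2(\mu)e^{-3i\theta+i(2S_B(\mu)-S_A(\mu))\log t}\big].$$ (1) There is a constant $C$ depending only on $\lambda$ such that, for all $A_1,B_1\in H^{2,5/2}(\mathbb{R})$ and all $t\ge3$, with $m=\|A_1\|_{L^\infty}+\|B_1\|_{L^\infty}$ and $M=\|A_1\|_{H^{2,5/2}}+\|B_1\|_{H^{2,5/2}}$, $$\|\tilde u(t)\|_{L^\infty_x}\le C\,t^{-1/2}\,m\,\langle m\rangle^2,\qquad \|(\square+1)\tilde u(t)-N(\tilde u(t))\|_{L^2_x}\le C\,t^{-2}(\log t)^2\,M\,\langle M\rangle^8,$$ where $(\square+1)\tilde u(t)$ is taken in the sense of distributions in $x$ for each $t>1$. (2) In particular, for every $\varepsilon_0>0$ there is $\eta>0$, depending only on $\varepsilon_0$ and $\lambda$, such that if $A_1,B_1\in H^{2,5/2}(\mathbb{R})$ and $\|A_1\|_{L^\infty}+\|B_1\|_{L^\infty}\le\eta$,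 then for every $\delta_0<1$ there is $T\ge1$ with $$\|\tilde u(t)\|_{L^\infty_x}\le\varepsilon_0t^{-1/2},\qquad \|(\square+1)\tilde u(t)-N(\tilde u(t))\|_{L^2_x}\le\varepsilon_0t^{-1-\delta_0}\qquad(t\ge T).$$ (3) If $A_1,B_1\in H^{2,5/2}(\mathbb{R})$ and the set $\{\xi\in\mathbb{R}: |A_1(\xi)|\ne|B_1(\xi)|\}$ has positive measure, then $\liminf_{t\to\infty}\|\mathrm{Im}\,\tilde u(t)\|_{L^2_x(\mathbb{R})}>0$. -/

import Mathlib

open MeasureTheory Filter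
open scoped ENNReal ContDiff

noncomputable section

namespace KG

/-- The Japanese bracket `⟨x⟩ = (1 + x²)^{1/2}`. -/
def jbr (x : ℝ) : ℝ := Real.sqrt (1 + x ^ 2)

/-- `g` is the `j`-th derivative of `f` in the sense of distributions on `ℝ`. -/
def IsWeakDeriv (j : ℕ) (f g : ℝ → ℂ) : Prop :=
  LocallyIntegrable g volume ∧
    ∀ φ : ℝ → ℝ, ContDiff ℝ ∞ φ → HasCompactSupport φ →
      ∫ x, iteratedDeriv j φ x • f x = (-1 : ℂ) ^ j * ∫ x, φ x • g x

open Classical in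
/-- The `j`-th weak derivative of `f` (unique up to null sets), and `0` if there is none. -/
def weakDeriv (j : ℕ) (f : ℝ → ℂ) : ℝ → ℂ :=
  if h : ∃ g, IsWeakDeriv j f g then h.choose else 0

/-- Membership in the weighted Sobolev space `H^{k,s}(ℝ)`. -/
def MemWSobolev (k : ℕ) (s : ℝ) (f : ℝ → ℂ) : Prop :=
  MemLp f 2 volume ∧
    ∀ j ≤ k, (∃ g, IsWeakDeriv j f g) ∧
      MemLp (fun x => (jbr x ^ s) • weakDeriv j f x) 2 volume

/-- The norm `‖f‖_{H^{k,s}} = ∑_{j ≤ k} ‖⟨x⟩^s ∂^j f‖_{L²}`. -/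
def wSobolevNorm (k : ℕ) (s : ℝ) (f : ℝ → ℂ) : ℝ :=
  ∑ j ∈ Finset.range (k + 1),
    (eLpNorm (fun x => (jbr x ^ s) • weakDeriv j f x) 2 volume).toReal

/-- The `L^∞` norm as a real number. -/
def linftyNorm (f : ℝ → ℂ) : ℝ := (eLpNorm f ∞ volume).toReal

/-- The cubic nonlinearity `N(u) = λ |u|² u`. -/
def cubic (lam : ℝ) (u : ℂ) : ℂ := (lam : ℂ) * ((‖u‖ ^ 2 : ℝ) : ℂ) * u

/-- `θ(t,x) = -(t² - x²)^{1/2}`. -/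
def theta (t x : ℝ) : ℝ := -Real.sqrt (t ^ 2 - x ^ 2)

/-- `μ(t,x) = x (t² - x²)^{-1/2}`. -/
def mu (t x : ℝ) : ℝ := x / Real.sqrt (t ^ 2 - x ^ 2)

/-- The phase modulation accompanying `e^{iθ}`. -/
def phaseA (lam : ℝ) (A B : ℝ → ℂ) (z : ℝ) : ℝ :=
  lam / 2 * (jbr z)⁻¹ * (‖A z‖ ^ 2 + 2 * ‖B z‖ ^ 2)

/-- The phase modulation accompanying `e^{-iθ}`. -/
def phaseB (lam : ℝ) (A B : ℝ → ℂ) (z : ℝ) : ℝ :=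
  -(lam / 2) * (jbr z)⁻¹ * (2 * ‖A z‖ ^ 2 + ‖B z‖ ^ 2)

/-- `A₂ = -(λ/8) A₁² \bar B₁`. -/
def ampA2 (lam : ℝ) (A B : ℝ → ℂ) (z : ℝ) : ℂ :=
  -((lam : ℂ) / 8) * A z ^ 2 * (starRingEnd ℂ) (B z)

/-- `B₂ = -(λ/8) \bar A₁ B₁²`. -/
def ampB2 (lam : ℝ) (A B : ℝ → ℂ) (z : ℝ) : ℂ :=
  -((lam : ℂ) / 8) * (starRingEnd ℂ) (A z) * B z ^ 2

/-- `e^{ip}` for a real phase `p`. -/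
def cis (p : ℝ) : ℂ := Complex.exp (Complex.I * (p : ℂ))

/-- The leading profile `u_ap`. -/
def uap (lam : ℝ) (A B : ℝ → ℂ) (t x : ℝ) : ℂ :=
  if |x| < t then
    ((t ^ (-(1 / 2) : ℝ) : ℝ) : ℂ) *
      (A (mu t x) * cis (theta t x + phaseA lam A B (mu t x) * Real.log t) +
        B (mu t x) * cis (-theta t x + phaseB lam A B (mu t x) * Real.log t))
  else 0

/-- The third-harmonic correction `v_ap`. -/
def vap (lam : ℝ) (A B : ℝ → ℂ) (t x : ℝ) : ℂ :=
  if |x| < t then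
    ((t ^ (-(3 / 2) : ℝ) : ℝ) : ℂ) *
      (ampA2 lam A B (mu t x) *
          cis (3 * theta t x + 2 * phaseA lam A B (mu t x) * Real.log t
            - phaseB lam A B (mu t x) * Real.log t) +
        ampB2 lam A B (mu t x) *
          cis (-3 * theta t x - phaseA lam A B (mu t x) * Real.log t
            + 2 * phaseB lam A B (mu t x) * Real.log t))
  else 0

/-- The profile `ũ = u_ap + v_ap`. -/
def profile (lam : ℝ) (A B : ℝ → ℂ) (t x : ℝ) : ℂ :=
  uap lam A B t x + vap lam A B t x

/-- `(□ + 1) u(t) = G(t)` in `D'(ℝ)` for every `t > T`, where `□ = ∂_t² - ∂_x²`: for each test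
function `φ` of `x`, the pairing `⟨u(t), φ⟩` is twice differentiable in `t > T`, and its second
derivative is `⟨u(t), φ''⟩ - ⟨u(t), φ⟩ + ⟨G(t), φ⟩`. This determines `G(t)` up to null sets
for every `t > T`. -/
def IsBoxPlusOne (T : ℝ) (u G : ℝ → ℝ → ℂ) : Prop :=
  (∀ t, T < t → LocallyIntegrable (u t) volume ∧ LocallyIntegrable (G t) volume) ∧
    ∀ φ : ℝ → ℝ, ContDiff ℝ ∞ φ → HasCompactSupport φ →
      ∃ p : ℝ → ℂ, ∀ t, T < t →
        HasDerivAt (fun s => ∫ x, φ x • u s x) (p t) t ∧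
        HasDerivAt p
          ((∫ x, iteratedDeriv 2 φ x • u t x) - (∫ x, φ x • u t x) + ∫ x, φ x • G t x) t

end KG

end

/-! In the coordinate z with x = t z/⟨z⟩, the interior of the light cone at time t becomes the whole
line, √(t² - x²) = t/⟨z⟩ and dx = t⟨z⟩⁻³ dz. The profile becomes a sum of four modes t^{r-1} f(z)
e^{i(κt/⟨z⟩ + S(z) log t)}, with (r, κ) = (1/2, ∓1) for A₁, B₁ and (-1/2, ∓3) for A₂, B₂. Applied to
a mode, □ + 1 multiplies the oscillation by t^{r-1} times (1 - κ²) f + ⟨z⟩(-2κS + iκ(2r - 1)) f/t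
plus a remainder of relative size t⁻² log² t (`Mode.src_eq`). For κ = ∓1 and r = 1/2 only -2κ⟨z⟩S
f/t survives, and S_A, S_B are the phases for which this is the resonant part of N(u_ap). The rest
of N(u_ap) consists of third harmonics; there 1 - κ² = -8, which dictates A₂ and B₂
(`sourceZ_sub_cubic`).

What is left is pointwise t^{-5/2} log² t times ⟨z⟩⁴ times the size of the data and their first two
derivatives. In L² the Jacobian contributes t^{1/2}⟨z⟩^{-3/2}, which produces both the rate t⁻² and
the weight ⟨z⟩^{5/2} (`sqrt_weight`).

The data have only two weak derivatives. They are replaced by C¹ representatives with locally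
absolutely continuous derivative (`MemWSobolev.exists_jet`), and the equation is verified against
test functions: the pairing is differentiated twice in t under the integral, and its defect is the
z-derivative of a flux (`Mode.hasDerivAt_flux`) that vanishes as z → ±∞, so the edge of the cone
contributes nothing.

The small-data statement follows because log² t is absorbed by t^{1-δ}. For the imaginary part,
`im_add_sq_ge` bounds (Im(α + β))² below by (|α| - |β|)²/2 plus products of frequency ±2. Their
weighted integrals tend to zero by non-stationary phase (`Mode.tendsto_integral_osc`), while the
integral of (|A₁| - |B₁|)² against the same weight does not depend on t and is positive. -/

noncomputable section

namespace KG

/-! ### Locally absolutely continuous functions -/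

/-- Local absolute continuity of a complex-valued function on the line. -/
def LocAC (f : ℝ → ℂ) : Prop := ∀ a b : ℝ, AbsolutelyContinuousOnInterval f a b

namespace LocAC

/-- Absolute continuity only sees increments, so it passes from a function with larger increments to
one with smaller ones. This covers conjugation and, through the primitive of ‖g‖, indefinite
integrals. -/
theorem of_dist_le {X : Type*} [PseudoMetricSpace X] {g : ℝ → X} {f : ℝ → ℂ}
    (hg : ∀ a b, AbsolutelyContinuousOnInterval g a b)
    (h : ∀ x y, dist (f x) (f y) ≤ dist (g x) (g y)) : LocAC f := by
  intro a b
  rw [absolutelyContinuousOnInterval_iff]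
  intro ε hε
  obtain ⟨δ, hδ, H⟩ := (absolutelyContinuousOnInterval_iff g a b).1 (hg a b) ε hε
  exact ⟨δ, hδ, fun E hE hE' =>
    (Finset.sum_le_sum fun i _ => h _ _).trans_lt (H E hE hE')⟩

theorem of_contDiff {f : ℝ → ℂ} (hf : ContDiff ℝ 1 f) : LocAC f :=
  fun _ _ => hf.contDiffOn.absolutelyContinuousOnInterval

theorem of_hasDerivAt {f f' : ℝ → ℂ} (h : ∀ x, HasDerivAt f (f' x) x) (hc : Continuous f') :
    LocAC f := by
  refine of_contDiff (contDiff_one_iff_deriv.2 ⟨fun x => (h x).differentiableAt, ?_⟩)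
  rwa [show deriv f = f' from funext fun x => (h x).deriv]

theorem const (c : ℂ) : LocAC fun _ => c := of_contDiff contDiff_const

theorem add {f g : ℝ → ℂ} (hf : LocAC f) (hg : LocAC g) : LocAC fun x => f x + g x :=
  fun a b => (hf a b).add (hg a b)

theorem sub {f g : ℝ → ℂ} (hf : LocAC f) (hg : LocAC g) : LocAC fun x => f x - g x :=
  fun a b => (hf a b).sub (hg a b)

theorem mul {f g : ℝ → ℂ} (hf : LocAC f) (hg : LocAC g) : LocAC fun x => f x * g x :=
  fun a b => (hf a b).smul (hg a b)

theorem conj {f : ℝ → ℂ} (hf : LocAC f) : LocAC fun x => (starRingEnd ℂ) (f x) :=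
  of_dist_le hf fun _ _ => (Complex.dist_conj_conj _ _).le

theorem continuous {f : ℝ → ℂ} (hf : LocAC f) : Continuous f := by
  rw [continuous_iff_continuousAt]
  intro x
  have := (hf (x - 1) (x + 1)).continuousOn
  refine this.continuousAt ?_
  rw [Set.uIcc_of_le (by linarith)]
  exact Icc_mem_nhds (by linarith) (by linarith)

theorem primitive {g : ℝ → ℂ} (hg : LocallyIntegrable g volume) (c : ℝ) :
    LocAC fun x => ∫ v in c..x, g v := by
  have hI : ∀ a b, IntervalIntegrable g volume a b := fun a b =>
    (hg.integrableOn_isCompact isCompact_uIcc).intervalIntegrable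
  refine of_dist_le (g := fun x => ∫ v in c..x, ‖g v‖) (fun a b => ?_) fun x y => ?_
  -- The interval is enlarged to contain the base point c, then cut back to [a, b].
  · have h1 : AbsolutelyContinuousOnInterval (fun x => ∫ v in c..x, ‖g v‖)
        (min a (min b c)) (max a (max b c)) :=
      (hI _ _).norm.absolutelyContinuousOnInterval_intervalIntegral (by
        rw [Set.mem_uIcc]; left; simp)
    refine h1.mono ?_
    rw [Set.uIcc_of_le (a := min a (min b c)) (by simp), Set.uIcc]
    exact Set.Icc_subset_Icc (by simp [← min_assoc]) (by simp [← max_assoc])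
  · rw [dist_comm, dist_comm (∫ v in c..x, ‖g v‖), dist_eq_norm, dist_eq_norm,
      intervalIntegral.integral_interval_sub_left (hI _ _) (hI _ _),
      intervalIntegral.integral_interval_sub_left (hI _ _).norm (hI _ _).norm, Real.norm_eq_abs]
    exact intervalIntegral.norm_integral_le_abs_integral_norm

/-- f minus the primitive of f' is absolutely continuous with derivative zero almost everywhere,
hence constant. -/
theorem integral_eq_sub {f f' : ℝ → ℂ} (hf : LocAC f) (hd : ∀ᵐ x, HasDerivAt f (f' x) x)
    (hi : LocallyIntegrable f' volume) (a b : ℝ) : ∫ x in a..b, f' x = f b - f a := by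
  have hg : LocAC fun x => f x - ∫ v in a..x, f' v := hf.sub (primitive hi a)
  obtain ⟨C, hC⟩ := (hg a b).const_of_ae_hasDerivAt_zero (by
    filter_upwards [hd, _root_.LocallyIntegrable.ae_hasDerivAt_integral hi] with x h1 h2 _
    simpa using h1.fun_sub (h2 a))
  have h1 := hC a Set.left_mem_uIcc
  have h2 := hC b Set.right_mem_uIcc
  simp only [intervalIntegral.integral_same, sub_zero] at h1
  rw [h1, ← h2]; ring

/-- The form in which integrations by parts are made below. -/
theorem integral_deriv_eq_zero {f f' : ℝ → ℂ} (hf : LocAC f) (hd : ∀ᵐ x, HasDerivAt f (f' x) x)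
    (hi : Integrable f' volume) (ht : Tendsto f atTop (nhds 0)) (hb : Tendsto f atBot (nhds 0)) :
    ∫ x, f' x = 0 := by
  have h1 := intervalIntegral_tendsto_integral hi tendsto_neg_atTop_atBot tendsto_id
  have h2 : Tendsto (fun x : ℝ => ∫ y in (-x)..(id x), f' y) atTop (nhds 0) := by
    simp only [hf.integral_eq_sub hd hi.locallyIntegrable, id]
    simpa using ht.sub (hb.comp tendsto_neg_atTop_atBot)
  exact tendsto_nhds_unique h1 h2

end LocAC

/-! ### Weak derivatives and regular representatives -/

theorem tendsto_zero_of_hasCompactSupport {f : ℝ → ℂ} (hf : HasCompactSupport f) :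
    Tendsto f atTop (nhds 0) ∧ Tendsto f atBot (nhds 0) := by
  obtain ⟨b, hb⟩ := hf.isCompact.bddAbove
  obtain ⟨a, ha⟩ := hf.isCompact.bddBelow
  constructor
  · refine tendsto_const_nhds.congr' ?_
    filter_upwards [eventually_gt_atTop b] with x hx
    exact (image_eq_zero_of_notMem_tsupport fun h => (hb h).not_gt hx).symm
  · refine tendsto_const_nhds.congr' ?_
    filter_upwards [eventually_lt_atBot a] with x hx
    exact (image_eq_zero_of_notMem_tsupport fun h => (ha h).not_gt hx).symm

/-- A smooth compactly supported function of zero mean has a compactly supported primitive. -/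
theorem exists_testFunction_primitive {χ : ℝ → ℝ} (hχ : ContDiff ℝ ∞ χ) (hc : HasCompactSupport χ)
    (h0 : ∫ x, χ x = 0) :
    ∃ Φ : ℝ → ℝ, ContDiff ℝ ∞ Φ ∧ HasCompactSupport Φ ∧ deriv Φ = χ := by
  obtain ⟨R, hR⟩ := hc.isCompact.isBounded.subset_closedBall 0
  rw [Real.closedBall_eq_Icc] at hR
  simp only [zero_sub, zero_add] at hR
  have hz : ∀ x, x ∉ Set.Icc (-R) R → χ x = 0 := fun x hx =>
    image_eq_zero_of_notMem_tsupport fun h => hx (hR h)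
  have hI : Integrable χ volume := hχ.continuous.integrable_of_hasCompactSupport hc
  refine ⟨fun x => ∫ v in Set.Iic x, χ v, ?_⟩
  have hd : ∀ x, HasDerivAt (fun x => ∫ v in Set.Iic x, χ v) (χ x) x := by
    intro x
    have h1 : HasDerivAt (fun x => (∫ v in Set.Iic 0, χ v) + ∫ v in (0 : ℝ)..x, χ v) (χ x) x :=
      (intervalIntegral.integral_hasDerivAt_right (hχ.continuous.intervalIntegrable _ _)
        (hχ.continuous.stronglyMeasurableAtFilter _ _) hχ.continuous.continuousAt).const_add _
    convert h1 using 2 with y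
    rw [← intervalIntegral.integral_Iic_sub_Iic hI.integrableOn hI.integrableOn]; ring
  have hderiv : deriv (fun x => ∫ v in Set.Iic x, χ v) = χ := funext fun x => (hd x).deriv
  refine ⟨contDiff_infty_iff_deriv.2 ⟨fun x => (hd x).differentiableAt, by rwa [hderiv]⟩, ?_, hderiv⟩
  refine HasCompactSupport.of_support_subset_isCompact (isCompact_Icc (a := -R) (b := R)) ?_
  intro x hx
  by_contra hx'
  apply hx
  rw [Set.mem_Icc, not_and_or, not_le, not_le] at hx'
  rcases hx' with h | h
  · refine setIntegral_eq_zero_of_forall_eq_zero fun v hv => hz v ?_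
    rw [Set.mem_Icc]; intro h'; linarith [Set.mem_Iic.1 hv]
  -- To the right of the support the primitive has collected the whole integral of χ, which is zero.
  · change ∫ v in Set.Iic x, χ v = 0
    rw [← h0]
    refine setIntegral_eq_integral_of_forall_compl_eq_zero fun v hv => hz v ?_
    rw [Set.mem_Icc]; intro h'; exact hv (Set.mem_Iic.2 (by linarith))

/-- A locally integrable function with zero distributional derivative is constant. -/
theorem ae_eq_const_of_weakDeriv_zero {h : ℝ → ℂ} (hh : LocallyIntegrable h volume)
    (H : ∀ φ : ℝ → ℝ, ContDiff ℝ ∞ φ → HasCompactSupport φ → ∫ x, deriv φ x • h x = 0) :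
    ∃ c : ℂ, ∀ᵐ x, h x = c := by
  let b : ContDiffBump (0 : ℝ) := ⟨1, 2, one_pos, one_lt_two⟩
  let ψ := b.normed volume
  have hψ : ContDiff ℝ ∞ ψ := b.contDiff_normed
  have hψc : HasCompactSupport ψ := b.hasCompactSupport_normed
  have hψ1 : ∫ x, ψ x = 1 := b.integral_normed
  refine ⟨∫ x, ψ x • h x, ?_⟩
  refine ae_eq_of_integral_contDiff_smul_eq hh (locallyIntegrable_const _) fun φ hφ hφc => ?_
  have hi : ∀ g : ℝ → ℝ, ContDiff ℝ ∞ g → HasCompactSupport g →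
      Integrable (fun x => g x • h x) volume := fun g hg hgc =>
    hh.integrable_smul_left_of_hasCompactSupport hg.continuous hgc
  have hφI : Integrable φ volume := hφ.continuous.integrable_of_hasCompactSupport hφc
  have hψI : Integrable ψ volume := hψ.continuous.integrable_of_hasCompactSupport hψc
  set m := ∫ x, φ x with hm
  -- Since ψ has integral one, φ - mψ has mean zero and is the derivative of a test function; the
  -- hypothesis applied to that function gives ∫ φh = m ∫ ψh.
  obtain ⟨Φ, h1, h2, h3⟩ := exists_testFunction_primitive
    (χ := fun x => φ x - m * ψ x) (hφ.sub (contDiff_const.mul hψ))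
    (hφc.sub (HasCompactSupport.mul_left hψc)) (by
      rw [integral_sub hφI (hψI.const_mul m), integral_const_mul, hψ1, mul_one, hm, sub_self])
  have h4 := H Φ h1 h2
  rw [h3] at h4
  have h5 : ∀ x, (φ x - m * ψ x) • h x = φ x • h x - (m : ℂ) * (ψ x • h x) := by
    intro x; simp only [Complex.real_smul]; push_cast; ring
  simp only [h5] at h4
  rw [integral_sub (hi φ hφ hφc) ((hi ψ hψ hψc).const_mul _), integral_const_mul] at h4
  rw [integral_smul_const, ← hm, Complex.real_smul]
  exact sub_eq_zero.1 h4

/-- Integrating the derivative of φ times the primitive of g shows that f minus this primitive has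
zero distributional derivative. -/
theorem exists_primitive_of_weakDeriv {f g : ℝ → ℂ} (hf : LocallyIntegrable f volume)
    (hg : LocallyIntegrable g volume)
    (H : ∀ φ : ℝ → ℝ, ContDiff ℝ ∞ φ → HasCompactSupport φ →
      ∫ x, deriv φ x • f x = -∫ x, φ x • g x) :
    ∃ c : ℂ, ∀ᵐ x, f x = c + ∫ v in (0 : ℝ)..x, g v := by
  have hp := LocAC.primitive hg 0
  have hpl := hp.continuous.locallyIntegrable (μ := volume)
  obtain ⟨c, hc⟩ := ae_eq_const_of_weakDeriv_zero (hf.sub hpl) (fun φ hφ hφc => by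
    have hφ' : ContDiff ℝ ∞ (deriv φ) := ((contDiff_infty_iff_deriv).1 hφ).2
    have hφ1 : ∀ x, HasDerivAt (fun x => (φ x : ℂ)) ((deriv φ x : ℝ) : ℂ) x := fun x =>
      ((hφ.differentiable (by simp)) x).hasDerivAt.ofReal_comp
    have hac : LocAC fun x => (φ x : ℂ) * ∫ v in (0 : ℝ)..x, g v :=
      (LocAC.of_hasDerivAt hφ1 (Complex.continuous_ofReal.comp hφ'.continuous)).mul hp
    have i1 := hpl.integrable_smul_left_of_hasCompactSupport hφ'.continuous hφc.deriv
    have i2 := hg.integrable_smul_left_of_hasCompactSupport hφ.continuous hφc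
    have i3 := hf.integrable_smul_left_of_hasCompactSupport hφ'.continuous hφc.deriv
    have hcs : HasCompactSupport fun x => (φ x : ℂ) * ∫ v in (0 : ℝ)..x, g v :=
      (hφc.comp_left (g := ((↑) : ℝ → ℂ)) Complex.ofReal_zero).mul_right
    have := hac.integral_deriv_eq_zero
      (f' := fun x => deriv φ x • (∫ v in (0 : ℝ)..x, g v) + φ x • g x) (by
        filter_upwards [_root_.LocallyIntegrable.ae_hasDerivAt_integral hg] with x hx
        simp only [Complex.real_smul]
        exact (hφ1 x).fun_mul (hx 0)) (i1.add i2)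
      (tendsto_zero_of_hasCompactSupport hcs).1 (tendsto_zero_of_hasCompactSupport hcs).2
    rw [integral_add i1 i2] at this
    simp only [Pi.sub_apply, smul_sub]
    rw [integral_sub i3 i1, H φ hφ hφc, sub_eq_zero]
    exact (eq_neg_of_add_eq_zero_left this).symm)
  exact ⟨c, hc.mono fun x hx => by rw [← hx, Pi.sub_apply]; ring⟩

/-- A `C¹` function with locally absolutely continuous derivative, with its derivatives of
order one and two (the latter almost everywhere). -/
structure Jet where
  f : ℝ → ℂ
  f₁ : ℝ → ℂ
  f₂ : ℝ → ℂ
  hasDeriv : ∀ z, HasDerivAt f (f₁ z) z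
  locAC : LocAC f₁
  ae_hasDeriv : ∀ᵐ z, HasDerivAt f₁ (f₂ z) z
  meas : Measurable f₂

/-- Integrating the second weak derivative twice, with the right constants, recovers the data almost
everywhere. All pointwise calculus is done on this representative. -/
theorem MemWSobolev.exists_jet {s : ℝ} {A : ℝ → ℂ} (hA : MemWSobolev 2 s A) :
    ∃ J : Jet, J.f =ᵐ[volume] A ∧ J.f =ᵐ[volume] weakDeriv 0 A ∧
      J.f₁ =ᵐ[volume] weakDeriv 1 A ∧ J.f₂ =ᵐ[volume] weakDeriv 2 A := by
  obtain ⟨hL, hA⟩ := hA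
  have hAl : LocallyIntegrable A volume := hL.locallyIntegrable (by norm_num)
  have hw : ∀ j ≤ 2, IsWeakDeriv j A (weakDeriv j A) := by
    intro j hj
    have h := (hA j hj).1
    rw [weakDeriv, dif_pos h]
    exact h.choose_spec
  obtain ⟨l0, w0⟩ := hw 0 (by norm_num)
  obtain ⟨l1, w1⟩ := hw 1 (by norm_num)
  obtain ⟨l2, w2⟩ := hw 2 (by norm_num)
  have e0 : ∀ᵐ x, A x = weakDeriv 0 A x :=
    ae_eq_of_integral_contDiff_smul_eq hAl l0 fun φ h1 h2 => by simpa using w0 φ h1 h2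
  obtain ⟨c0, h0⟩ := exists_primitive_of_weakDeriv hAl l1 fun φ h1 h2 => by
    simpa [iteratedDeriv_one] using w1 φ h1 h2
  -- `weakDeriv 2 A` is tied to A, not to `weakDeriv 1 A`; testing the first-order identity with φ'
  -- supplies the link.
  obtain ⟨c1, h1⟩ := exists_primitive_of_weakDeriv l1 l2 fun φ h1 h2 => by
    have hφ' : ContDiff ℝ ∞ (deriv φ) := ((contDiff_infty_iff_deriv).1 h1).2
    have e1 := w1 _ hφ' h2.deriv
    have e2 := w2 φ h1 h2
    rw [iteratedDeriv_one] at e1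
    rw [iteratedDeriv_succ, iteratedDeriv_one] at e2
    simp only [pow_one, neg_mul, one_mul, even_two, Even.neg_pow, one_pow] at e1 e2
    rw [← e2, e1, neg_neg]
  have hm := l2.aestronglyMeasurable
  set g1 : ℝ → ℂ := fun x => c1 + ∫ v in (0 : ℝ)..x, weakDeriv 2 A v with hg1
  have ac1 : LocAC g1 := (LocAC.const c1).add (LocAC.primitive l2 0)
  set g0 : ℝ → ℂ := fun x => c0 + ∫ v in (0 : ℝ)..x, g1 v with hg0
  have e1 : g1 =ᵐ[volume] weakDeriv 1 A := h1.mono fun x hx => hx.symm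
  have hA0 : g0 =ᵐ[volume] A := by
    filter_upwards [h0] with x hx
    rw [hx]
    refine congrArg (c0 + ·) ?_
    exact intervalIntegral.integral_congr_ae (e1.mono fun x hx _ => hx)
  -- `Jet.meas` requires genuine measurability, hence a measurable version of `weakDeriv 2 A`.
  refine ⟨⟨g0, g1, hm.mk _, fun z => ?_, ac1, ?_, hm.stronglyMeasurable_mk.measurable⟩,
    hA0, hA0.trans e0, e1, hm.ae_eq_mk.symm⟩
  · exact (intervalIntegral.integral_hasDerivAt_right (ac1.continuous.intervalIntegrable _ _)
      (ac1.continuous.stronglyMeasurableAtFilter _ _) ac1.continuous.continuousAt).const_add _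
  · filter_upwards [_root_.LocallyIntegrable.ae_hasDerivAt_integral l2, hm.ae_eq_mk] with x hx hx'
    rw [← hx']
    exact (hx 0).const_add _

/-! ### The hyperbolic coordinate on the light cone -/

theorem jbr_sq (z : ℝ) : jbr z ^ 2 = 1 + z ^ 2 := Real.sq_sqrt (by positivity)

theorem jbr_pos (z : ℝ) : 0 < jbr z := Real.sqrt_pos.2 (by positivity)

theorem jbr_ne_zero (z : ℝ) : jbr z ≠ 0 := (jbr_pos z).ne'

theorem one_le_jbr (z : ℝ) : 1 ≤ jbr z := by
  rw [jbr, Real.one_le_sqrt]; nlinarith [sq_nonneg z]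

theorem abs_le_jbr (z : ℝ) : |z| ≤ jbr z :=
  Real.abs_le_sqrt (by linarith)

theorem hasDerivAt_jbr (z : ℝ) : HasDerivAt jbr (z / jbr z) z := by
  have h : HasDerivAt (fun z : ℝ => 1 + z ^ 2) (2 * z) z := by
    simpa using ((hasDerivAt_pow 2 z).const_add 1)
  have h2 := h.sqrt (by positivity)
  exact h2.congr_deriv (mul_div_mul_left _ _ two_ne_zero)

theorem continuous_jbr : Continuous jbr := by unfold jbr; fun_prop

/-- The velocity `z / ⟨z⟩` of the ray with hyperbolic coordinate `z`. -/
def vel (z : ℝ) : ℝ := z / jbr z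

/-- Source of the Jacobian t⟨z⟩⁻³ in every integral over the cone. -/
theorem hasDerivAt_vel (z : ℝ) : HasDerivAt vel (jbr z ^ 3)⁻¹ z := by
  have h := (hasDerivAt_id' z).fun_div (hasDerivAt_jbr z) (jbr_ne_zero z)
  refine h.congr_deriv ?_
  have := jbr_ne_zero z
  have := jbr_sq z
  field_simp
  linarith

theorem continuous_vel : Continuous vel :=
  continuous_iff_continuousAt.2 fun z => (hasDerivAt_vel z).continuousAt

theorem vel_sq (z : ℝ) : vel z ^ 2 = 1 - (jbr z ^ 2)⁻¹ := by
  have := jbr_ne_zero z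
  have := jbr_sq z
  unfold vel
  field_simp
  linarith

theorem abs_vel_lt_one (z : ℝ) : |vel z| < 1 := by
  rw [← sq_lt_one_iff_abs_lt_one, vel_sq]
  have : 0 < (jbr z ^ 2)⁻¹ := inv_pos.2 (pow_pos (jbr_pos z) 2)
  linarith

/-- Along the ray of coordinate z the phase θ is therefore -t/⟨z⟩, linear in t. -/
theorem sqrt_sub_vel {t : ℝ} (ht : 0 < t) (z : ℝ) :
    Real.sqrt (t ^ 2 - (t * vel z) ^ 2) = t / jbr z := by
  rw [mul_pow, vel_sq, show t ^ 2 - t ^ 2 * (1 - (jbr z ^ 2)⁻¹) = (t / jbr z) ^ 2 by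
    rw [div_pow]; ring]
  exact Real.sqrt_sq (div_pos ht (jbr_pos z)).le

theorem mu_vel {t : ℝ} (ht : 0 < t) (z : ℝ) : mu t (t * vel z) = z := by
  have := jbr_ne_zero z
  rw [mu, sqrt_sub_vel ht, vel]
  field_simp

theorem abs_mul_vel_lt {t : ℝ} (ht : 0 < t) (z : ℝ) : |t * vel z| < t := by
  rw [abs_mul, abs_of_pos ht]
  nlinarith [abs_vel_lt_one z]

theorem jbr_mu {t x : ℝ} (hx : |x| < t) : jbr (mu t x) = t / Real.sqrt (t ^ 2 - x ^ 2) := by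
  have ht : 0 < t := (abs_nonneg x).trans_lt hx
  have h : 0 < t ^ 2 - x ^ 2 := by
    have := sq_lt_sq' (abs_lt.1 hx).1 (abs_lt.1 hx).2
    linarith
  have h2 : 1 + mu t x ^ 2 = (t / Real.sqrt (t ^ 2 - x ^ 2)) ^ 2 := by
    rw [mu, div_pow, div_pow, Real.sq_sqrt h.le]
    field_simp
    ring
  rw [jbr, h2]
  exact Real.sqrt_sq (by positivity)

theorem theta_eq {t x : ℝ} (hx : |x| < t) : theta t x = -(t / jbr (mu t x)) := by
  have ht : 0 < t := (abs_nonneg x).trans_lt hx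
  rw [jbr_mu hx, theta, div_div_cancel₀ ht.ne']

theorem vel_mu {t x : ℝ} (hx : |x| < t) : t * vel (mu t x) = x := by
  have ht : 0 < t := (abs_nonneg x).trans_lt hx
  have h : 0 < Real.sqrt (t ^ 2 - x ^ 2) := by
    have := sq_lt_sq' (abs_lt.1 hx).1 (abs_lt.1 hx).2
    exact Real.sqrt_pos.2 (by linarith)
  rw [vel, jbr_mu hx, mu]
  field_simp

theorem image_vel {t : ℝ} (ht : 0 < t) :
    (fun z => t * vel z) '' Set.univ = {x | |x| < t} := by
  ext x
  constructor
  · rintro ⟨z, -, rfl⟩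
    exact abs_mul_vel_lt ht z
  · exact fun hx => ⟨mu t x, trivial, vel_mu hx⟩

theorem injOn_vel {t : ℝ} (ht : 0 < t) : Set.InjOn (fun z => t * vel z) Set.univ := by
  intro z _ w _ h
  rw [← mu_vel ht z, ← mu_vel ht w]
  exact congrArg (mu t) h

/-- The function equal to `g (μ(t,x))` inside the light cone and to `0` outside. -/
def coneLift (t : ℝ) (g : ℝ → ℂ) (x : ℝ) : ℂ := if |x| < t then g (mu t x) else 0

theorem coneLift_vel {t : ℝ} (ht : 0 < t) (g : ℝ → ℂ) (z : ℝ) : coneLift t g (t * vel z) = g z := by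
  rw [coneLift, if_pos (abs_mul_vel_lt ht z), mu_vel ht]

theorem measurableSet_cone (t : ℝ) : MeasurableSet {x : ℝ | |x| < t} :=
  measurableSet_lt measurable_norm measurable_const

theorem measurable_coneLift (t : ℝ) {g : ℝ → ℂ} (hg : Measurable g) : Measurable (coneLift t g) := by
  refine Measurable.ite (measurableSet_cone t) (hg.comp ?_) measurable_const
  unfold mu
  fun_prop

/-- z ↦ t z/⟨z⟩ is differentiable and so maps null sets to null sets. Changing the data on a null
set thus changes the profile at each time only on a null set. -/
theorem ae_mu_of_ae (t : ℝ) {P : ℝ → Prop} (h : ∀ᵐ z, P z) : ∀ᵐ x, |x| < t → P (mu t x) := by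
  have h0 : volume ((fun z => t * vel z) '' {z | ¬ P z}) = 0 :=
    addHaar_image_eq_zero_of_differentiableOn_of_addHaar_eq_zero volume
      (fun z _ => ((hasDerivAt_vel z).const_mul t).differentiableAt.differentiableWithinAt) h
  refine measure_mono_null (fun x hx => ?_) h0
  obtain ⟨hxt, hP⟩ := Classical.not_imp.1 hx
  exact ⟨mu t x, hP, vel_mu hxt⟩

theorem coneLift_congr_ae (t : ℝ) {g g' : ℝ → ℂ} (h : g =ᵐ[volume] g') :
    coneLift t g =ᵐ[volume] coneLift t g' := by
  filter_upwards [ae_mu_of_ae t h] with x hx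
  by_cases hxt : |x| < t
  · simp [coneLift, hxt, hx hxt]
  · simp [coneLift, hxt]

theorem lintegral_coneLift {t : ℝ} (ht : 0 < t) (F : ℝ → ℝ≥0∞) (hF : ∀ x, ¬ |x| < t → F x = 0) :
    ∫⁻ x, F x = ∫⁻ z, ENNReal.ofReal (t * (jbr z ^ 3)⁻¹) * F (t * vel z) := by
  have h := lintegral_image_eq_lintegral_abs_deriv_mul (s := Set.univ) (f := fun z => t * vel z)
    (f' := fun z => t * (jbr z ^ 3)⁻¹) MeasurableSet.univ
    (fun z _ => ((hasDerivAt_vel z).const_mul t).hasDerivWithinAt) (injOn_vel ht) F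
  rw [image_vel ht, setLIntegral_univ] at h
  rw [← setLIntegral_eq_of_support_subset (s := {x | |x| < t}) (fun x hx => by
    by_contra h'; exact hx (hF x h')), h]
  refine lintegral_congr fun z => ?_
  rw [abs_of_pos (mul_pos ht (inv_pos.2 (pow_pos (jbr_pos z) 3)))]

theorem integral_coneLift {t : ℝ} (ht : 0 < t) (φ : ℝ → ℝ) (g : ℝ → ℂ) :
    ∫ x, φ x • coneLift t g x = ∫ z, (t * (jbr z ^ 3)⁻¹ : ℝ) • φ (t * vel z) • g z := by
  have h := integral_image_eq_integral_abs_deriv_smul (s := Set.univ) (f := fun z => t * vel z)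
    (f' := fun z => t * (jbr z ^ 3)⁻¹) MeasurableSet.univ
    (fun z _ => ((hasDerivAt_vel z).const_mul t).hasDerivWithinAt) (injOn_vel ht)
    (fun x => φ x • coneLift t g x)
  rw [image_vel ht, setIntegral_univ] at h
  rw [← setIntegral_eq_integral_of_forall_compl_eq_zero (s := {x | |x| < t}) (fun x hx => by
    have : ¬ |x| < t := hx
    simp [coneLift, this]), h]
  refine integral_congr_ae (Eventually.of_forall fun z => ?_)
  simp only [coneLift_vel ht]
  rw [abs_of_pos (mul_pos ht (inv_pos.2 (pow_pos (jbr_pos z) 3)))]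

theorem eLpNorm_two_sq {α : Type*} [MeasurableSpace α] {ν : Measure α} {E : Type*}
    [NormedAddCommGroup E] (g : α → E) : eLpNorm g 2 ν = (∫⁻ x, ‖g x‖ₑ ^ 2 ∂ν) ^ (1 / 2 : ℝ) := by
  rw [eLpNorm_eq_lintegral_rpow_enorm_toReal (by norm_num) (by norm_num)]
  simp

/-- `L²` norms at time `t` in the hyperbolic coordinate, for functions vanishing outside the
light cone. -/
theorem eLpNorm_coneLift {E : Type*} [NormedAddCommGroup E] [NormedSpace ℝ E] {t : ℝ} (ht : 0 < t)
    (F : ℝ → E) (hF : ∀ x, ¬ |x| < t → F x = 0) :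
    eLpNorm F 2 volume =
      eLpNorm (fun z => Real.sqrt (t * (jbr z ^ 3)⁻¹) • F (t * vel z)) 2 volume := by
  rw [eLpNorm_two_sq, eLpNorm_two_sq,
    lintegral_coneLift ht (fun x => ‖F x‖ₑ ^ 2) (fun x hx => by simp [hF x hx])]
  congr 1
  refine lintegral_congr fun z => ?_
  have h0 : 0 ≤ t * (jbr z ^ 3)⁻¹ := (mul_pos ht (inv_pos.2 (pow_pos (jbr_pos z) 3))).le
  rw [enorm_smul, mul_pow, Real.enorm_eq_ofReal (Real.sqrt_nonneg _),
    ← ENNReal.ofReal_pow (Real.sqrt_nonneg _), Real.sq_sqrt h0]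

theorem integrable_inv_jbr_sq : Integrable (fun z => (jbr z ^ 2)⁻¹) volume := by
  simp only [jbr_sq]
  exact integrable_inv_one_add_sq

theorem integrable_inv_jbr_cube : Integrable (fun z => (jbr z ^ 3)⁻¹) volume := by
  refine integrable_inv_jbr_sq.mono' ?_ (Eventually.of_forall fun z => ?_)
  · exact ((continuous_jbr.pow 3).inv₀ fun z => pow_ne_zero 3 (jbr_ne_zero z)).aestronglyMeasurable
  · rw [Real.norm_of_nonneg (inv_nonneg.2 (pow_pos (jbr_pos z) 3).le)]
    exact inv_anti₀ (pow_pos (jbr_pos z) 2) (pow_le_pow_right₀ (one_le_jbr z) (by norm_num))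

/-! ### Calculus of jets and their pointwise bounds -/

namespace Jet

theorem continuous (J : Jet) : Continuous J.f :=
  continuous_iff_continuousAt.2 fun z => (J.hasDeriv z).continuousAt

theorem continuous₁ (J : Jet) : Continuous J.f₁ := J.locAC.continuous

theorem locAC₀ (J : Jet) : LocAC J.f := LocAC.of_hasDerivAt J.hasDeriv J.continuous₁

/-- Sum of two jets. -/
def add (J L : Jet) : Jet where
  f z := J.f z + L.f z
  f₁ z := J.f₁ z + L.f₁ z
  f₂ z := J.f₂ z + L.f₂ z
  hasDeriv z := (J.hasDeriv z).fun_add (L.hasDeriv z)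
  locAC := J.locAC.add L.locAC
  ae_hasDeriv := by
    filter_upwards [J.ae_hasDeriv, L.ae_hasDeriv] with z h h' using h.fun_add h'
  meas := J.meas.add L.meas

/-- Product of two jets. -/
def mul (J L : Jet) : Jet where
  f z := J.f z * L.f z
  f₁ z := J.f₁ z * L.f z + J.f z * L.f₁ z
  f₂ z := J.f₂ z * L.f z + 2 * (J.f₁ z * L.f₁ z) + J.f z * L.f₂ z
  hasDeriv z := (J.hasDeriv z).fun_mul (L.hasDeriv z)
  locAC := (J.locAC.mul L.locAC₀).add (J.locAC₀.mul L.locAC)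
  ae_hasDeriv := by
    filter_upwards [J.ae_hasDeriv, L.ae_hasDeriv] with z h h'
    exact ((h.fun_mul (L.hasDeriv z)).fun_add ((J.hasDeriv z).fun_mul h')).congr_deriv (by ring)
  meas := ((J.meas.mul L.continuous.measurable).add
    ((J.continuous₁.measurable.mul L.continuous₁.measurable).const_mul 2)).add
      (J.continuous.measurable.mul L.meas)

/-- Complex conjugate of a jet. -/
def conj (J : Jet) : Jet where
  f z := (starRingEnd ℂ) (J.f z)
  f₁ z := (starRingEnd ℂ) (J.f₁ z)
  f₂ z := (starRingEnd ℂ) (J.f₂ z)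
  hasDeriv z := (J.hasDeriv z).star
  locAC := J.locAC.conj
  ae_hasDeriv := J.ae_hasDeriv.mono fun _ h => h.star
  meas := Complex.continuous_conj.measurable.comp J.meas

/-- Constant multiple of a jet. -/
def smul (c : ℂ) (J : Jet) : Jet where
  f z := c * J.f z
  f₁ z := c * J.f₁ z
  f₂ z := c * J.f₂ z
  hasDeriv z := (J.hasDeriv z).const_mul c
  locAC := (LocAC.const c).mul J.locAC
  ae_hasDeriv := J.ae_hasDeriv.mono fun _ h => h.const_mul c
  meas := J.meas.const_mul c

/-- The jet of `⟨z⟩⁻¹`. -/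
def invJbr : Jet where
  f z := (((jbr z)⁻¹ : ℝ) : ℂ)
  f₁ z := ((-(z / jbr z ^ 3) : ℝ) : ℂ)
  f₂ z := ((3 * z ^ 2 / jbr z ^ 5 - 1 / jbr z ^ 3 : ℝ) : ℂ)
  hasDeriv z := by
    have h := (hasDerivAt_jbr z).fun_inv (jbr_ne_zero z)
    have := jbr_ne_zero z
    refine h.ofReal_comp.congr_deriv (congrArg _ ?_)
    field_simp
  locAC := by
    refine LocAC.of_contDiff (Complex.ofRealCLM.contDiff.comp ?_)
    unfold jbr
    have : ContDiff ℝ 1 fun z : ℝ => Real.sqrt (1 + z ^ 2) :=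
      ContDiff.sqrt (by fun_prop) fun z => by positivity
    exact (contDiff_id.div (this.pow 3) fun z => pow_ne_zero 3 (jbr_ne_zero z)).neg
  ae_hasDeriv := Eventually.of_forall fun z => by
    have h := ((hasDerivAt_id' z).fun_div ((hasDerivAt_jbr z).fun_pow 3)
      (pow_ne_zero 3 (jbr_ne_zero z))).fun_neg
    have := jbr_ne_zero z
    refine h.ofReal_comp.congr_deriv (congrArg _ ?_)
    field_simp
    ring
  meas := by
    have := continuous_jbr.measurable
    fun_prop

end Jet

/-- Pointwise bounds of a jet of homogeneity `p + 1` in the data: `k` controls the data and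
their first derivatives, `h` also the second derivatives, and `K` is a uniform bound. -/
structure JetBound (K : ℝ) (k h : ℝ → ℝ) (c : ℝ) (p : ℕ) (J : Jet) : Prop where
  b₀ : ∀ z, ‖J.f z‖ ≤ c * K ^ p * k z
  b₁ : ∀ z, ‖J.f₁ z‖ ≤ c * K ^ p * k z
  b₂ : ∀ z, ‖J.f₂ z‖ ≤ c * K ^ p * h z

/-- The relations between the control functions used in `JetBound`. -/
structure Controls (K : ℝ) (k h : ℝ → ℝ) : Prop where
  nonneg : ∀ z, 0 ≤ k z
  le_h : ∀ z, k z ≤ h z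
  decay : ∀ z, jbr z ^ 2 * k z ≤ K

namespace Controls
variable {K : ℝ} {k h : ℝ → ℝ}

theorem K_nonneg (H : Controls K k h) : 0 ≤ K :=
  (mul_nonneg (sq_nonneg _) (H.nonneg 0)).trans (H.decay 0)

theorem le_K (H : Controls K k h) (z : ℝ) : k z ≤ K := by
  have h1 : 1 ≤ jbr z ^ 2 := one_le_pow₀ (one_le_jbr z)
  nlinarith [H.decay z, H.nonneg z]

theorem h_nonneg (H : Controls K k h) (z : ℝ) : 0 ≤ h z := (H.nonneg z).trans (H.le_h z)

end Controls

namespace JetBound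
variable {K c c' : ℝ} {k h : ℝ → ℝ} {p q : ℕ} {J J' : Jet}

theorem add (hJ : JetBound K k h c p J) (hJ' : JetBound K k h c' p J') :
    JetBound K k h (c + c') p (J.add J') where
  b₀ z := (norm_add_le _ _).trans (by linarith [hJ.b₀ z, hJ'.b₀ z])
  b₁ z := (norm_add_le _ _).trans (by linarith [hJ.b₁ z, hJ'.b₁ z])
  b₂ z := (norm_add_le _ _).trans (by linarith [hJ.b₂ z, hJ'.b₂ z])

theorem conj (hJ : JetBound K k h c p J) : JetBound K k h c p J.conj where
  b₀ z := (RCLike.norm_conj _).trans_le (hJ.b₀ z)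
  b₁ z := (RCLike.norm_conj _).trans_le (hJ.b₁ z)
  b₂ z := (RCLike.norm_conj _).trans_le (hJ.b₂ z)

theorem smul (a : ℂ) (hJ : JetBound K k h c p J) : JetBound K k h (‖a‖ * c) p (J.smul a) where
  b₀ z := (norm_mul _ _).trans_le (by
    rw [mul_assoc, mul_assoc, ← mul_assoc c]; gcongr; exact hJ.b₀ z)
  b₁ z := (norm_mul _ _).trans_le (by
    rw [mul_assoc, mul_assoc, ← mul_assoc c]; gcongr; exact hJ.b₁ z)
  b₂ z := (norm_mul _ _).trans_le (by
    rw [mul_assoc, mul_assoc, ← mul_assoc c]; gcongr; exact hJ.b₂ z)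

theorem mono (H : Controls K k h) (hc : c ≤ c') (hJ : JetBound K k h c p J) :
    JetBound K k h c' p J := by
  have hK := pow_nonneg H.K_nonneg p
  refine ⟨fun z => (hJ.b₀ z).trans ?_, fun z => (hJ.b₁ z).trans ?_, fun z => (hJ.b₂ z).trans ?_⟩
  · have := H.nonneg z; gcongr
  · have := H.nonneg z; gcongr
  · have := H.h_nonneg z; gcongr

/-- In each Leibniz term at most one factor carries a second derivative; another factor is
controlled by k ≤ K, which supplies the additional power of K. The factor 4 = 1 + 2 + 1 counts the
terms of (fg)''. -/
theorem mul (H : Controls K k h) (hc : 0 ≤ c) (hc' : 0 ≤ c')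
    (hJ : JetBound K k h c p J) (hJ' : JetBound K k h c' q J') :
    JetBound K k h (4 * (c * c')) (p + q + 1) (J.mul J') := by
  have hK := H.K_nonneg
  have key : ∀ z {X Y : ℂ} {x y : ℝ}, ‖X‖ ≤ c * K ^ p * x → ‖Y‖ ≤ c' * K ^ q * y →
      0 ≤ x → 0 ≤ y → x * y ≤ K * z → ‖X * Y‖ ≤ c * c' * K ^ (p + q + 1) * z := by
    intro z X Y x y hX hY hx hy hxy
    rw [norm_mul]
    calc ‖X‖ * ‖Y‖ ≤ (c * K ^ p * x) * (c' * K ^ q * y) := by gcongr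
      _ = c * c' * K ^ (p + q) * (x * y) := by rw [pow_add]; ring
      _ ≤ c * c' * K ^ (p + q) * (K * z) := by gcongr
      _ = c * c' * K ^ (p + q + 1) * z := by rw [pow_succ]; ring
  have k0 := H.nonneg
  have h0 := H.h_nonneg
  have kk : ∀ z, k z * k z ≤ K * k z := fun z => mul_le_mul_of_nonneg_right (H.le_K z) (k0 z)
  have kh : ∀ z, k z * h z ≤ K * h z := fun z => mul_le_mul_of_nonneg_right (H.le_K z) (h0 z)
  have hk : ∀ z, h z * k z ≤ K * h z := fun z => by rw [mul_comm]; exact kh z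
  have kkh : ∀ z, k z * k z ≤ K * h z := fun z =>
    (kk z).trans (mul_le_mul_of_nonneg_left (H.le_h z) hK)
  have pos : ∀ z, 0 ≤ c * c' * K ^ (p + q + 1) * k z := fun z => by
    have := k0 z; positivity
  refine ⟨fun z => ?_, fun z => ?_, fun z => ?_⟩
  · have := key (k z) (hJ.b₀ z) (hJ'.b₀ z) (k0 z) (k0 z) (kk z)
    have := pos z
    change ‖J.f z * J'.f z‖ ≤ _
    linarith
  · have h1 := key (k z) (hJ.b₁ z) (hJ'.b₀ z) (k0 z) (k0 z) (kk z)
    have h2 := key (k z) (hJ.b₀ z) (hJ'.b₁ z) (k0 z) (k0 z) (kk z)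
    have := pos z
    refine (norm_add_le _ _).trans ?_
    linarith
  · have h1 := key (h z) (hJ.b₂ z) (hJ'.b₀ z) (h0 z) (k0 z) (hk z)
    have h2 := key (h z) (hJ.b₁ z) (hJ'.b₁ z) (k0 z) (k0 z) (kkh z)
    have h3 := key (h z) (hJ.b₀ z) (hJ'.b₂ z) (k0 z) (h0 z) (kh z)
    refine (norm_add₃_le).trans ?_
    rw [norm_mul (2 : ℂ), Complex.norm_ofNat]
    linarith

theorem norm_invJbr (z : ℝ) :
    ‖Jet.invJbr.f z‖ ≤ 1 ∧ ‖Jet.invJbr.f₁ z‖ ≤ 1 ∧ ‖Jet.invJbr.f₂ z‖ ≤ 4 := by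
  have h1 := one_le_jbr z
  have h0 := jbr_pos z
  have h2 := abs_le_jbr z
  have h3 := jbr_sq z
  refine ⟨?_, ?_, ?_⟩ <;> simp only [Jet.invJbr, Complex.norm_real, Real.norm_eq_abs]
  · rw [abs_of_pos (inv_pos.2 h0)]
    exact inv_le_one_of_one_le₀ h1
  · rw [abs_neg, abs_div, abs_of_pos (pow_pos h0 3), div_le_one (pow_pos h0 3)]
    exact h2.trans (le_self_pow₀ h1 (by norm_num))
  · have e : 3 * z ^ 2 / jbr z ^ 5 - 1 / jbr z ^ 3
        = 3 * (z ^ 2 / jbr z ^ 5) - 1 / jbr z ^ 3 := by ring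
    have a1 : 1 / jbr z ^ 3 ≤ 1 := (div_le_one (pow_pos h0 3)).2 (one_le_pow₀ h1)
    have a2 : z ^ 2 / jbr z ^ 5 ≤ 1 := (div_le_one (pow_pos h0 5)).2
      ((by linarith : z ^ 2 ≤ jbr z ^ 2).trans (pow_le_pow_right₀ h1 (by norm_num)))
    have a3 : 0 ≤ 1 / jbr z ^ 3 := by positivity
    have a4 : 0 ≤ z ^ 2 / jbr z ^ 5 := by positivity
    rw [e, abs_le]
    constructor <;> linarith

/-- The bracket is not part of the data, so the degree p does not change. The constant is 7 = 4 + 2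
+ 1, from the Leibniz rule with the bounds 1, 1, 4 on ⟨z⟩⁻¹ and its derivatives. -/
theorem invJbr_mul (H : Controls K k h) (hc : 0 ≤ c) (hJ : JetBound K k h c p J) :
    JetBound K k h (7 * c) p (Jet.invJbr.mul J) := by
  have hK := H.K_nonneg
  have key : ∀ {X Y : ℂ} {x y : ℝ}, ‖X‖ ≤ x → ‖Y‖ ≤ y → ‖X * Y‖ ≤ x * y := by
    intro X Y x y hX hY
    rw [norm_mul]
    exact mul_le_mul hX hY (norm_nonneg _) ((norm_nonneg _).trans hX)
  have pos : ∀ z, 0 ≤ c * K ^ p * k z := fun z => by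
    have := H.nonneg z; positivity
  have posh : ∀ z, c * K ^ p * k z ≤ c * K ^ p * h z := fun z => by
    have := H.le_h z; gcongr
  refine ⟨fun z => ?_, fun z => ?_, fun z => ?_⟩ <;> obtain ⟨n0, n1, n2⟩ := norm_invJbr z <;>
    have p1 := pos z <;> have p2 := posh z
  · have := key n0 (hJ.b₀ z)
    change ‖Jet.invJbr.f z * J.f z‖ ≤ _
    linarith
  · have h1 := key n1 (hJ.b₀ z)
    have h2 := key n0 (hJ.b₁ z)
    refine (norm_add_le _ _).trans ?_
    linarith
  · have h1 := key n2 (hJ.b₀ z)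
    have h2 := key n1 (hJ.b₁ z)
    have h3 := key n0 (hJ.b₂ z)
    refine (norm_add₃_le).trans ?_
    rw [norm_mul (2 : ℂ), Complex.norm_ofNat]
    linarith

end JetBound

/-! ### Differentiation under the integral and the algebra of the flux -/

theorem integrable_coneLift_iff {t : ℝ} (ht : 0 < t) (g : ℝ → ℂ) :
    Integrable (coneLift t g) volume ↔
      Integrable (fun z => (t * (jbr z ^ 3)⁻¹ : ℝ) • g z) volume := by
  have h := integrableOn_image_iff_integrableOn_abs_deriv_smul (s := Set.univ)
    (f := fun z => t * vel z) (f' := fun z => t * (jbr z ^ 3)⁻¹) MeasurableSet.univ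
    (fun z _ => ((hasDerivAt_vel z).const_mul t).hasDerivWithinAt) (injOn_vel ht)
    (coneLift t g)
  rw [image_vel ht, integrableOn_univ,
    integrableOn_iff_integrable_of_support_subset (fun x hx => by
      by_contra h'; exact hx (by
        have : ¬ |x| < t := h'
        simp [coneLift, this]))] at h
  rw [h]
  simp only [coneLift_vel ht, abs_of_pos (mul_pos ht (inv_pos.2 (pow_pos (jbr_pos _) 3)))]

theorem exists_rpow_le (r : ℝ) {t : ℝ} (ht : 0 < t) :
    ∃ C, 0 ≤ C ∧ ∀ s ∈ Set.Ioo (t / 2) (2 * t), s ^ r ≤ C := by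
  obtain ⟨C, hC⟩ := (isCompact_Icc (a := t / 2) (b := 2 * t)).exists_bound_of_continuousOn
    (f := fun s : ℝ => s ^ r) (fun s hs => by
      refine (Real.continuousAt_rpow_const _ _ (Or.inl ?_)).continuousWithinAt
      linarith [hs.1])
  refine ⟨|C|, abs_nonneg C, fun s hs => ?_⟩
  exact (Real.le_norm_self _).trans ((hC s ⟨hs.1.le, hs.2.le⟩).trans (le_abs_self C))

/-- Differentiation under the integral sign, locally uniformly dominated on `(0, ∞)`. -/
theorem hasDerivAt_integral_of_locally_dominated {F F' : ℝ → ℝ → ℂ} {w : ℝ → ℝ}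
    (hw : Integrable w volume) (hF : ∀ s, 0 < s → Continuous (F s))
    (hF' : ∀ s, 0 < s → Continuous (F' s))
    (hd : ∀ s, 0 < s → ∀ z, HasDerivAt (fun s => F s z) (F' s z) s)
    (hb : ∀ t, 0 < t → ∃ C, ∀ s ∈ Set.Ioo (t / 2) (2 * t), ∀ z, ‖F s z‖ ≤ C * w z)
    (hb' : ∀ t, 0 < t → ∃ C, ∀ s ∈ Set.Ioo (t / 2) (2 * t), ∀ z, ‖F' s z‖ ≤ C * w z)
    {t : ℝ} (ht : 0 < t) :
    Integrable (F' t) volume ∧ HasDerivAt (fun s => ∫ z, F s z) (∫ z, F' t z) t := by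
  have hn : Set.Ioo (t / 2) (2 * t) ∈ nhds t := Ioo_mem_nhds (by linarith) (by linarith)
  have hpos : ∀ s ∈ Set.Ioo (t / 2) (2 * t), 0 < s := fun s hs => by linarith [hs.1]
  obtain ⟨C, hC⟩ := hb t ht
  obtain ⟨C', hC'⟩ := hb' t ht
  refine hasDerivAt_integral_of_dominated_loc_of_deriv_le hn ?_ ?_
    (hF' t ht).aestronglyMeasurable
    (Eventually.of_forall fun z s hs => hC' s hs z) (hw.const_mul C')
    (Eventually.of_forall fun z s hs => hd s (hpos s hs) z)
  · filter_upwards [hn] with s hs using (hF s (hpos s hs)).aestronglyMeasurable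
  · exact (hw.const_mul C).mono' (hF t ht).aestronglyMeasurable
      (Eventually.of_forall fun z => hC t (mem_of_mem_nhds hn) z)

/-- The coefficient of the undifferentiated test function in `Mode.hasDerivAt_flux`, with k = iκ, s
= iS, L = log t. The left side is the z-derivative of an amplitude of the flux plus that amplitude
times the logarithmic derivative of the oscillation; the right side collects the terms of `ker₂`,
`ker` and the source. Once denominators are cleared it is a polynomial identity modulo z² = j² - 1.
-/
theorem flux_identity {j z t k r L f f1 f2 s s1 s2 : ℂ} (hj : j ≠ 0) (ht : t ≠ 0)
    (h : j ^ 2 = 1 + z ^ 2) :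
    (2 / t * (1 / j ^ 3) * ((r + s) / t + k / j) * f
        + 2 / t * (z / j) * (s1 / t - k * z / j ^ 3) * f
        + 2 / t * (z / j) * ((r + s) / t + k / j) * f1
        + (z / j * (f1 + (-k * t * z / j ^ 3 + s1 * L) * f)
          + j * (f2 + (-k * t * (1 / j ^ 3 - 3 * z ^ 2 / j ^ 5) + s2 * L) * f
            + (-k * t * z / j ^ 3 + s1 * L) * f1)
          - 2 * (1 / j ^ 3) * f - 2 * (z / j) * f1) / t ^ 2)
      + (-k * t * z / j ^ 3 + s1 * L) * (2 / t * (z / j) * ((r + s) / t + k / j) * f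
        + (j * (f1 + (-k * t * z / j ^ 3 + s1 * L) * f) - 2 * (z / j) * f) / t ^ 2)
    = (f * (((r + s) / t + k / j) ^ 2 - (r + s) / t ^ 2) + f
        - ((1 + k ^ 2) * f + j * (2 * k * s + k * (2 * r - 1)) * f / t
          + (((r + s) ^ 2 - (r + s)) * f
            - 2 * j ^ 3 * ((r + s) * f / j ^ 3 + z / j * s1 * f
              + z / j * (r + s) * (f1 + s1 * L * f))
            - j ^ 3 * (z / j * (f1 + s1 * L * f)
              + j * (f2 + s2 * L * f + s1 * L * f1 + s1 * L * (f1 + s1 * L * f))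
              - 2 * f / j ^ 3 - 2 * (z / j) * (f1 + s1 * L * f))) / t ^ 2)) / j ^ 3 := by
  field_simp
  have hz : z ^ 2 = j ^ 2 - 1 := by linear_combination -h
  ring_nf
  simp only [hz]
  ring

/-! ### Oscillating modes in the coordinates (t, z) -/

/-- An oscillating term `t^{r-1} f(z) e^{i(κ t/⟨z⟩ + S(z) log t)}` with real phase `S`. -/
structure Mode where
  r : ℝ
  κ : ℝ
  f : Jet
  S : Jet
  real : ∀ z, (S.f z).im = 0

namespace Mode
variable (m : Mode)

/-- The oscillating factor. -/
def osc (t z : ℝ) : ℂ :=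
  Complex.exp (Complex.I * m.κ * t / jbr z + Complex.I * m.S.f z * Real.log t)

/-- The value of the mode in the coordinates `(t, z)`. -/
def val (t z : ℝ) : ℂ := ((t ^ m.r / t : ℝ) : ℂ) * m.f.f z * m.osc t z

/-- The part of `(□ + 1)` of the mode that decays faster by `t⁻²`. -/
def rem (t z : ℝ) : ℂ :=
  let j : ℂ := jbr z
  let L : ℂ := Real.log t
  let s := Complex.I * m.S.f z
  let s1 := Complex.I * m.S.f₁ z
  let s2 := Complex.I * m.S.f₂ z
  let f := m.f.f z
  let f1 := m.f.f₁ z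
  let D := f1 + s1 * L * f
  ((m.r + s) ^ 2 - (m.r + s)) * f
    - 2 * j ^ 3 * ((m.r + s) * f / j ^ 3 + z / j * s1 * f + z / j * (m.r + s) * D)
    - j ^ 3 * (z / j * D + j * (m.f.f₂ z + s2 * L * f + s1 * L * f1 + s1 * L * D)
      - 2 * f / j ^ 3 - 2 * (z / j) * D)

/-- `(□ + 1)` of the mode in the coordinates `(t, z)`. -/
def src (t z : ℝ) : ℂ :=
  ((t ^ m.r / t : ℝ) : ℂ) * m.osc t z *
    ((1 + (Complex.I * m.κ) ^ 2) * m.f.f z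
      + jbr z * (2 * (Complex.I * m.κ) * (Complex.I * m.S.f z)
        + Complex.I * m.κ * (2 * m.r - 1)) * m.f.f z / t
      + m.rem t z / t ^ 2)

/-- The phase being real, the exponent is purely imaginary. -/
theorem norm_osc (t z : ℝ) : ‖m.osc t z‖ = 1 := by
  have h : ((m.S.f z).re : ℂ) = m.S.f z := by
    apply Complex.ext <;> simp [m.real z]
  have e : Complex.I * m.κ * t / jbr z + Complex.I * m.S.f z * Real.log t
      = ((m.κ * t / jbr z + (m.S.f z).re * Real.log t : ℝ) : ℂ) * Complex.I := by
    push_cast; rw [h]; ring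
  rw [osc, e, Complex.norm_exp_ofReal_mul_I]

theorem continuous_osc (t : ℝ) : Continuous (m.osc t) := by
  have h1 := continuous_jbr
  have h2 := m.S.continuous
  unfold osc
  refine Complex.continuous_exp.comp (Continuous.add (Continuous.div (by fun_prop) (by fun_prop)
    fun z => ?_) (by fun_prop))
  exact_mod_cast jbr_ne_zero z

/-- Logarithmic time derivative of `t · val`. -/
def rate (t z : ℝ) : ℂ :=
  (m.r + Complex.I * m.S.f z) / t + Complex.I * m.κ / jbr z

theorem hasDerivAt_osc_time {t : ℝ} (ht : 0 < t) (z : ℝ) :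
    HasDerivAt (fun t : ℝ => ((t ^ m.r : ℝ) : ℂ) * m.osc t z)
      (((t ^ m.r : ℝ) : ℂ) * m.osc t z * m.rate t z) t := by
  have h1 : HasDerivAt (fun t : ℝ => ((t ^ m.r : ℝ) : ℂ)) ((m.r * (t ^ m.r / t) : ℝ) : ℂ) t := by
    have := (Real.hasDerivAt_rpow_const (x := t) (p := m.r) (Or.inl ht.ne')).ofReal_comp
    rwa [Real.rpow_sub_one ht.ne'] at this
  have h2 : HasDerivAt (fun t : ℝ => Complex.I * m.κ * t / jbr z
      + Complex.I * m.S.f z * Real.log t)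
      (Complex.I * m.κ / jbr z + Complex.I * m.S.f z * ((t⁻¹ : ℝ) : ℂ)) t := by
    refine HasDerivAt.fun_add (HasDerivAt.div_const ?_ _)
      ((Real.hasDerivAt_log ht.ne').ofReal_comp.const_mul _)
    simpa using (hasDerivAt_id' t).ofReal_comp.const_mul (Complex.I * m.κ)
  refine (h1.fun_mul h2.cexp).congr_deriv ?_
  have h3 : (t : ℂ) ≠ 0 := by exact_mod_cast ht.ne'
  simp only [rate, osc]
  push_cast
  field_simp
  ring

/-- For κ ≠ 0 the term growing with t vanishes only at z = 0, the stationary point of the phase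
t/⟨z⟩. -/
theorem hasDerivAt_osc_space (t z : ℝ) :
    HasDerivAt (m.osc t) (m.osc t z *
      (-(Complex.I * m.κ) * t * z / (jbr z : ℂ) ^ 3 + Complex.I * m.S.f₁ z * Real.log t)) z := by
  have hj : (jbr z : ℂ) ≠ 0 := by exact_mod_cast jbr_ne_zero z
  have h1 : HasDerivAt (fun z : ℝ => (jbr z : ℂ)) ((z / jbr z : ℝ) : ℂ) z :=
    (hasDerivAt_jbr z).ofReal_comp
  have h2 : HasDerivAt (fun z : ℝ => Complex.I * m.κ * t / jbr z
      + Complex.I * m.S.f z * Real.log t) (-(Complex.I * m.κ) * t * z / (jbr z : ℂ) ^ 3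
      + Complex.I * m.S.f₁ z * Real.log t) z := by
    refine HasDerivAt.fun_add ?_ (((m.S.hasDeriv z).const_mul _).mul_const _)
    refine ((hasDerivAt_const z (Complex.I * m.κ * t)).fun_div h1 hj).congr_deriv ?_
    push_cast
    field_simp
    ring
  exact h2.cexp

section Kernels
variable (φ φ₁ φ₂ : ℝ → ℝ)

/-- The density of the pairing of the mode with a test function. -/
def ker (t z : ℝ) : ℂ :=
  ((jbr z ^ 3)⁻¹ : ℝ) * m.f.f z * (((t ^ m.r : ℝ) : ℂ) * m.osc t z * φ (t * vel z))

/-- First time derivative of `ker`. -/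
def ker₁ (t z : ℝ) : ℂ :=
  ((jbr z ^ 3)⁻¹ : ℝ) * m.f.f z * (((t ^ m.r : ℝ) : ℂ) * m.osc t z *
    (vel z * φ₁ (t * vel z) + φ (t * vel z) * m.rate t z))

/-- Second time derivative of `ker`. -/
def ker₂ (t z : ℝ) : ℂ :=
  ((jbr z ^ 3)⁻¹ : ℝ) * m.f.f z * (((t ^ m.r : ℝ) : ℂ) * m.osc t z *
    (vel z ^ 2 * φ₂ (t * vel z) + 2 * vel z * φ₁ (t * vel z) * m.rate t z
      + φ (t * vel z) * (m.rate t z ^ 2 - (m.r + Complex.I * m.S.f z) / t ^ 2)))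

/-- The flux whose `z`-derivative accounts for the integrations by parts. -/
def flux (t z : ℝ) : ℂ :=
  ((t ^ m.r : ℝ) : ℂ) * (m.osc t z *
    (φ₁ (t * vel z) * (-(((jbr z : ℂ) ^ 2)⁻¹ * m.f.f z) / t)
      + φ (t * vel z) * (2 / t * vel z * m.rate t z * m.f.f z
        + (jbr z * (m.f.f₁ z + (-(Complex.I * m.κ) * t * z / (jbr z : ℂ) ^ 3
            + Complex.I * m.S.f₁ z * Real.log t) * m.f.f z) - 2 * vel z * m.f.f z) / t ^ 2)))

variable {φ φ₁ φ₂}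

theorem hasDerivAt_comp_vel_time (h : ∀ x, HasDerivAt φ (φ₁ x) x) (t z : ℝ) :
    HasDerivAt (fun t : ℝ => (φ (t * vel z) : ℂ)) ((vel z : ℂ) * φ₁ (t * vel z)) t := by
  have h1 : HasDerivAt (fun t : ℝ => t * vel z) (vel z) t := by
    simpa using (hasDerivAt_id' t).mul_const (vel z)
  refine ((h _).comp t h1).ofReal_comp.congr_deriv ?_
  push_cast; ring

theorem hasDerivAt_comp_vel_space (h : ∀ x, HasDerivAt φ (φ₁ x) x) (t z : ℝ) :
    HasDerivAt (fun z : ℝ => (φ (t * vel z) : ℂ)) (φ₁ (t * vel z) * (t / (jbr z : ℂ) ^ 3)) z := by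
  refine ((h _).comp z ((hasDerivAt_vel z).const_mul t)).ofReal_comp.congr_deriv ?_
  push_cast; ring

theorem hasDerivAt_ker (h : ∀ x, HasDerivAt φ (φ₁ x) x) {t : ℝ} (ht : 0 < t) (z : ℝ) :
    HasDerivAt (fun t => m.ker φ t z) (m.ker₁ φ φ₁ t z) t := by
  refine HasDerivAt.const_mul _ ?_
  refine ((m.hasDerivAt_osc_time ht z).fun_mul (hasDerivAt_comp_vel_time h t z)).congr_deriv ?_
  ring

theorem hasDerivAt_ker₁ (h : ∀ x, HasDerivAt φ (φ₁ x) x) (h₁ : ∀ x, HasDerivAt φ₁ (φ₂ x) x)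
    {t : ℝ} (ht : 0 < t) (z : ℝ) :
    HasDerivAt (fun t => m.ker₁ φ φ₁ t z) (m.ker₂ φ φ₁ φ₂ t z) t := by
  have hr : HasDerivAt (fun t : ℝ => m.rate t z) (-((m.r + Complex.I * m.S.f z) / t ^ 2)) t := by
    have h3 : (t : ℂ) ≠ 0 := by exact_mod_cast ht.ne'
    have h4 : HasDerivAt (fun t : ℝ => (t : ℂ)) 1 t := by
      simpa using (hasDerivAt_id' t).ofReal_comp
    refine (((hasDerivAt_const t (m.r + Complex.I * m.S.f z)).fun_div h4 h3).add_const
      (Complex.I * m.κ / jbr z)).congr_deriv ?_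
    ring
  refine HasDerivAt.const_mul _ ?_
  refine ((m.hasDerivAt_osc_time ht z).fun_mul
    (((hasDerivAt_comp_vel_time h₁ t z).const_mul (vel z : ℂ)).fun_add
      ((hasDerivAt_comp_vel_time h t z).fun_mul hr))).congr_deriv ?_
  ring

/-- The defect of the tested equation is an exact z-derivative. Since ∂_z φ(t v) = t⟨z⟩⁻³ φ'(t v)
with v = z/⟨z⟩, derivatives can be moved off the test function one at a time; `flux` collects the
boundary terms. The coefficients of φ'', φ' and φ are compared separately. Only the second
derivatives of the jets need a hypothesis at z. -/
theorem hasDerivAt_flux (h : ∀ x, HasDerivAt φ (φ₁ x) x) (h₁ : ∀ x, HasDerivAt φ₁ (φ₂ x) x)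
    {t : ℝ} (ht : 0 < t) {z : ℝ} (hf : HasDerivAt m.f.f₁ (m.f.f₂ z) z)
    (hS : HasDerivAt m.S.f₁ (m.S.f₂ z) z) :
    HasDerivAt (m.flux φ φ₁ t) (m.ker₂ φ φ₁ φ₂ t z - m.ker φ₂ t z + m.ker φ t z
      - ((t * (jbr z ^ 3)⁻¹ : ℝ) • φ (t * vel z) • m.src t z)) z := by
  have hj : (jbr z : ℂ) ≠ 0 := by exact_mod_cast jbr_ne_zero z
  have ht' : (t : ℂ) ≠ 0 := by exact_mod_cast ht.ne'
  have hjz : (jbr z : ℂ) ^ 2 = 1 + (z : ℂ) ^ 2 := by exact_mod_cast jbr_sq z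
  have hid := flux_identity (k := Complex.I * m.κ) (r := m.r) (L := Real.log t) (f := m.f.f z)
    (f1 := m.f.f₁ z) (f2 := m.f.f₂ z) (s := Complex.I * m.S.f z) (s1 := Complex.I * m.S.f₁ z)
    (s2 := Complex.I * m.S.f₂ z) hj ht' hjz
  have dj : HasDerivAt (fun z : ℝ => (jbr z : ℂ)) ((z : ℂ) / jbr z) z := by
    simpa using (hasDerivAt_jbr z).ofReal_comp
  have dz : HasDerivAt (fun z : ℝ => (z : ℂ)) 1 z := by
    simpa using (hasDerivAt_id' z).ofReal_comp
  have dv : HasDerivAt (fun z : ℝ => (vel z : ℂ)) (1 / (jbr z : ℂ) ^ 3) z := by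
    simpa using (hasDerivAt_vel z).ofReal_comp
  have d1 : HasDerivAt (fun z : ℝ => -(((jbr z : ℂ) ^ 2)⁻¹ * m.f.f z) / (t : ℂ))
      ((2 * z / (jbr z : ℂ) ^ 4 * m.f.f z - ((jbr z : ℂ) ^ 2)⁻¹ * m.f.f₁ z) / t) z := by
    refine ((((dj.fun_pow 2).fun_inv (pow_ne_zero 2 hj)).fun_mul
      (m.f.hasDeriv z)).fun_neg.div_const _).congr_deriv ?_
    field_simp
    ring
  have dr : HasDerivAt (fun z : ℝ => m.rate t z)
      (Complex.I * m.S.f₁ z / t - Complex.I * m.κ * z / (jbr z : ℂ) ^ 3) z := by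
    refine (((((m.S.hasDeriv z).const_mul Complex.I).const_add (m.r : ℂ)).div_const
      (t : ℂ)).fun_add ((hasDerivAt_const z (Complex.I * (m.κ : ℂ))).fun_div dj hj)).congr_deriv ?_
    field_simp
    ring
  have de : HasDerivAt (fun z : ℝ => -(Complex.I * m.κ) * t * z / (jbr z : ℂ) ^ 3
      + Complex.I * m.S.f₁ z * Real.log t)
      (-(Complex.I * m.κ) * t * (1 / (jbr z : ℂ) ^ 3 - 3 * z ^ 2 / (jbr z : ℂ) ^ 5)
        + Complex.I * m.S.f₂ z * Real.log t) z := by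
    refine HasDerivAt.fun_add ?_ ((hS.const_mul _).mul_const _)
    refine ((dz.const_mul (-(Complex.I * m.κ) * t)).fun_div (dj.fun_pow 3)
      (pow_ne_zero 3 hj)).congr_deriv ?_
    field_simp
    ring
  have d0 := ((dv.const_mul (2 / (t : ℂ))).fun_mul dr).fun_mul (m.f.hasDeriv z) |>.fun_add
    (((dj.fun_mul (hf.fun_add (de.fun_mul (m.f.hasDeriv z)))).fun_sub
      ((dv.const_mul 2).fun_mul (m.f.hasDeriv z))).div_const ((t : ℂ) ^ 2))
  have dX := ((hasDerivAt_comp_vel_space h₁ t z).fun_mul d1).fun_add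
    ((hasDerivAt_comp_vel_space h t z).fun_mul d0)
  refine (((m.hasDerivAt_osc_space t z).fun_mul dX).const_mul
    ((t ^ m.r : ℝ) : ℂ)).congr_deriv ?_
  have hv : (vel z : ℂ) = z / jbr z := by simp [vel]
  have hv2 : ((z : ℂ) / jbr z) ^ 2 = 1 - ((jbr z : ℂ) ^ 2)⁻¹ := by
    rw [← hv]; exact_mod_cast vel_sq z
  simp only [ker, ker₂, src, Complex.real_smul]
  rw [hv]
  push_cast
  simp only [rem, rate] at hid ⊢
  set x0 : ℂ := (φ (t * vel z) : ℂ)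
  set x1 : ℂ := (φ₁ (t * vel z) : ℂ)
  set x2 : ℂ := (φ₂ (t * vel z) : ℂ)
  set E := m.osc t z
  set q : ℂ := ((t ^ m.r : ℝ) : ℂ)
  generalize (Real.log t : ℂ) = L at *
  generalize Complex.I * (m.κ : ℂ) = k at *
  generalize Complex.I * m.S.f z = s at *
  generalize Complex.I * m.S.f₁ z = s1 at *
  generalize Complex.I * m.S.f₂ z = s2 at *
  generalize m.f.f z = f at *
  generalize m.f.f₁ z = f1 at *
  generalize m.f.f₂ z = f2 at *
  generalize (m.r : ℂ) = r at *
  generalize (jbr z : ℂ) = j at *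
  generalize (t : ℂ) = t at *
  generalize (z : ℂ) = z at *
  have c2 : (j ^ 3)⁻¹ * f * (q * E * ((z / j) ^ 2 * x2)) - (j ^ 3)⁻¹ * f * (q * E * x2)
      -- Terms in φ'': v² - 1 = -⟨z⟩⁻² is produced by the inner derivative of φ'(t v) in the flux.
      = q * E * (x2 * (t / j ^ 3) * (-((j ^ 2)⁻¹ * f) / t)) := by
    rw [hv2]; field_simp; ring
  -- Terms in φ': the remaining derivatives of the φ' part of the flux, plus the inner derivative of
  -- φ(t v) in its φ part.
  have c1 : (j ^ 3)⁻¹ * f * (q * E * (2 * (z / j) * x1 * ((r + s) / t + k / j)))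
      = q * E * (x1 * ((2 * z / j ^ 4 * f - (j ^ 2)⁻¹ * f1) / t
        + (-k * t * z / j ^ 3 + s1 * L) * (-((j ^ 2)⁻¹ * f) / t)
        + t / j ^ 3 * (2 / t * (z / j) * ((r + s) / t + k / j) * f
        + (j * (f1 + (-k * t * z / j ^ 3 + s1 * L) * f) - 2 * (z / j) * f) / t ^ 2))) := by
    field_simp; ring
  -- The source carries t^r/t and the kernels t^r; the factor t of the Jacobian makes up the
  -- difference.
  have hq : t * (q / t) = q := by field_simp
  linear_combination (q * E * x0) * hid - c2 - c1 + (j ^ 3)⁻¹ * x0 * E *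
    ((1 + k ^ 2) * f + j * (2 * k * s + k * (2 * r - 1)) * f / t
      + (((r + s) ^ 2 - (r + s)) * f
        - 2 * j ^ 3 * ((r + s) * f / j ^ 3 + z / j * s1 * f
          + z / j * (r + s) * (f1 + s1 * L * f))
        - j ^ 3 * (z / j * (f1 + s1 * L * f)
          + j * (f2 + s2 * L * f + s1 * L * f1 + s1 * L * (f1 + s1 * L * f))
          - 2 * f / j ^ 3 - 2 * (z / j) * (f1 + s1 * L * f))) / t ^ 2) * hq

end Kernels
end Mode

/-! ### The equation for a single mode in the sense of distributions -/

namespace Mode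
variable {m : Mode} {D : ℝ} {φ φ₁ φ₂ : ℝ → ℝ}

/-- Uniform bounds of a mode, with decay of its amplitude. -/
structure Bounded (m : Mode) (D : ℝ) : Prop where
  f_le : ∀ z, jbr z ^ 2 * ‖m.f.f z‖ ≤ D
  f₁_le : ∀ z, jbr z ^ 2 * ‖m.f.f₁ z‖ ≤ D
  S_le : ∀ z, ‖m.S.f z‖ ≤ D
  S₁_le : ∀ z, ‖m.S.f₁ z‖ ≤ D

theorem Bounded.nonneg (h : m.Bounded D) : 0 ≤ D := (norm_nonneg _).trans (h.S_le 0)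

theorem Bounded.norm_f_le (h : m.Bounded D) (z : ℝ) : ‖m.f.f z‖ ≤ D := by
  have h1 : 1 ≤ jbr z ^ 2 := one_le_pow₀ (one_le_jbr z)
  nlinarith [h.f_le z, norm_nonneg (m.f.f z)]

theorem Bounded.norm_rate_le (h : m.Bounded D) {t s : ℝ} (ht : 0 < t) (hs : t / 2 ≤ s) (z : ℝ) :
    ‖m.rate s z‖ ≤ (|m.r| + D) / (t / 2) + |m.κ| := by
  have hs0 : 0 < s := by linarith
  have hD := h.nonneg
  unfold rate
  refine (norm_add_le _ _).trans (add_le_add ?_ ?_)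
  · rw [norm_div, Complex.norm_real, Real.norm_of_nonneg hs0.le]
    refine div_le_div₀ (by positivity) ((norm_add_le _ _).trans ?_) (by positivity) hs
    rw [norm_mul, Complex.norm_I, one_mul, Complex.norm_real, Real.norm_eq_abs]
    linarith [h.S_le z]
  · rw [norm_div, norm_mul, Complex.norm_I, one_mul, Complex.norm_real, Complex.norm_real,
      Real.norm_eq_abs, Real.norm_of_nonneg (jbr_pos z).le]
    exact div_le_self (abs_nonneg _) (one_le_jbr z)

theorem continuous_rate (m : Mode) (t : ℝ) : Continuous (m.rate t) := by
  have h1 := continuous_jbr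
  have h2 := m.S.continuous
  unfold rate
  refine Continuous.add (by fun_prop) (Continuous.div (by fun_prop) (by fun_prop) fun z => ?_)
  exact_mod_cast jbr_ne_zero z

theorem continuous_inv_jbr_cube : Continuous fun z => (jbr z ^ 3)⁻¹ :=
  (continuous_jbr.pow 3).inv₀ fun z => pow_ne_zero 3 (jbr_ne_zero z)

theorem continuous_ker (m : Mode) (hφ : Continuous φ) (t : ℝ) : Continuous (m.ker φ t) := by
  have h0 := continuous_inv_jbr_cube
  have h1 := m.f.continuous
  have h2 := m.continuous_osc t
  have h3 := continuous_vel
  unfold ker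
  fun_prop

theorem continuous_ker₁ (m : Mode) (hφ : Continuous φ) (hφ₁ : Continuous φ₁) (t : ℝ) :
    Continuous (m.ker₁ φ φ₁ t) := by
  have h0 := continuous_inv_jbr_cube
  have h1 := m.f.continuous
  have h2 := m.continuous_osc t
  have h3 := continuous_vel
  have h4 := m.continuous_rate t
  unfold ker₁
  fun_prop

theorem continuous_ker₂ (m : Mode) (hφ : Continuous φ) (hφ₁ : Continuous φ₁) (hφ₂ : Continuous φ₂)
    (t : ℝ) : Continuous (m.ker₂ φ φ₁ φ₂ t) := by
  have h0 := continuous_inv_jbr_cube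
  have h1 := m.f.continuous
  have h2 := m.continuous_osc t
  have h3 := continuous_vel
  have h4 := m.continuous_rate t
  have h5 := m.S.continuous
  unfold ker₂
  fun_prop

/-- Common to the three kernel bounds: the oscillation has modulus one and the factor Y is bounded,
so the Jacobian ⟨z⟩⁻³ alone provides an integrable majorant, uniform for s near t. -/
theorem norm_weighted_le (h : m.Bounded D) {t s Q X : ℝ} (hs : t / 2 ≤ s) (ht : 0 < t)
    (hQ : s ^ m.r ≤ Q) (z : ℝ) {Y : ℂ} (hY : ‖Y‖ ≤ X) :
    ‖(((jbr z ^ 3)⁻¹ : ℝ) : ℂ) * m.f.f z * (((s ^ m.r : ℝ) : ℂ) * m.osc s z * Y)‖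
      ≤ D * Q * X * (jbr z ^ 3)⁻¹ := by
  have hj := inv_pos.2 (pow_pos (jbr_pos z) 3)
  have hs0 : 0 < s := by linarith
  have hD := h.nonneg
  have hs1 := Real.rpow_nonneg hs0.le m.r
  have hQ0 : 0 ≤ Q := hs1.trans hQ
  rw [norm_mul, norm_mul, norm_mul, norm_mul, m.norm_osc, mul_one, Complex.norm_real,
    Complex.norm_real, Real.norm_of_nonneg hs1, Real.norm_of_nonneg hj.le]
  have := h.norm_f_le z
  have hX : 0 ≤ X := (norm_nonneg _).trans hY
  calc (jbr z ^ 3)⁻¹ * ‖m.f.f z‖ * (s ^ m.r * ‖Y‖) ≤ (jbr z ^ 3)⁻¹ * D * (Q * X) := by gcongr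
    _ = _ := by ring

theorem norm_real_le {x C : ℝ} (h : |x| ≤ C) : ‖(x : ℂ)‖ ≤ C := by
  rwa [Complex.norm_real, Real.norm_eq_abs]

theorem norm_vel_le (z : ℝ) : ‖(vel z : ℂ)‖ ≤ 1 := norm_real_le (abs_vel_lt_one z).le

theorem norm_mul_le_mul {X Y : ℂ} {x y : ℝ} (hX : ‖X‖ ≤ x) (hY : ‖Y‖ ≤ y) : ‖X * Y‖ ≤ x * y := by
  rw [norm_mul]
  exact mul_le_mul hX hY (norm_nonneg _) ((norm_nonneg _).trans hX)

theorem exists_ker_le (h : m.Bounded D) {C : ℝ} (hφ : ∀ x, |φ x| ≤ C) {t : ℝ} (ht : 0 < t) :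
    ∃ B, ∀ s ∈ Set.Ioo (t / 2) (2 * t), ∀ z, ‖m.ker φ s z‖ ≤ B * (jbr z ^ 3)⁻¹ := by
  obtain ⟨Q, -, hQ⟩ := exists_rpow_le m.r ht
  exact ⟨D * Q * C, fun s hs z => norm_weighted_le h hs.1.le ht (hQ s hs) z (norm_real_le (hφ _))⟩

theorem exists_ker₁_le (h : m.Bounded D) {C : ℝ} (hφ : ∀ x, |φ x| ≤ C) (hφ₁ : ∀ x, |φ₁ x| ≤ C)
    {t : ℝ} (ht : 0 < t) :
    ∃ B, ∀ s ∈ Set.Ioo (t / 2) (2 * t), ∀ z, ‖m.ker₁ φ φ₁ s z‖ ≤ B * (jbr z ^ 3)⁻¹ := by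
  obtain ⟨Q, -, hQ⟩ := exists_rpow_le m.r ht
  refine ⟨D * Q * _, fun s hs z => norm_weighted_le h hs.1.le ht (hQ s hs) z
    ((norm_add_le _ _).trans (add_le_add (norm_mul_le_mul (norm_vel_le z) (norm_real_le (hφ₁ _)))
      (norm_mul_le_mul (norm_real_le (hφ _)) (h.norm_rate_le ht hs.1.le z))))⟩

theorem exists_ker₂_le (h : m.Bounded D) {C : ℝ} (hφ : ∀ x, |φ x| ≤ C) (hφ₁ : ∀ x, |φ₁ x| ≤ C)
    (hφ₂ : ∀ x, |φ₂ x| ≤ C) {t : ℝ} (ht : 0 < t) :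
    ∃ B, ∀ s ∈ Set.Ioo (t / 2) (2 * t), ∀ z, ‖m.ker₂ φ φ₁ φ₂ s z‖ ≤ B * (jbr z ^ 3)⁻¹ := by
  obtain ⟨Q, -, hQ⟩ := exists_rpow_le m.r ht
  have hD := h.nonneg
  refine ⟨D * Q * (1 ^ 2 * C + 2 * 1 * C * ((|m.r| + D) / (t / 2) + |m.κ|)
    + C * (((|m.r| + D) / (t / 2) + |m.κ|) ^ 2 + (|m.r| + D) / (t / 2) ^ 2)),
    fun s hs z => norm_weighted_le h hs.1.le ht (hQ s hs) z ?_⟩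
  have hv := norm_vel_le z
  have hr := h.norm_rate_le ht hs.1.le z
  refine norm_add₃_le.trans (add_le_add (add_le_add ?_ ?_) ?_)
  · refine norm_mul_le_mul ?_ (norm_real_le (hφ₂ _))
    rw [norm_pow]; gcongr
  · exact norm_mul_le_mul (norm_mul_le_mul (norm_mul_le_mul (by simp) hv) (norm_real_le (hφ₁ _))) hr
  · refine norm_mul_le_mul (norm_real_le (hφ _)) ((norm_sub_le _ _).trans (add_le_add ?_ ?_))
    · rw [norm_pow]; gcongr
    · rw [norm_div, norm_pow, Complex.norm_real, Real.norm_eq_abs, sq_abs]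
      have h2 : (t / 2) ^ 2 ≤ s ^ 2 := by
        have := hs.1.le
        gcongr
      refine div_le_div₀ (by positivity) ((norm_add_le _ _).trans ?_) (by positivity) h2
      rw [norm_mul, Complex.norm_I, one_mul, Complex.norm_real, Real.norm_eq_abs]
      linarith [h.S_le z]

/-- The flux contains f' and S', which are only locally absolutely continuous; its other ingredients
are C¹. -/
theorem locAC_flux (m : Mode) (h : ∀ x, HasDerivAt φ (φ₁ x) x)
    (h₁ : ∀ x, HasDerivAt φ₁ (φ₂ x) x) (hφ₂ : Continuous φ₂) (t : ℝ) :
    LocAC (m.flux φ φ₁ t) := by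
  have cφ : Continuous φ := continuous_iff_continuousAt.2 fun x => (h x).continuousAt
  have cφ₁ : Continuous φ₁ := continuous_iff_continuousAt.2 fun x => (h₁ x).continuousAt
  have hj : ContDiff ℝ 1 jbr := by
    unfold jbr
    exact ContDiff.sqrt (by fun_prop) fun z => by positivity
  have hjne : ∀ z : ℝ, (jbr z : ℂ) ≠ 0 := fun z => by exact_mod_cast jbr_ne_zero z
  have hjc : ContDiff ℝ 1 fun z => (jbr z : ℂ) := Complex.ofRealCLM.contDiff.comp hj
  have hzc : ContDiff ℝ 1 fun z : ℝ => (z : ℂ) := Complex.ofRealCLM.contDiff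
  have cj := continuous_jbr
  have cv := continuous_vel
  have aφ : LocAC fun z => (φ (t * vel z) : ℂ) := LocAC.of_hasDerivAt
    (hasDerivAt_comp_vel_space h t) (by
      refine Continuous.mul (by fun_prop) (Continuous.div (by fun_prop) (by fun_prop)
        fun z => pow_ne_zero 3 (hjne z)))
  have aφ₁ : LocAC fun z => (φ₁ (t * vel z) : ℂ) := LocAC.of_hasDerivAt
    (hasDerivAt_comp_vel_space h₁ t) (by
      refine Continuous.mul (by fun_prop) (Continuous.div (by fun_prop) (by fun_prop)
        fun z => pow_ne_zero 3 (hjne z)))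
  have ao : LocAC (m.osc t) := LocAC.of_hasDerivAt (m.hasDerivAt_osc_space t) (by
    have h1 := m.continuous_osc t
    have h2 := m.S.continuous₁
    refine h1.mul (Continuous.add (Continuous.div (by fun_prop) (by fun_prop)
      fun z => pow_ne_zero 3 (hjne z)) (by fun_prop)))
  have aj : LocAC fun z => (jbr z : ℂ) := LocAC.of_contDiff hjc
  have aj2 : LocAC fun z => ((jbr z : ℂ) ^ 2)⁻¹ :=
    LocAC.of_contDiff ((hjc.pow 2).inv fun z => pow_ne_zero 2 (hjne z))
  have aji : LocAC fun z => (jbr z : ℂ)⁻¹ := LocAC.of_contDiff (hjc.inv hjne)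
  have av : LocAC fun z => (vel z : ℂ) := LocAC.of_contDiff
    (Complex.ofRealCLM.contDiff.comp (contDiff_id.div hj jbr_ne_zero))
  have az : LocAC fun z => -(Complex.I * m.κ) * t * z / (jbr z : ℂ) ^ 3 := by
    simp only [div_eq_mul_inv]
    exact LocAC.of_contDiff
      ((contDiff_const.mul hzc).mul ((hjc.pow 3).inv fun z => pow_ne_zero 3 (hjne z)))
  have af := m.f.locAC₀
  have af₁ := m.f.locAC
  have aS := m.S.locAC₀
  have aS₁ := m.S.locAC
  have ar : LocAC (m.rate t) :=
    (((LocAC.const _).add ((LocAC.const _).mul aS)).mul (LocAC.const (t : ℂ)⁻¹)).add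
      ((LocAC.const (Complex.I * m.κ)).mul aji)
  -- Divisions by powers of t become products with constants, to which `LocAC.mul` applies.
  have e : m.flux φ φ₁ t = fun z => ((t ^ m.r : ℝ) : ℂ) * (m.osc t z *
    (φ₁ (t * vel z) * (-(t : ℂ)⁻¹ * (((jbr z : ℂ) ^ 2)⁻¹ * m.f.f z))
      + φ (t * vel z) * (2 / t * vel z * m.rate t z * m.f.f z
        + (jbr z * (m.f.f₁ z + (-(Complex.I * m.κ) * t * z / (jbr z : ℂ) ^ 3
            + Complex.I * m.S.f₁ z * Real.log t) * m.f.f z) - 2 * vel z * m.f.f z)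
            * ((t : ℂ) ^ 2)⁻¹))) := by
    funext z
    simp only [flux]
    ring
  rw [e]
  exact (LocAC.const _).mul (ao.mul ((aφ₁.mul ((LocAC.const _).mul (aj2.mul af))).add
    (aφ.mul ((((((LocAC.const _).mul av).mul ar).mul af)).add
      (((aj.mul (af₁.add ((az.add (((LocAC.const _).mul aS₁).mul (LocAC.const _))).mul af))).sub
        (((LocAC.const _).mul av).mul af)).mul (LocAC.const _))))))

/-- The flux spends at most one power of ⟨z⟩ against the decay ⟨z⟩⁻² of f and f', so it vanishes as
z → ±∞, that is, towards the edge of the cone. -/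
theorem exists_flux_le (h : m.Bounded D) {C : ℝ} (hφ : ∀ x, |φ x| ≤ C) (hφ₁ : ∀ x, |φ₁ x| ≤ C)
    {t : ℝ} (ht : 0 < t) : ∃ B, ∀ z, ‖m.flux φ φ₁ t z‖ ≤ B * (jbr z)⁻¹ := by
  have hD := h.nonneg
  have hC : 0 ≤ C := (abs_nonneg _).trans (hφ 0)
  set Λ := (|m.r| + D) / (t / 2) + |m.κ|
  refine ⟨t ^ m.r * (1 * (C * (1 * D / t)
    + C * (2 / t * 1 * Λ * D + (D + (|m.κ| * t + D * |Real.log t|) * D + 2 * 1 * D) / t ^ 2))),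
    fun z => ?_⟩
  have hj := jbr_pos z
  have hj1 := one_le_jbr z
  have hji : (jbr z)⁻¹ ≤ 1 := inv_le_one_of_one_le₀ hj1
  have hji0 : 0 < (jbr z)⁻¹ := inv_pos.2 hj
  have key : ∀ {x : ℝ}, 0 ≤ x → jbr z ^ 2 * x ≤ D → x ≤ D * (jbr z)⁻¹ ∧
      jbr z * x ≤ D * (jbr z)⁻¹ := by
    intro x hx hle
    have h2 : jbr z * x ≤ D * (jbr z)⁻¹ := by
      rw [← div_eq_mul_inv, le_div_iff₀ hj]; nlinarith
    exact ⟨by nlinarith, h2⟩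
  obtain ⟨f1, f2⟩ := key (norm_nonneg _) (h.f_le z)
  obtain ⟨g1, g2⟩ := key (norm_nonneg _) (h.f₁_le z)
  have nt : ‖(t : ℂ)‖ = t := by rw [Complex.norm_real, Real.norm_of_nonneg ht.le]
  have nj : ‖(jbr z : ℂ)‖ = jbr z := by rw [Complex.norm_real, Real.norm_of_nonneg hj.le]
  have hv := norm_vel_le z
  have hr : ‖m.rate t z‖ ≤ Λ := h.norm_rate_le ht (by linarith) z
  have hq : ‖((t ^ m.r : ℝ) : ℂ)‖ = t ^ m.r := by
    rw [Complex.norm_real, Real.norm_of_nonneg (Real.rpow_nonneg ht.le _)]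
  have main : ‖m.flux φ φ₁ t z‖ ≤ t ^ m.r * (1 * (C * (1 * (D * (jbr z)⁻¹) / t)
      + C * (2 / t * 1 * Λ * (D * (jbr z)⁻¹)
        + (D * (jbr z)⁻¹ + (|m.κ| * t + D * |Real.log t|) * (D * (jbr z)⁻¹)
          + 2 * 1 * (D * (jbr z)⁻¹)) / t ^ 2))) := by
    refine norm_mul_le_mul hq.le (norm_mul_le_mul (m.norm_osc t z).le ((norm_add_le _ _).trans
      (add_le_add (norm_mul_le_mul (norm_real_le (hφ₁ _)) ?_)
        (norm_mul_le_mul (norm_real_le (hφ _)) ((norm_add_le _ _).trans (add_le_add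
          (norm_mul_le_mul (norm_mul_le_mul (norm_mul_le_mul ?_ hv) hr) f1) ?_))))))
    · rw [norm_div, norm_neg, nt]
      gcongr
      refine norm_mul_le_mul ?_ f1
      rw [norm_inv, norm_pow, nj]
      exact inv_le_one_of_one_le₀ (one_le_pow₀ hj1)
    · rw [norm_div, nt]; simp
    · rw [norm_div, norm_pow, nt]
      gcongr
      refine (norm_sub_le _ _).trans (add_le_add ?_
        (norm_mul_le_mul (norm_mul_le_mul (by simp) hv) f1))
      rw [mul_add]
      refine (norm_add_le _ _).trans (add_le_add ?_ ?_)
      · rw [norm_mul, nj]; exact g2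
      · rw [mul_left_comm]
        refine norm_mul_le_mul ((norm_add_le _ _).trans (add_le_add ?_ ?_)) ?_
        · rw [norm_div, norm_pow, nj, div_le_iff₀ (pow_pos hj 3)]
          simp only [norm_mul, norm_neg, Complex.norm_I, one_mul, Complex.norm_real,
            Real.norm_eq_abs, abs_of_pos ht]
          have : |z| ≤ jbr z ^ 3 := (abs_le_jbr z).trans (le_self_pow₀ hj1 (by norm_num))
          gcongr
        · refine norm_mul_le_mul ?_ (norm_real_le le_rfl)
          rw [norm_mul, Complex.norm_I, one_mul]; exact h.S₁_le z
        · rw [norm_mul, nj]; exact f2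
  refine main.trans (le_of_eq ?_)
  ring

theorem tendsto_inv_jbr : Tendsto (fun z => (jbr z)⁻¹) atTop (nhds 0) ∧
    Tendsto (fun z => (jbr z)⁻¹) atBot (nhds 0) := by
  constructor
  · exact (tendsto_atTop_mono (fun z => (le_abs_self z).trans (abs_le_jbr z))
      tendsto_id).inv_tendsto_atTop
  · exact (tendsto_atTop_mono abs_le_jbr tendsto_abs_atBot_atTop).inv_tendsto_atTop

theorem tendsto_zero_of_le_inv_jbr {F : ℝ → ℂ} {B : ℝ} (h : ∀ z, ‖F z‖ ≤ B * (jbr z)⁻¹) :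
    Tendsto F atTop (nhds 0) ∧ Tendsto F atBot (nhds 0) := by
  obtain ⟨h1, h2⟩ := tendsto_inv_jbr
  refine ⟨squeeze_zero_norm h ?_, squeeze_zero_norm h ?_⟩
  · simpa using h1.const_mul B
  · simpa using h2.const_mul B

/-- The Jacobian absorbs the factor 1/t of `val`, which is why `ker` carries t^r. -/
theorem integral_coneLift_val (m : Mode) (φ : ℝ → ℝ) {t : ℝ} (ht : 0 < t) :
    ∫ x, φ x • coneLift t (m.val t) x = ∫ z, m.ker φ t z := by
  rw [integral_coneLift ht]
  refine integral_congr_ae (Eventually.of_forall fun z => ?_)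
  have h3 : (t : ℂ) ≠ 0 := by exact_mod_cast ht.ne'
  simp only [val, ker, Complex.real_smul]
  push_cast
  field_simp

/-- The equation `(□ + 1) val = src` in the sense of distributions. -/
theorem isBoxPlusOne (h : m.Bounded D)
    (hsrc : ∀ t, 1 < t → Integrable (coneLift t (m.src t)) volume) :
    IsBoxPlusOne 1 (fun t => coneLift t (m.val t)) (fun t => coneLift t (m.src t)) := by
  have hw := integrable_inv_jbr_cube
  constructor
  · intro t ht
    have ht0 : 0 < t := by linarith
    refine ⟨((integrable_coneLift_iff ht0 _).2 ?_).locallyIntegrable, (hsrc t ht).locallyIntegrable⟩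
    have e : (fun z => (t * (jbr z ^ 3)⁻¹ : ℝ) • m.val t z) = m.ker (fun _ => 1) t := by
      funext z
      have h3 : (t : ℂ) ≠ 0 := by exact_mod_cast ht0.ne'
      simp only [val, ker, Complex.real_smul]
      push_cast
      field_simp
    rw [e]
    obtain ⟨B, hB⟩ := exists_ker_le h (φ := fun _ => 1) (C := 1) (by simp) ht0
    exact (hw.const_mul B).mono' (m.continuous_ker continuous_const t).aestronglyMeasurable
      (Eventually.of_forall fun z => hB t ⟨by linarith, by linarith⟩ z)
  · intro φ hφ hφc
    have hφ' : ContDiff ℝ ∞ (deriv φ) := (contDiff_infty_iff_deriv.1 hφ).2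
    have hφ'' : ContDiff ℝ ∞ (deriv (deriv φ)) := (contDiff_infty_iff_deriv.1 hφ').2
    have e2 : iteratedDeriv 2 φ = deriv (deriv φ) := by
      rw [iteratedDeriv_succ, iteratedDeriv_one]
    rw [e2]
    have d0 : ∀ x, HasDerivAt φ (deriv φ x) x := fun x =>
      (hφ.differentiable (by simp) x).hasDerivAt
    have d1 : ∀ x, HasDerivAt (deriv φ) (deriv (deriv φ) x) x := fun x =>
      (hφ'.differentiable (by simp) x).hasDerivAt
    obtain ⟨C0, hC0⟩ := hφ.continuous.bounded_above_of_compact_support hφc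
    obtain ⟨C1, hC1⟩ := hφ'.continuous.bounded_above_of_compact_support hφc.deriv
    obtain ⟨C2, hC2⟩ := hφ''.continuous.bounded_above_of_compact_support hφc.deriv.deriv
    set C := max C0 (max C1 C2)
    have b0 : ∀ x, |φ x| ≤ C := fun x => (hC0 x).trans (le_max_left _ _)
    have b1 : ∀ x, |deriv φ x| ≤ C := fun x =>
      (hC1 x).trans ((le_max_left _ _).trans (le_max_right _ _))
    have b2 : ∀ x, |deriv (deriv φ) x| ≤ C := fun x =>
      (hC2 x).trans ((le_max_right _ _).trans (le_max_right _ _))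
    have c0 := hφ.continuous
    have c1 := hφ'.continuous
    have c2 := hφ''.continuous
    refine ⟨fun t => ∫ z, m.ker₁ φ (deriv φ) t z, fun t ht => ?_⟩
    have ht0 : 0 < t := by linarith
    have D1 := hasDerivAt_integral_of_locally_dominated hw (F := m.ker φ)
      (F' := m.ker₁ φ (deriv φ)) (fun s _ => m.continuous_ker c0 s)
      (fun s _ => m.continuous_ker₁ c0 c1 s) (fun s hs z => m.hasDerivAt_ker d0 hs z)
      (fun t ht => exists_ker_le h b0 ht) (fun t ht => exists_ker₁_le h b0 b1 ht) ht0
    have D2 := hasDerivAt_integral_of_locally_dominated hw (F := m.ker₁ φ (deriv φ))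
      (F' := m.ker₂ φ (deriv φ) (deriv (deriv φ))) (fun s _ => m.continuous_ker₁ c0 c1 s)
      (fun s _ => m.continuous_ker₂ c0 c1 c2 s) (fun s hs z => m.hasDerivAt_ker₁ d0 d1 hs z)
      (fun t ht => exists_ker₁_le h b0 b1 ht) (fun t ht => exists_ker₂_le h b0 b1 b2 ht) ht0
    constructor
    · refine D1.2.congr_of_eventuallyEq ?_
      filter_upwards [lt_mem_nhds ht0] with s hs using m.integral_coneLift_val φ hs
    · refine D2.2.congr_deriv ?_
      rw [integral_coneLift_val m _ ht0, integral_coneLift_val m _ ht0, integral_coneLift ht0]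
      have hker : ∀ ψ : ℝ → ℝ, Continuous ψ → (∀ x, |ψ x| ≤ C) →
          Integrable (m.ker ψ t) volume := fun ψ hc hb => by
        obtain ⟨B, hB⟩ := exists_ker_le h hb ht0
        exact (hw.const_mul B).mono' (m.continuous_ker hc t).aestronglyMeasurable
          (Eventually.of_forall fun z => hB t ⟨by linarith, by linarith⟩ z)
      have i0 := hker _ c0 b0
      have i2 := hker _ c2 b2
      have is : Integrable (fun z => (t * (jbr z ^ 3)⁻¹ : ℝ) • φ (t * vel z) • m.src t z)
          volume := by
        have := ((integrable_coneLift_iff ht0 _).1 (hsrc t ht)).bdd_smul (φ := fun z => φ (t * vel z)) C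
          (c0.comp (continuous_const.mul continuous_vel)).aestronglyMeasurable
          (Eventually.of_forall fun z => b0 _)
        refine this.congr (Eventually.of_forall fun z => ?_)
        exact smul_comm (φ (t * vel z)) (t * (jbr z ^ 3)⁻¹) (m.src t z)
      obtain ⟨B, hB⟩ := exists_flux_le h b0 b1 ht0
      -- The flux vanishes at ±∞, so the integral of its derivative is zero; written out, this is
      -- the equation tested against φ.
      have hz := (m.locAC_flux d0 d1 c2 t).integral_deriv_eq_zero (by
        filter_upwards [m.f.ae_hasDeriv, m.S.ae_hasDeriv] with z h1 h2
        exact m.hasDerivAt_flux d0 d1 ht0 h1 h2) (((D2.1.sub i2).add i0).sub is)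
        (tendsto_zero_of_le_inv_jbr hB).1 (tendsto_zero_of_le_inv_jbr hB).2
      rw [integral_sub' ((D2.1.sub i2).add i0) is, integral_add' (D2.1.sub i2) i0,
        integral_sub' D2.1 i2] at hz
      linear_combination hz

end Mode

/-! ### The four modes of the profile -/

/-- The jet of `|a|²`. -/
def Jet.normSq (a : Jet) : Jet := a.mul a.conj

/-- The jet of `phaseA`. -/
def jetSA (lam : ℝ) (a b : Jet) : Jet :=
  (Jet.invJbr.mul (a.normSq.add (b.normSq.smul 2))).smul (lam / 2)

/-- The jet of `phaseB`. -/
def jetSB (lam : ℝ) (a b : Jet) : Jet :=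
  (Jet.invJbr.mul ((a.normSq.smul 2).add b.normSq)).smul (-(lam / 2))

/-- The jet of `ampA2`. -/
def jetA2 (lam : ℝ) (a b : Jet) : Jet := ((a.mul a).mul b.conj).smul (-(lam / 8))

/-- The jet of `ampB2`. -/
def jetB2 (lam : ℝ) (a b : Jet) : Jet := ((b.mul b).mul a.conj).smul (-(lam / 8))

theorem Jet.normSq_f (a : Jet) (z : ℝ) : a.normSq.f z = ((‖a.f z‖ ^ 2 : ℝ) : ℂ) := by
  change a.f z * (starRingEnd ℂ) (a.f z) = _
  rw [Complex.mul_conj, Complex.normSq_eq_norm_sq]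

theorem jetSA_f (lam : ℝ) (a b : Jet) (z : ℝ) :
    (jetSA lam a b).f z = (phaseA lam a.f b.f z : ℂ) := by
  change (lam / 2 : ℂ) * ((((jbr z)⁻¹ : ℝ) : ℂ) * (a.normSq.f z + 2 * b.normSq.f z)) = _
  rw [Jet.normSq_f, Jet.normSq_f, phaseA]
  push_cast; ring

theorem jetSB_f (lam : ℝ) (a b : Jet) (z : ℝ) :
    (jetSB lam a b).f z = (phaseB lam a.f b.f z : ℂ) := by
  change (-(lam / 2) : ℂ) * ((((jbr z)⁻¹ : ℝ) : ℂ) * (2 * a.normSq.f z + b.normSq.f z)) = _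
  rw [Jet.normSq_f, Jet.normSq_f, phaseB]
  push_cast; ring

theorem jetA2_f (lam : ℝ) (a b : Jet) (z : ℝ) :
    (jetA2 lam a b).f z = ampA2 lam a.f b.f z := by
  change (-(lam / 8) : ℂ) * ((a.f z * a.f z) * (starRingEnd ℂ) (b.f z)) = _
  rw [ampA2]; ring

theorem jetB2_f (lam : ℝ) (a b : Jet) (z : ℝ) :
    (jetB2 lam a b).f z = ampB2 lam a.f b.f z := by
  change (-(lam / 8) : ℂ) * ((b.f z * b.f z) * (starRingEnd ℂ) (a.f z)) = _
  rw [ampB2]; ring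

theorem jetSA_real (lam : ℝ) (a b : Jet) (z : ℝ) : ((jetSA lam a b).f z).im = 0 := by
  rw [jetSA_f, Complex.ofReal_im]

theorem jetSB_real (lam : ℝ) (a b : Jet) (z : ℝ) : ((jetSB lam a b).f z).im = 0 := by
  rw [jetSB_f, Complex.ofReal_im]

/-- The mode carried by `A₁`. -/
def modeA (lam : ℝ) (a b : Jet) : Mode := ⟨1 / 2, -1, a, jetSA lam a b, jetSA_real lam a b⟩

/-- The mode carried by `B₁`. -/
def modeB (lam : ℝ) (a b : Jet) : Mode := ⟨1 / 2, 1, b, jetSB lam a b, jetSB_real lam a b⟩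

/-- The mode carried by `A₂`. -/
def modeA2 (lam : ℝ) (a b : Jet) : Mode :=
  ⟨-(1 / 2), -3, jetA2 lam a b, ((jetSA lam a b).smul 2).add ((jetSB lam a b).smul (-1)), fun z => by
    change (2 * (jetSA lam a b).f z + (-1) * (jetSB lam a b).f z).im = 0
    simp [jetSA_real, jetSB_real]⟩

/-- The mode carried by `B₂`. -/
def modeB2 (lam : ℝ) (a b : Jet) : Mode :=
  ⟨-(1 / 2), 3, jetB2 lam a b, ((jetSA lam a b).smul (-1)).add ((jetSB lam a b).smul 2), fun z => by
    change ((-1) * (jetSA lam a b).f z + 2 * (jetSB lam a b).f z).im = 0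
    simp [jetSA_real, jetSB_real]⟩

/-- The profile in the coordinates `(t, z)`. -/
def profileZ (lam : ℝ) (A B : ℝ → ℂ) (t z : ℝ) : ℂ :=
  ((t ^ (-(1 / 2) : ℝ) : ℝ) : ℂ) *
      (A z * cis (-(t / jbr z) + phaseA lam A B z * Real.log t) +
        B z * cis (t / jbr z + phaseB lam A B z * Real.log t)) +
    ((t ^ (-(3 / 2) : ℝ) : ℝ) : ℂ) *
      (ampA2 lam A B z *
          cis (-3 * (t / jbr z) + 2 * phaseA lam A B z * Real.log t
            - phaseB lam A B z * Real.log t) +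
        ampB2 lam A B z *
          cis (3 * (t / jbr z) - phaseA lam A B z * Real.log t
            + 2 * phaseB lam A B z * Real.log t))

theorem profile_eq_coneLift (lam : ℝ) (A B : ℝ → ℂ) (t : ℝ) :
    profile lam A B t = coneLift t (profileZ lam A B t) := by
  funext x
  by_cases h : |x| < t
  · simp only [profile, uap, vap, coneLift, if_pos h, profileZ, theta_eq h, neg_neg, mul_neg,
      neg_mul]
  · simp only [profile, uap, vap, coneLift, if_neg h, add_zero]

theorem profileZ_congr {lam : ℝ} {A B A' B' : ℝ → ℂ} {z : ℝ} (hA : A z = A' z) (hB : B z = B' z)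
    (t : ℝ) : profileZ lam A B t z = profileZ lam A' B' t z := by
  simp only [profileZ, phaseA, phaseB, ampA2, ampB2, hA, hB]

theorem profile_congr_ae {lam : ℝ} {A B A' B' : ℝ → ℂ} (hA : A =ᵐ[volume] A')
    (hB : B =ᵐ[volume] B') (t : ℝ) : profile lam A B t =ᵐ[volume] profile lam A' B' t := by
  rw [profile_eq_coneLift, profile_eq_coneLift]
  refine coneLift_congr_ae t ?_
  filter_upwards [hA, hB] with z h1 h2 using profileZ_congr h1 h2 t

theorem Mode.osc_eq_cis (m : Mode) {t z p : ℝ}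
    (h : (m.κ * t / jbr z + m.S.f z * Real.log t : ℂ) = p) : m.osc t z = cis p := by
  rw [Mode.osc, cis, ← h]
  congr 1
  ring

theorem oscA_eq (lam : ℝ) (a b : Jet) (t z : ℝ) : (modeA lam a b).osc t z =
    cis (-(t / jbr z) + phaseA lam a.f b.f z * Real.log t) := by
  refine Mode.osc_eq_cis _ ?_
  simp only [modeA, jetSA_f]; push_cast; ring

theorem oscB_eq (lam : ℝ) (a b : Jet) (t z : ℝ) : (modeB lam a b).osc t z =
    cis (t / jbr z + phaseB lam a.f b.f z * Real.log t) := by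
  refine Mode.osc_eq_cis _ ?_
  simp only [modeB, jetSB_f]; push_cast; ring

theorem oscA2_eq (lam : ℝ) (a b : Jet) (t z : ℝ) : (modeA2 lam a b).osc t z =
    cis (-3 * (t / jbr z) + 2 * phaseA lam a.f b.f z * Real.log t
            - phaseB lam a.f b.f z * Real.log t) := by
  refine Mode.osc_eq_cis _ ?_
  simp only [modeA2, Jet.add, Jet.smul, jetSA_f, jetSB_f]; push_cast; ring

theorem oscB2_eq (lam : ℝ) (a b : Jet) (t z : ℝ) : (modeB2 lam a b).osc t z =
    cis (3 * (t / jbr z) - phaseA lam a.f b.f z * Real.log t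
            + 2 * phaseB lam a.f b.f z * Real.log t) := by
  refine Mode.osc_eq_cis _ ?_
  simp only [modeB2, Jet.add, Jet.smul, jetSA_f, jetSB_f]; push_cast; ring

theorem norm_cis (p : ℝ) : ‖cis p‖ = 1 := by
  rw [cis, mul_comm, Complex.norm_exp_ofReal_mul_I]

theorem cis_add (p q : ℝ) : cis (p + q) = cis p * cis q := by
  simp only [cis, ← Complex.exp_add]; push_cast; ring_nf

theorem conj_cis (p : ℝ) : (starRingEnd ℂ) (cis p) = cis (-p) := by
  simp only [cis, ← Complex.exp_conj, map_mul, Complex.conj_I, Complex.conj_ofReal]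
  push_cast; ring_nf

/-- The frequency -3 and the phase 2S_A - S_B of the correction are those of the cubic interaction
of two waves A₁ with a conjugate wave B₁. -/
theorem oscA2_eq_mul (lam : ℝ) (a b : Jet) (t z : ℝ) : (modeA2 lam a b).osc t z =
    (modeA lam a b).osc t z ^ 2 * (starRingEnd ℂ) ((modeB lam a b).osc t z) := by
  rw [oscA2_eq, oscA_eq, oscB_eq, conj_cis, sq, ← cis_add, ← cis_add]
  congr 1; ring

theorem oscB2_eq_mul (lam : ℝ) (a b : Jet) (t z : ℝ) : (modeB2 lam a b).osc t z =
    (starRingEnd ℂ) ((modeA lam a b).osc t z) * (modeB lam a b).osc t z ^ 2 := by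
  rw [oscB2_eq, oscA_eq, oscB_eq, conj_cis, sq, ← cis_add, ← cis_add]
  congr 1; ring

theorem rpow_half_div {t : ℝ} (ht : 0 < t) : t ^ (1 / 2 : ℝ) / t = t ^ (-(1 / 2) : ℝ) := by
  rw [← Real.rpow_sub_one ht.ne']; norm_num

theorem rpow_neg_half_div {t : ℝ} (ht : 0 < t) :
    t ^ (-(1 / 2) : ℝ) / t = t ^ (-(3 / 2) : ℝ) := by
  rw [← Real.rpow_sub_one ht.ne']; norm_num

theorem profileZ_eq_modes (lam : ℝ) (a b : Jet) {t : ℝ} (ht : 0 < t) (z : ℝ) :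
    profileZ lam a.f b.f t z = (modeA lam a b).val t z + (modeB lam a b).val t z
      + (modeA2 lam a b).val t z + (modeB2 lam a b).val t z := by
  simp only [Mode.val, oscA_eq, oscB_eq, oscA2_eq, oscB2_eq]
  simp only [modeA, modeB, modeA2, modeB2, jetA2_f, jetB2_f, rpow_half_div ht,
    rpow_neg_half_div ht, profileZ]
  ring

section Bounds
variable {K c : ℝ} {k h : ℝ → ℝ} {lam : ℝ} {a b : Jet}

theorem jetBound_normSq (H : Controls K k h) (ha : JetBound K k h 1 0 a) :
    JetBound K k h 4 1 a.normSq := by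
  simpa [Jet.normSq] using JetBound.mul H zero_le_one zero_le_one ha ha.conj

/-- 42 = 7 · (4 + 2 · 4)/2: the squares cost 4 each, the factor ⟨z⟩⁻¹ costs 7, and λ/2 remains. -/
theorem jetBound_SA (H : Controls K k h) (ha : JetBound K k h 1 0 a) (hb : JetBound K k h 1 0 b) :
    JetBound K k h (42 * |lam|) 1 (jetSA lam a b) := by
  have h1 := ((jetBound_normSq H ha).add ((jetBound_normSq H hb).smul 2))
  have h2 := (JetBound.invJbr_mul H (by norm_num) h1).smul ((lam / 2 : ℂ))
  refine h2.mono H (le_of_eq ?_)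
  simp only [norm_div, Complex.norm_real, Complex.norm_ofNat, Real.norm_eq_abs]
  ring

theorem jetBound_SB (H : Controls K k h) (ha : JetBound K k h 1 0 a) (hb : JetBound K k h 1 0 b) :
    JetBound K k h (42 * |lam|) 1 (jetSB lam a b) := by
  have h1 := (((jetBound_normSq H ha).smul 2).add (jetBound_normSq H hb))
  have h2 := (JetBound.invJbr_mul H (by norm_num) h1).smul ((-(lam / 2) : ℂ))
  refine h2.mono H (le_of_eq ?_)
  simp only [norm_div, norm_neg, Complex.norm_real, Complex.norm_ofNat, Real.norm_eq_abs]
  ring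

/-- 2 = 4 · 4/8: two products and the factor λ/8. -/
theorem jetBound_A2 (H : Controls K k h) (ha : JetBound K k h 1 0 a) (hb : JetBound K k h 1 0 b) :
    JetBound K k h (2 * |lam|) 2 (jetA2 lam a b) := by
  have h1 := JetBound.mul H (by norm_num) zero_le_one
    (JetBound.mul H zero_le_one zero_le_one ha ha) hb.conj
  have h2 := h1.smul ((-(lam / 8) : ℂ))
  refine h2.mono H (le_of_eq ?_)
  simp only [norm_div, norm_neg, Complex.norm_real, Complex.norm_ofNat, Real.norm_eq_abs]
  ring

theorem jetBound_B2 (H : Controls K k h) (ha : JetBound K k h 1 0 a) (hb : JetBound K k h 1 0 b) :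
    JetBound K k h (2 * |lam|) 2 (jetB2 lam a b) := by
  have h1 := JetBound.mul H (by norm_num) zero_le_one
    (JetBound.mul H zero_le_one zero_le_one hb hb) ha.conj
  have h2 := h1.smul ((-(lam / 8) : ℂ))
  refine h2.mono H (le_of_eq ?_)
  simp only [norm_div, norm_neg, Complex.norm_real, Complex.norm_ofNat, Real.norm_eq_abs]
  ring

end Bounds

/-! ### Bounds on the remainder of a mode -/

namespace Mode
variable {K c : ℝ} {k h : ℝ → ℝ} {m : Mode} {p : ℕ}

/-- A mode whose amplitude is homogeneous of degree `p + 1` and whose phase is quadratic. -/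
structure Controlled (m : Mode) (K : ℝ) (k h : ℝ → ℝ) (c : ℝ) (p : ℕ) : Prop where
  one_le : 1 ≤ c
  r_le : |m.r| ≤ 1
  amp : JetBound K k h c p m.f
  phase : JetBound K k h c 1 m.S

theorem Controlled.S_le (H : Controls K k h) (hm : m.Controlled K k h c p) (z : ℝ) :
    ‖m.S.f z‖ ≤ c * (1 + K ^ 2) ∧ ‖m.S.f₁ z‖ ≤ c * (1 + K ^ 2) := by
  have hc : 0 ≤ c := zero_le_one.trans hm.one_le
  have hK := H.K_nonneg
  have e : c * K ^ 1 * k z ≤ c * (1 + K ^ 2) := by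
    have := H.le_K z
    rw [pow_one, mul_assoc]
    gcongr
    nlinarith
  exact ⟨(hm.phase.b₀ z).trans e, (hm.phase.b₁ z).trans e⟩

theorem Controlled.bounded (H : Controls K k h) (hm : m.Controlled K k h c p) :
    m.Bounded (c * K ^ p * K + c * (1 + K ^ 2)) := by
  have hc : 0 ≤ c := zero_le_one.trans hm.one_le
  have hK := H.K_nonneg
  have e : ∀ {x z : ℝ}, x ≤ c * K ^ p * k z →
      jbr z ^ 2 * x ≤ c * K ^ p * K + c * (1 + K ^ 2) := by
    intro x z hx
    calc jbr z ^ 2 * x ≤ jbr z ^ 2 * (c * K ^ p * k z) := by gcongr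
      _ = c * K ^ p * (jbr z ^ 2 * k z) := by ring
      _ ≤ c * K ^ p * K := by have := H.decay z; gcongr
      _ ≤ _ := by have : 0 ≤ c * (1 + K ^ 2) := by positivity
                  linarith
  have e' : c * (1 + K ^ 2) ≤ c * K ^ p * K + c * (1 + K ^ 2) := by
    have : 0 ≤ c * K ^ p * K := by positivity
    linarith
  exact ⟨fun z => e (hm.amp.b₀ z), fun z => e (hm.amp.b₁ z),
    fun z => (hm.S_le H z).1.trans e', fun z => (hm.S_le H z).2.trans e'⟩

/-- P stands for the bound on the phase terms, logarithm included, and X for that on the amplitude.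
Each term is at most quadratic in P and has at most four powers of j; the count is 33 = 6 + 14 + 8 +
5. -/
theorem rem_bound_aux {P X j : ℝ} (hP1 : 1 ≤ P) (hX0 : 0 ≤ X) (hj1 : 1 ≤ j) :
    ((2 * P) ^ 2 + 2 * P) * X
      + 2 * j ^ 3 * (2 * P * X + 1 * P * X + 1 * (2 * P) * (2 * P * X))
      + j ^ 3 * (1 * (2 * P * X) + j * (X + P * X + P * X + P * (2 * P * X))
        + 2 * X + 2 * 1 * (2 * P * X)) ≤ 33 * j ^ 4 * (P ^ 2 * X) := by
  obtain ⟨Y, hY⟩ : ∃ Y, Y = P * X := ⟨_, rfl⟩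
  obtain ⟨Z, hZ⟩ : ∃ Z, Z = P ^ 2 * X := ⟨_, rfl⟩
  have hP0 : 0 ≤ P := by linarith
  have hXY : X ≤ Y := hY ▸ le_mul_of_one_le_left hX0 hP1
  have hYZ : Y ≤ Z := by
    rw [hZ, sq, mul_assoc, ← hY]; exact le_mul_of_one_le_left (hX0.trans hXY) hP1
  have hZ0 : 0 ≤ Z := by linarith
  have j34 : j ^ 3 ≤ j ^ 4 := pow_le_pow_right₀ hj1 (by norm_num)
  have j04 : 1 ≤ j ^ 4 := one_le_pow₀ hj1
  have hj0 : 0 ≤ j := by linarith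
  calc _ = (4 * Z + 2 * Y) + 2 * j ^ 3 * (3 * Y + 4 * Z) + j ^ 3 * (6 * Y + 2 * X)
        + j ^ 4 * (X + 2 * Y + 2 * Z) := by rw [hZ, hY]; ring
    _ ≤ 1 * (6 * Z) + 2 * j ^ 4 * (7 * Z) + j ^ 4 * (8 * Z) + j ^ 4 * (5 * Z) := by
        have e1 : 4 * Z + 2 * Y ≤ 1 * (6 * Z) := by linarith
        have e2 : 3 * Y + 4 * Z ≤ 7 * Z := by linarith
        have e3 : 6 * Y + 2 * X ≤ 8 * Z := by linarith
        have e4 : X + 2 * Y + 2 * Z ≤ 5 * Z := by linarith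
        have e5 : 0 ≤ 6 * Y + 2 * X := by linarith
        have e6 : 0 ≤ 3 * Y + 4 * Z := by linarith
        gcongr
    _ ≤ j ^ 4 * (6 * Z) + 2 * j ^ 4 * (7 * Z) + j ^ 4 * (8 * Z) + j ^ 4 * (5 * Z) := by gcongr
    _ = _ := by rw [← hZ]; ring

theorem Controlled.norm_rem_le (H : Controls K k h) (hm : m.Controlled K k h c p) (t z : ℝ) :
    ‖m.rem t z‖ ≤ 33 * jbr z ^ 4 *
      ((c * (1 + K ^ 2) * (1 + |Real.log t|)) ^ 2 * (c * K ^ p * h z)) := by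
  have hc : 0 ≤ c := zero_le_one.trans hm.one_le
  have hc1 := hm.one_le
  have hK := H.K_nonneg
  have hh := H.h_nonneg z
  have hj := jbr_pos z
  have hj1 := one_le_jbr z
  set u := 1 + K ^ 2 with hu
  have hu1 : 1 ≤ u := by nlinarith [sq_nonneg K]
  set l := 1 + |Real.log t| with hl
  have hl1 : 1 ≤ l := by linarith [abs_nonneg (Real.log t)]
  set X := c * K ^ p * h z with hX
  have hX0 : 0 ≤ X := by positivity
  set P := c * u * l with hP
  have hcu : 1 ≤ c * u := one_le_mul_of_one_le_of_one_le hc1 hu1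
  have hP1 : 1 ≤ P := one_le_mul_of_one_le_of_one_le hcu hl1
  have hP0 : 0 ≤ P := by linarith
  have huP : c * u ≤ P := le_mul_of_one_le_right (by linarith) hl1
  have hkh : c * K ^ p * k z ≤ X :=
    mul_le_mul_of_nonneg_left (H.le_h z) (by positivity)
  have f0 : ‖m.f.f z‖ ≤ X := (hm.amp.b₀ z).trans hkh
  have f1 : ‖m.f.f₁ z‖ ≤ X := (hm.amp.b₁ z).trans hkh
  have f2 : ‖m.f.f₂ z‖ ≤ X := hm.amp.b₂ z
  obtain ⟨S0, S1⟩ := hm.S_le H z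
  have nI : ∀ w : ℂ, ‖Complex.I * w‖ = ‖w‖ := fun w => by
    rw [norm_mul, Complex.norm_I, one_mul]
  have nL : ‖(Real.log t : ℂ)‖ ≤ l := by
    rw [Complex.norm_real, Real.norm_eq_abs]; linarith
  have s0 : ‖Complex.I * m.S.f z‖ ≤ P := (nI _).trans_le (S0.trans huP)
  have s1 : ‖Complex.I * m.S.f₁ z‖ ≤ P := (nI _).trans_le (S1.trans huP)
  have s1L : ‖Complex.I * m.S.f₁ z * Real.log t‖ ≤ P :=
    norm_mul_le_mul ((nI _).trans_le S1) nL
  have s2f : ‖Complex.I * m.S.f₂ z * Real.log t * m.f.f z‖ ≤ P * X := by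
    -- S'' is controlled only by h, which has no uniform bound. Here S'' supplies the factor h of
    -- the final estimate, and f supplies k ≤ K.
    have e1 : ‖m.S.f₂ z * m.f.f z‖ ≤ c * u * X := by
      refine (norm_mul_le_mul (hm.phase.b₂ z) (hm.amp.b₀ z)).trans ?_
      rw [show c * K ^ 1 * h z * (c * K ^ p * k z) = c * (K * k z) * X by rw [hX]; ring]
      gcongr
      nlinarith [H.le_K z]
    rw [show Complex.I * m.S.f₂ z * Real.log t * m.f.f z
      = Complex.I * (m.S.f₂ z * m.f.f z * Real.log t) by ring, nI]
    refine (norm_mul_le_mul e1 nL).trans (le_of_eq ?_)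
    rw [hP]; ring
  have rs : ‖(m.r : ℂ) + Complex.I * m.S.f z‖ ≤ 2 * P := by
    refine (norm_add_le _ _).trans ?_
    rw [Complex.norm_real, Real.norm_eq_abs]
    linarith [hm.r_le]
  have hD : ‖m.f.f₁ z + Complex.I * m.S.f₁ z * Real.log t * m.f.f z‖ ≤ 2 * P * X := by
    refine (norm_add_le _ _).trans ((add_le_add f1 (norm_mul_le_mul s1L f0)).trans ?_)
    nlinarith
  have nj : ‖(jbr z : ℂ)‖ = jbr z := by rw [Complex.norm_real, Real.norm_of_nonneg hj.le]
  have nj3 : ‖(jbr z : ℂ) ^ 3‖ = jbr z ^ 3 := by rw [norm_pow, nj]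
  have nz : ‖(z : ℂ) / jbr z‖ ≤ 1 := by
    rw [norm_div, nj, Complex.norm_real, Real.norm_eq_abs, div_le_one hj]
    exact abs_le_jbr z
  have dj3 : ∀ {w : ℂ} {x : ℝ}, ‖w‖ ≤ x → ‖w / (jbr z : ℂ) ^ 3‖ ≤ x := by
    intro w x hw
    rw [norm_div, nj3]
    exact (div_le_self (norm_nonneg _) (one_le_pow₀ hj1)).trans hw
  have main : ‖m.rem t z‖ ≤ ((2 * P) ^ 2 + 2 * P) * X
      + 2 * jbr z ^ 3 * (2 * P * X + 1 * P * X + 1 * (2 * P) * (2 * P * X))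
      + jbr z ^ 3 * (1 * (2 * P * X) + jbr z * (X + P * X + P * X + P * (2 * P * X))
        + 2 * X + 2 * 1 * (2 * P * X)) := by
    refine (norm_sub_le _ _).trans (add_le_add ((norm_sub_le _ _).trans (add_le_add ?_ ?_)) ?_)
    · refine norm_mul_le_mul ((norm_sub_le _ _).trans (add_le_add ?_ rs)) f0
      rw [norm_pow]; gcongr
    · refine norm_mul_le_mul ?_ (norm_add₃_le.trans (add_le_add (add_le_add ?_ ?_) ?_))
      · rw [norm_mul, nj3, Complex.norm_ofNat]
      · exact dj3 (norm_mul_le_mul rs f0)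
      · exact norm_mul_le_mul (norm_mul_le_mul nz s1) f0
      · exact norm_mul_le_mul (norm_mul_le_mul nz rs) hD
    · refine norm_mul_le_mul nj3.le ((norm_sub_le _ _).trans (add_le_add ((norm_sub_le _ _).trans
        (add_le_add ((norm_add_le _ _).trans (add_le_add ?_ ?_)) ?_)) ?_))
      · exact norm_mul_le_mul nz hD
      · refine norm_mul_le_mul nj.le ((norm_add_le _ _).trans
          (add_le_add (norm_add₃_le.trans (add_le_add (add_le_add f2 s2f) ?_)) ?_))
        · exact norm_mul_le_mul s1L f1
        · exact norm_mul_le_mul s1L hD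
      · exact dj3 (norm_mul_le_mul (by simp) f0)
      · exact norm_mul_le_mul (norm_mul_le_mul (by simp) nz) hD
  exact main.trans (rem_bound_aux hP1 hX0 hj1)

end Mode

/-! ### The cubic term and the cancellation of the leading orders -/

theorem norm_cubic_sub_le (lam : ℝ) {x y : ℂ} {R : ℝ} (hx : ‖x‖ ≤ R) (hy : ‖y‖ ≤ R) :
    ‖cubic lam x - cubic lam y‖ ≤ 3 * |lam| * R ^ 2 * ‖x - y‖ := by
  have e : cubic lam x - cubic lam y = (lam : ℂ) *
      (((‖x‖ ^ 2 : ℝ) : ℂ) * (x - y) + ((‖x‖ ^ 2 - ‖y‖ ^ 2 : ℝ) : ℂ) * y) := by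
    unfold cubic; push_cast; ring
  have hR : 0 ≤ R := (norm_nonneg _).trans hx
  have h1 : |‖x‖ ^ 2 - ‖y‖ ^ 2| ≤ 2 * R * ‖x - y‖ := by
    rw [sq_sub_sq, abs_mul]
    have := abs_norm_sub_norm_le x y
    rw [abs_of_nonneg (by positivity : 0 ≤ ‖x‖ + ‖y‖)]
    gcongr
    linarith
  have h2 : ‖x‖ ^ 2 ≤ R ^ 2 := by gcongr
  rw [e, norm_mul, Complex.norm_real, Real.norm_eq_abs]
  calc |lam| * ‖((‖x‖ ^ 2 : ℝ) : ℂ) * (x - y) + ((‖x‖ ^ 2 - ‖y‖ ^ 2 : ℝ) : ℂ) * y‖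
      ≤ |lam| * (R ^ 2 * ‖x - y‖ + 2 * R * ‖x - y‖ * R) := by
        gcongr
        refine (norm_add_le _ _).trans (add_le_add ?_ ?_)
        · exact Mode.norm_mul_le_mul (Mode.norm_real_le (by rwa [abs_of_nonneg (sq_nonneg _)])) le_rfl
        · exact Mode.norm_mul_le_mul (Mode.norm_real_le h1) hy
    _ = _ := by ring

/-- Since o and p have modulus one, only four phases occur: o and p themselves, which are resonant,
and the third harmonics. Here ρ plays the role of t^{-1/2}, so ρ³ = ρ/t. -/
theorem cubic_two_modes {lam ρ t : ℝ} {a b o p : ℂ} (ho : ‖o‖ = 1) (hp : ‖p‖ = 1) (ht : t ≠ 0)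
    (hρ : ρ ^ 2 * t = 1) :
    cubic lam (ρ * (a * o + b * p)) = ρ / t * (
      lam * (‖a‖ ^ 2 + 2 * ‖b‖ ^ 2 : ℝ) * (a * o) + lam * (2 * ‖a‖ ^ 2 + ‖b‖ ^ 2 : ℝ) * (b * p)
      + lam * (a ^ 2 * (starRingEnd ℂ) b) * (o ^ 2 * (starRingEnd ℂ) p)
      + lam * ((starRingEnd ℂ) a * b ^ 2) * ((starRingEnd ℂ) o * p ^ 2)) := by
  have ns : ∀ w : ℂ, ((‖w‖ ^ 2 : ℝ) : ℂ) = w * (starRingEnd ℂ) w := fun w => by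
    rw [Complex.mul_conj, Complex.normSq_eq_norm_sq]
  have h1 : o * (starRingEnd ℂ) o = 1 := by rw [← ns, ho]; simp
  have h2 : p * (starRingEnd ℂ) p = 1 := by rw [← ns, hp]; simp
  have h3 : (ρ : ℂ) ^ 2 * t = 1 := by exact_mod_cast hρ
  have ht' : (t : ℂ) ≠ 0 := by exact_mod_cast ht
  have h4 : (ρ : ℂ) / t = ρ ^ 3 := by
    rw [div_eq_iff ht']; linear_combination (-(ρ : ℂ)) * h3
  rw [cubic, ns, h4]
  push_cast
  have na := ns a
  have nb := ns b
  push_cast at na nb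
  rw [na, nb]
  simp only [map_mul, map_add, Complex.conj_ofReal]
  linear_combination (lam * (ρ : ℂ) ^ 3 * (a ^ 2 * (starRingEnd ℂ) a * o
      + 2 * a * b * (starRingEnd ℂ) a * p)) * h1
    + (lam * (ρ : ℂ) ^ 3 * (2 * a * b * (starRingEnd ℂ) b * o
      + b ^ 2 * (starRingEnd ℂ) b * p)) * h2

theorem Mode.src_eq (m : Mode) (t z : ℝ) : m.src t z =
    ((t ^ m.r / t : ℝ) : ℂ) * m.osc t z *
    ((1 - (m.κ : ℂ) ^ 2) * m.f.f z
      + jbr z * (-2 * m.κ * m.S.f z + Complex.I * m.κ * (2 * m.r - 1)) * m.f.f z / t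
      + m.rem t z / t ^ 2) := by
  unfold src
  linear_combination (((t ^ m.r / t : ℝ) : ℂ) * m.osc t z * ((m.κ : ℂ) ^ 2 * m.f.f z
    + jbr z * (2 * m.κ * m.S.f z) * m.f.f z / t)) * Complex.I_sq

/-- The constant controlling all modes. -/
def modeConst (lam : ℝ) : ℝ := 126 * (|lam| + 1)

theorem one_le_modeConst (lam : ℝ) : 1 ≤ modeConst lam := by
  unfold modeConst; linarith [abs_nonneg lam]

/-- `(□ + 1)` of the profile in the coordinates `(t, z)`. -/
def sourceZ (lam : ℝ) (a b : Jet) (t z : ℝ) : ℂ :=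
  (modeA lam a b).src t z + (modeB lam a b).src t z
    + (modeA2 lam a b).src t z + (modeB2 lam a b).src t z

section Bounds
variable {K : ℝ} {k h : ℝ → ℝ} {lam : ℝ} {a b : Jet}

theorem controlled_modeA (H : Controls K k h) (ha : JetBound K k h 1 0 a)
    (hb : JetBound K k h 1 0 b) : (modeA lam a b).Controlled K k h (modeConst lam) 0 :=
  ⟨one_le_modeConst lam, by rw [abs_le]; constructor <;> norm_num [modeA],
    ha.mono H (one_le_modeConst lam),
    (jetBound_SA H ha hb).mono H (by unfold modeConst; linarith [abs_nonneg lam])⟩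

theorem controlled_modeB (H : Controls K k h) (ha : JetBound K k h 1 0 a)
    (hb : JetBound K k h 1 0 b) : (modeB lam a b).Controlled K k h (modeConst lam) 0 :=
  ⟨one_le_modeConst lam, by rw [abs_le]; constructor <;> norm_num [modeB],
    hb.mono H (one_le_modeConst lam),
    (jetBound_SB H ha hb).mono H (by unfold modeConst; linarith [abs_nonneg lam])⟩

/-- The phase 2S_A - S_B costs three times the bound 42|λ|; this is where the 126 in `modeConst`
comes from. -/
theorem controlled_modeA2 (H : Controls K k h) (ha : JetBound K k h 1 0 a)
    (hb : JetBound K k h 1 0 b) : (modeA2 lam a b).Controlled K k h (modeConst lam) 2 :=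
  ⟨one_le_modeConst lam, by rw [abs_le]; constructor <;> norm_num [modeA2],
    (jetBound_A2 H ha hb).mono H (by unfold modeConst; linarith [abs_nonneg lam]),
    (((jetBound_SA H ha hb).smul 2).add ((jetBound_SB H ha hb).smul (-1))).mono H
      (by simp only [norm_neg, norm_one, Complex.norm_ofNat]
          unfold modeConst; linarith [abs_nonneg lam])⟩

theorem controlled_modeB2 (H : Controls K k h) (ha : JetBound K k h 1 0 a)
    (hb : JetBound K k h 1 0 b) : (modeB2 lam a b).Controlled K k h (modeConst lam) 2 :=
  ⟨one_le_modeConst lam, by rw [abs_le]; constructor <;> norm_num [modeB2],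
    (jetBound_B2 H ha hb).mono H (by unfold modeConst; linarith [abs_nonneg lam]),
    (((jetBound_SA H ha hb).smul (-1)).add ((jetBound_SB H ha hb).smul 2)).mono H
      (by simp only [norm_neg, norm_one, Complex.norm_ofNat]
          unfold modeConst; linarith [abs_nonneg lam])⟩

/-- All terms of order t^{-1/2} and t^{-3/2} cancel: κ² = 1 and 2r = 1 for the leading modes, the
choice of S_A, S_B removes the resonant cubic terms, and that of A₂, B₂ the third harmonics. There
remain the effect of the corrections inside the cubic, the remainders of the leading modes, and for
the corrections the next-order terms, with iκ(2r - 1) = ±6i, and the remainders. -/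
theorem sourceZ_sub_cubic (lam : ℝ) (a b : Jet) {t : ℝ} (ht : 0 < t) (z : ℝ) :
    sourceZ lam a b t z - cubic lam (profileZ lam a.f b.f t z) =
      (cubic lam ((modeA lam a b).val t z + (modeB lam a b).val t z)
        - cubic lam (profileZ lam a.f b.f t z))
      + ((t ^ (-(1 / 2) : ℝ) / t ^ 2 : ℝ) : ℂ) * (
        ((modeA lam a b).osc t z * (modeA lam a b).rem t z
          + (modeB lam a b).osc t z * (modeB lam a b).rem t z)
        + ((modeA2 lam a b).osc t z * (jbr z * (6 * ((modeA2 lam a b).S.f z + Complex.I))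
            * (jetA2 lam a b).f z)
          + (modeB2 lam a b).osc t z * (jbr z * (-6 * ((modeB2 lam a b).S.f z + Complex.I))
            * (jetB2 lam a b).f z))
        + ((modeA2 lam a b).osc t z * (modeA2 lam a b).rem t z
          + (modeB2 lam a b).osc t z * (modeB2 lam a b).rem t z) / t) := by
  have hj : (jbr z : ℂ) ≠ 0 := by exact_mod_cast jbr_ne_zero z
  have ht' : (t : ℂ) ≠ 0 := by exact_mod_cast ht.ne'
  have hρ : (t ^ (-(1 / 2) : ℝ)) ^ 2 * t = 1 := by
    rw [← Real.rpow_natCast, ← Real.rpow_mul ht.le]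
    norm_num
    rw [Real.rpow_neg_one, inv_mul_cancel₀ ht.ne']
  have hc := cubic_two_modes (lam := lam) (a := a.f z) (b := b.f z)
    ((modeA lam a b).norm_osc t z) ((modeB lam a b).norm_osc t z) ht.ne' hρ
  rw [← oscA2_eq_mul, ← oscB2_eq_mul] at hc
  have vA : (modeA lam a b).val t z + (modeB lam a b).val t z
      = ((t ^ (-(1 / 2) : ℝ) : ℝ) : ℂ) * (a.f z * (modeA lam a b).osc t z
        + b.f z * (modeB lam a b).osc t z) := by
    simp only [Mode.val, modeA, modeB, rpow_half_div ht]; ring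
  -- The phases are designed for this: -2κ⟨z⟩S is the resonant coefficient of the cubic.
  have sA : (jbr z : ℂ) * (2 * (phaseA lam a.f b.f z : ℂ))
      = lam * (‖a.f z‖ ^ 2 + 2 * ‖b.f z‖ ^ 2 : ℝ) := by
    rw [phaseA]; push_cast; field_simp
  have sB : (jbr z : ℂ) * (-2 * (phaseB lam a.f b.f z : ℂ))
      = lam * (2 * ‖a.f z‖ ^ 2 + ‖b.f z‖ ^ 2 : ℝ) := by
    rw [phaseB]; push_cast; field_simp
  -- -8 = 1 - 3² is the leading factor of □ + 1 at frequency ±3.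
  have fA : (-8 : ℂ) * (jetA2 lam a b).f z
      = lam * (a.f z ^ 2 * (starRingEnd ℂ) (b.f z)) := by
    rw [jetA2_f, ampA2]; ring
  have fB : (-8 : ℂ) * (jetB2 lam a b).f z
      = lam * ((starRingEnd ℂ) (a.f z) * b.f z ^ 2) := by
    rw [jetB2_f, ampB2]; ring
  rw [vA, hc, ← sA, ← sB, ← fA, ← fB]
  simp only [sourceZ, Mode.src_eq]
  generalize (modeA lam a b).osc t z = oA
  generalize (modeB lam a b).osc t z = oB
  generalize (modeA2 lam a b).osc t z = oA2
  generalize (modeB2 lam a b).osc t z = oB2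
  generalize (modeA lam a b).rem t z = rA
  generalize (modeB lam a b).rem t z = rB
  generalize (modeA2 lam a b).rem t z = rA2
  generalize (modeB2 lam a b).rem t z = rB2
  simp only [modeA, modeB, modeA2, modeB2, rpow_half_div ht]
  rw [jetSA_f, jetSB_f]
  push_cast
  ring

/-- One factor of the data is kept as h, for the L² norm, and the others go into powers of K. The
constant is 180 = 24 + 66 + 24 + 66: difference of cubics, remainders of the leading modes,
next-order terms of the corrections, and their remainders. -/
theorem norm_sourceZ_sub_cubic_le (H : Controls K k h) (ha : JetBound K k h 1 0 a)
    (hb : JetBound K k h 1 0 b) {t : ℝ} (ht : 1 ≤ t) (z : ℝ) :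
    ‖sourceZ lam a b t z - cubic lam (profileZ lam a.f b.f t z)‖ ≤
      180 * modeConst lam ^ 4 * (t ^ (-(1 / 2) : ℝ) / t ^ 2) * (1 + |Real.log t|) ^ 2
        * (1 + K ^ 2) ^ 4 * (jbr z ^ 4 * h z) := by
  have ht0 : 0 < t := by linarith
  have cA := controlled_modeA (lam := lam) H ha hb
  have cB := controlled_modeB (lam := lam) H ha hb
  have cA2 := controlled_modeA2 (lam := lam) H ha hb
  have cB2 := controlled_modeB2 (lam := lam) H ha hb
  have rA := cA.norm_rem_le H t z
  have rB := cB.norm_rem_le H t z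
  have rA2 := cA2.norm_rem_le H t z
  have rB2 := cB2.norm_rem_le H t z
  have hlc : |lam| ≤ modeConst lam := by unfold modeConst; linarith [abs_nonneg lam]
  have hc1 := one_le_modeConst lam
  have SA2 := (cA2.S_le H z).1
  have SB2 := (cB2.S_le H z).1
  have hK := H.K_nonneg
  have hh := H.h_nonneg z
  have hj1 := one_le_jbr z
  have hkK := H.le_K z
  have hkh := H.le_h z
  have hk0 := H.nonneg z
  rw [sourceZ_sub_cubic lam a b ht0]
  generalize modeConst lam = c at *
  have hc0 : 0 ≤ c := by linarith
  obtain ⟨u, hu⟩ : ∃ u, u = 1 + K ^ 2 := ⟨_, rfl⟩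
  obtain ⟨l, hl⟩ : ∃ l, l = 1 + |Real.log t| := ⟨_, rfl⟩
  obtain ⟨ρ, hρ⟩ : ∃ ρ : ℝ, ρ = t ^ (-(1 / 2) : ℝ) := ⟨_, rfl⟩
  have hρ0 : 0 < ρ := hρ ▸ Real.rpow_pos_of_pos ht0 _
  have hρ2 : ρ ^ 2 * t = 1 := by
    rw [hρ, ← Real.rpow_natCast, ← Real.rpow_mul ht0.le]
    norm_num
    rw [Real.rpow_neg_one, inv_mul_cancel₀ ht0.ne']
  rw [← hu, ← hl] at rA rB rA2 rB2
  rw [← hu] at SA2 SB2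
  rw [← hu, ← hl, ← hρ]
  have hu1 : 1 ≤ u := by rw [hu]; nlinarith [sq_nonneg K]
  have hl1 : 1 ≤ l := by rw [hl]; linarith [abs_nonneg (Real.log t)]
  have hK2 : K ^ 2 ≤ u := by rw [hu]; linarith
  have hu0 : 0 ≤ u := by linarith
  have hl0 : 0 ≤ l := by linarith
  have hj0 : 0 ≤ jbr z := by linarith
  obtain ⟨Z, hZ⟩ : ∃ Z, Z = l ^ 2 * u ^ 4 * (jbr z ^ 4 * h z) := ⟨_, rfl⟩
  have hZ0 : 0 ≤ Z := by rw [hZ]; positivity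
  have c34 : c ^ 3 ≤ c ^ 4 := pow_le_pow_right₀ hc1 (by norm_num)
  have c24 : c ^ 2 ≤ c ^ 4 := pow_le_pow_right₀ hc1 (by norm_num)
  have l2 : 1 ≤ l ^ 2 := one_le_pow₀ hl1
  have j41 : jbr z ≤ jbr z ^ 4 := le_self_pow₀ hj1 (by norm_num)
  have j4 : 1 ≤ jbr z ^ 4 := one_le_pow₀ hj1
  have u24 : u ^ 2 ≤ u ^ 4 := pow_le_pow_right₀ hu1 (by norm_num)
  have u34 : u ^ 3 ≤ u ^ 4 := pow_le_pow_right₀ hu1 (by norm_num)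
  have R1 : 33 * jbr z ^ 4 * ((c * u * l) ^ 2 * (c * K ^ 0 * h z)) ≤ 33 * c ^ 4 * Z := by
    calc _ = 33 * c ^ 3 * (l ^ 2 * u ^ 2 * (jbr z ^ 4 * h z)) := by ring
      _ ≤ 33 * c ^ 4 * Z := by rw [hZ]; gcongr
  have R2 : 33 * jbr z ^ 4 * ((c * u * l) ^ 2 * (c * K ^ 2 * h z)) ≤ 33 * c ^ 4 * Z := by
    calc _ = 33 * c ^ 3 * (l ^ 2 * (u ^ 2 * K ^ 2) * (jbr z ^ 4 * h z)) := by ring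
      _ ≤ 33 * c ^ 3 * (l ^ 2 * (u ^ 2 * u) * (jbr z ^ 4 * h z)) := by gcongr
      _ = 33 * c ^ 3 * (l ^ 2 * u ^ 3 * (jbr z ^ 4 * h z)) := by ring
      _ ≤ 33 * c ^ 4 * Z := by rw [hZ]; gcongr
  have nj : ‖(jbr z : ℂ)‖ = jbr z := by rw [Complex.norm_real, Real.norm_of_nonneg hj0]
  have M2 : ∀ {w S f : ℂ}, ‖w‖ = 6 → ‖S‖ ≤ c * u → ‖f‖ ≤ c * K ^ 2 * k z →
      ‖(jbr z : ℂ) * (w * (S + Complex.I)) * f‖ ≤ 12 * c ^ 4 * Z := by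
    intro w S f hw hS hf
    have h1 : ‖S + Complex.I‖ ≤ 2 * (c * u) := by
      refine (norm_add_le _ _).trans ?_
      rw [Complex.norm_I]
      linarith [one_le_mul_of_one_le_of_one_le hc1 hu1]
    calc _ ≤ jbr z * (6 * (2 * (c * u))) * (c * K ^ 2 * k z) :=
          Mode.norm_mul_le_mul (Mode.norm_mul_le_mul nj.le (Mode.norm_mul_le_mul hw.le h1)) hf
      _ ≤ jbr z ^ 4 * (6 * (2 * (c * u))) * (c * u * h z) := by gcongr
      _ = 12 * c ^ 2 * (1 * u ^ 2 * (jbr z ^ 4 * h z)) := by ring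
      _ ≤ 12 * c ^ 4 * Z := by rw [hZ]; gcongr
  have nval : ∀ (m : Mode) {x : ℝ}, ‖m.f.f z‖ ≤ x → ‖m.val t z‖ ≤ t ^ m.r / t * x := by
    intro m x hx
    unfold Mode.val
    rw [norm_mul, m.norm_osc, mul_one]
    refine Mode.norm_mul_le_mul (Mode.norm_real_le ?_) hx
    rw [abs_of_nonneg (div_nonneg (Real.rpow_nonneg ht0.le _) ht0.le)]
  have ck : c * K ^ 0 * k z ≤ c * K := by rw [pow_zero, mul_one]; gcongr
  -- Two bounds for the corrections: this one retains h, the next is uniform in z.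
  have ck2 : c * K ^ 2 * k z ≤ c * u * h z := by gcongr
  have ck3 : c * K ^ 2 * k z ≤ c * K ^ 2 * K := by gcongr
  have eA : t ^ (modeA lam a b).r / t = ρ := by rw [hρ]; exact rpow_half_div ht0
  have eB : t ^ (modeB lam a b).r / t = ρ := by rw [hρ]; exact rpow_half_div ht0
  have eA2 : t ^ (modeA2 lam a b).r / t = ρ / t := by rw [hρ]; rfl
  have eB2 : t ^ (modeB2 lam a b).r / t = ρ / t := by rw [hρ]; rfl
  have nA := nval (modeA lam a b) ((cA.amp.b₀ z).trans ck)
  have nB := nval (modeB lam a b) ((cB.amp.b₀ z).trans ck)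
  have nA2 := nval (modeA2 lam a b) ((cA2.amp.b₀ z).trans ck2)
  have nB2 := nval (modeB2 lam a b) ((cB2.amp.b₀ z).trans ck2)
  have nA2' := nval (modeA2 lam a b) ((cA2.amp.b₀ z).trans ck3)
  have nB2' := nval (modeB2 lam a b) ((cB2.amp.b₀ z).trans ck3)
  rw [eA] at nA
  rw [eB] at nB
  rw [eA2] at nA2 nA2'
  rw [eB2] at nB2 nB2'
  have ρt : ρ / t ≤ ρ := div_le_self hρ0.le ht
  -- The factor u = 1 + K² allows one bound for both arguments of the cubic, since with the
  -- corrections K becomes K + K³ = K u.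
  have nU : ‖(modeA lam a b).val t z + (modeB lam a b).val t z‖ ≤ 2 * ρ * c * K * u := by
    refine (norm_add_le _ _).trans ((add_le_add nA nB).trans ?_)
    have : ρ * (c * K) ≤ ρ * (c * K) * u := le_mul_of_one_le_right (by positivity) hu1
    linarith
  have nP : ‖profileZ lam a.f b.f t z‖ ≤ 2 * ρ * c * K * u := by
    rw [profileZ_eq_modes lam a b ht0]
    refine (norm_add_le _ _).trans ((add_le_add ((norm_add₃_le).trans
      (add_le_add (add_le_add nA nB) nA2')) nB2').trans ?_)
    have : ρ / t * (c * K ^ 2 * K) ≤ ρ * (c * K ^ 2 * K) := by gcongr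
    rw [hu]; linarith
  have nd : ‖(modeA lam a b).val t z + (modeB lam a b).val t z - profileZ lam a.f b.f t z‖
      ≤ 2 * (ρ / t * (c * u * h z)) := by
    rw [profileZ_eq_modes lam a b ht0, show ∀ x y z w : ℂ, x + y - (x + y + z + w) = -(z + w) by
      intros; ring, norm_neg]
    refine (norm_add_le _ _).trans ?_
    linarith
  have hcub : ‖cubic lam ((modeA lam a b).val t z + (modeB lam a b).val t z)
        - cubic lam (profileZ lam a.f b.f t z)‖ ≤ ρ / t ^ 2 * (24 * c ^ 4 * Z) := by
    have e3 : ρ / t ^ 2 = ρ ^ 3 / t := by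
      field_simp; linear_combination -hρ2
    calc _ ≤ 3 * |lam| * (2 * ρ * c * K * u) ^ 2 * (2 * (ρ / t * (c * u * h z))) :=
          (norm_cubic_sub_le lam nU nP).trans (by gcongr)
      _ ≤ 3 * c * (2 * ρ * c * K * u) ^ 2 * (2 * (ρ / t * (c * u * h z))) := by gcongr
      _ = ρ ^ 3 / t * (24 * c ^ 4 * (1 * (u ^ 3 * K ^ 2) * (1 * h z))) := by ring
      _ ≤ ρ ^ 3 / t * (24 * c ^ 4 * (l ^ 2 * (u ^ 3 * u) * (jbr z ^ 4 * h z))) := by gcongr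
      _ = ρ / t ^ 2 * (24 * c ^ 4 * Z) := by rw [hZ, e3]; ring
  have no : ∀ (m : Mode) {w : ℂ} {x : ℝ}, ‖w‖ ≤ x → ‖m.osc t z * w‖ ≤ x := by
    intro m w x hw
    rwa [norm_mul, m.norm_osc, one_mul]
  have hrest := add_le_add (add_le_add
    (add_le_add (no (modeA lam a b) (rA.trans R1)) (no (modeB lam a b) (rB.trans R1)))
    (add_le_add (no (modeA2 lam a b) (M2 (w := 6) (by simp) SA2 (cA2.amp.b₀ z)))
      (no (modeB2 lam a b) (M2 (w := -6) (by simp) SB2 (cB2.amp.b₀ z)))))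
    (add_le_add (no (modeA2 lam a b) (rA2.trans R2)) (no (modeB2 lam a b) (rB2.trans R2)))
  refine (norm_add_le _ _).trans ((add_le_add hcub (Mode.norm_mul_le_mul
    (Mode.norm_real_le (abs_of_nonneg (by positivity)).le) ((norm_add₃_le).trans
      ((add_le_add (add_le_add (norm_add_le _ _) (norm_add_le _ _)) ?_).trans hrest)))).trans ?_)
  · rw [norm_div, Complex.norm_real, Real.norm_of_nonneg ht0.le]
    exact (div_le_self (norm_nonneg _) ht).trans (norm_add_le _ _)
  · rw [hZ]
    exact le_of_eq (by ring)

end Bounds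

/-! ### Sobolev embedding and the control functions -/

theorem setIntegral_Ioc_le_eLpNorm_two {H : ℝ → ℝ} (hH : MemLp H 2 volume) (z : ℝ) :
    ∫ x in Set.Ioc z (z + 1), H x ≤ (eLpNorm H 2 volume).toReal := by
  -- On an interval of length one the L¹ norm is at most the L² norm.
  have : IsProbabilityMeasure (volume.restrict (Set.Ioc z (z + 1))) := ⟨by simp⟩
  have hm := hH.aestronglyMeasurable.restrict (s := Set.Ioc z (z + 1))
  have h1 : ∫ x in Set.Ioc z (z + 1), H x ≤
      (eLpNorm H 1 (volume.restrict (Set.Ioc z (z + 1)))).toReal := by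
    refine (Real.le_norm_self _).trans ((norm_integral_le_integral_norm _).trans ?_)
    rw [eLpNorm_one_eq_lintegral_enorm, integral_norm_eq_lintegral_enorm hm]
  refine h1.trans (ENNReal.toReal_mono hH.2.ne ?_)
  exact (eLpNorm_le_eLpNorm_of_exponent_le (by norm_num) hm).trans
    (eLpNorm_restrict_le _ _ _ _)

/-- One-dimensional Sobolev embedding. -/
theorem norm_le_eLpNorm_of_locAC {f f' : ℝ → ℂ} {H : ℝ → ℝ} (hf : LocAC f)
    (hd : ∀ᵐ z, HasDerivAt f (f' z) z) (hm : AEStronglyMeasurable f' volume)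
    (hH : MemLp H 2 volume) (hle : ∀ z, ‖f z‖ + ‖f' z‖ ≤ H z) (z : ℝ) :
    ‖f z‖ ≤ (eLpNorm H 2 volume).toReal := by
  have hL : LocallyIntegrable f' volume :=
    (hH.mono hm (Eventually.of_forall fun x =>
      (by linarith [norm_nonneg (f x), hle x] : ‖f' x‖ ≤ H x).trans
        (Real.le_norm_self _))).locallyIntegrable (by norm_num)
  have hI : ∀ a b, IntervalIntegrable f' volume a b := fun a b =>
    (hL.integrableOn_isCompact isCompact_uIcc).intervalIntegrable
  have hfI : ∀ a b, IntervalIntegrable f volume a b := fun a b =>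
    hf.continuous.intervalIntegrable a b
  have hHI : IntervalIntegrable H volume z (z + 1) :=
    ((hH.locallyIntegrable (by norm_num)).integrableOn_isCompact isCompact_uIcc).intervalIntegrable
  have hz : z ≤ z + 1 := by linarith
  set c := ∫ x in z..(z + 1), ‖f' x‖ with hc
  -- f(z) differs from each f(y) by at most the integral of |f'| over the unit interval; averaging
  -- in y bounds f(z).
  have key : ∀ y ∈ Set.Icc z (z + 1), ‖f z‖ ≤ ‖f y‖ + c := by
    intro y hy
    have h1 : ‖f y - f z‖ ≤ c := by
      rw [← hf.integral_eq_sub hd hL]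
      refine (intervalIntegral.norm_integral_le_integral_norm hy.1).trans ?_
      exact intervalIntegral.integral_mono_interval le_rfl hy.1 hy.2
        (Eventually.of_forall fun x => norm_nonneg _) (hI _ _).norm
    have h2 := norm_sub_norm_le (f z) (f y)
    rw [norm_sub_rev] at h2
    linarith
  have e1 : ∫ _ in z..(z + 1), ‖f z‖ = ‖f z‖ := by simp
  have e2 : ∫ _ in z..(z + 1), c = c := by simp
  calc ‖f z‖ = ∫ _ in z..(z + 1), ‖f z‖ := e1.symm
    _ ≤ ∫ y in z..(z + 1), (‖f y‖ + c) :=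
        intervalIntegral.integral_mono_on hz (by simp) ((hfI _ _).norm.add (by simp)) key
    _ = ∫ y in z..(z + 1), (‖f y‖ + ‖f' y‖) := by
        rw [intervalIntegral.integral_add (hfI _ _).norm (by simp), e2,
          intervalIntegral.integral_add (hfI _ _).norm (hI _ _).norm]
    _ ≤ ∫ y in z..(z + 1), H y :=
        intervalIntegral.integral_mono_on hz ((hfI _ _).norm.add (hI _ _).norm) hHI
          fun y _ => hle y
    _ ≤ _ := by
        rw [intervalIntegral.integral_of_le hz]
        exact setIntegral_Ioc_le_eLpNorm_two hH z

/-- Pointwise size of two jets and their first derivatives. -/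
def ctrlK (a b : Jet) (z : ℝ) : ℝ := ‖a.f z‖ + ‖a.f₁ z‖ + ‖b.f z‖ + ‖b.f₁ z‖

/-- Pointwise size of two jets and their derivatives of order at most two. -/
def ctrlH (a b : Jet) (z : ℝ) : ℝ := ctrlK a b z + ‖a.f₂ z‖ + ‖b.f₂ z‖

/-- The weighted size `⟨z⟩^{5/2} ctrlH`. -/
def ctrlW (a b : Jet) (z : ℝ) : ℝ := jbr z ^ (5 / 2 : ℝ) * ctrlH a b z

theorem measurable_ctrlH (a b : Jet) : Measurable (ctrlH a b) := by
  have h1 := a.continuous.measurable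
  have h2 := a.continuous₁.measurable
  have h3 := a.meas
  have h4 := b.continuous.measurable
  have h5 := b.continuous₁.measurable
  have h6 := b.meas
  unfold ctrlH ctrlK
  fun_prop

theorem measurable_ctrlW (a b : Jet) : Measurable (ctrlW a b) :=
  (continuous_jbr.measurable.pow_const _).mul (measurable_ctrlH a b)

theorem ctrlK_nonneg (a b : Jet) (z : ℝ) : 0 ≤ ctrlK a b z := by unfold ctrlK; positivity

theorem ctrlK_le_ctrlH (a b : Jet) (z : ℝ) : ctrlK a b z ≤ ctrlH a b z := by
  unfold ctrlH; linarith [norm_nonneg (a.f₂ z), norm_nonneg (b.f₂ z)]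

theorem ctrlH_nonneg (a b : Jet) (z : ℝ) : 0 ≤ ctrlH a b z :=
  (ctrlK_nonneg a b z).trans (ctrlK_le_ctrlH a b z)

theorem jbr_sq_le_rpow (z : ℝ) : jbr z ^ 2 ≤ jbr z ^ (5 / 2 : ℝ) := by
  rw [← Real.rpow_natCast]
  exact Real.rpow_le_rpow_of_exponent_le (one_le_jbr z) (by norm_num)

/-- `J` represents `A` together with its weak derivatives. -/
def Represents (J : Jet) (A : ℝ → ℂ) : Prop :=
  J.f =ᵐ[volume] weakDeriv 0 A ∧ J.f₁ =ᵐ[volume] weakDeriv 1 A ∧ J.f₂ =ᵐ[volume] weakDeriv 2 A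

theorem eLpNorm_jet_le {A : ℝ → ℂ} {s : ℝ} {J : Jet} (hA : MemWSobolev 2 s A)
    (hJ : Represents J A) :
    eLpNorm (fun z => jbr z ^ s * (‖J.f z‖ + ‖J.f₁ z‖ + ‖J.f₂ z‖)) 2 volume
      ≤ ENNReal.ofReal (wSobolevNorm 2 s A) := by
  obtain ⟨e0, e1, e2⟩ := hJ
  have m0 := (hA.2 0 (by norm_num)).2
  have m1 := (hA.2 1 (by norm_num)).2
  have m2 := (hA.2 2 (by norm_num)).2
  have hj := fun z => (Real.rpow_pos_of_pos (jbr_pos z) s).le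
  have e : (fun z => jbr z ^ s * (‖J.f z‖ + ‖J.f₁ z‖ + ‖J.f₂ z‖)) =ᵐ[volume]
      ((fun z => ‖(jbr z ^ s) • weakDeriv 0 A z‖) + (fun z => ‖(jbr z ^ s) • weakDeriv 1 A z‖))
        + (fun z => ‖(jbr z ^ s) • weakDeriv 2 A z‖) := by
    filter_upwards [e0, e1, e2] with z h0 h1 h2
    simp only [Pi.add_apply, norm_smul, Real.norm_of_nonneg (hj z), h0, h1, h2]
    ring
  rw [eLpNorm_congr_ae e]
  refine (eLpNorm_add_le (m0.norm.1.add m1.norm.1) m2.norm.1 (by norm_num)).trans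
    ((add_le_add_left (eLpNorm_add_le m0.norm.1 m1.norm.1 (by norm_num)) _).trans ?_)
  rw [eLpNorm_norm, eLpNorm_norm, eLpNorm_norm, wSobolevNorm]
  simp only [Finset.sum_range_succ, Finset.sum_range_zero, zero_add]
  rw [ENNReal.ofReal_add (by positivity) (by positivity),
    ENNReal.ofReal_add (by positivity) (by positivity),
    ENNReal.ofReal_toReal m0.2.ne, ENNReal.ofReal_toReal m1.2.ne, ENNReal.ofReal_toReal m2.2.ne]

theorem wSobolevNorm_nonneg (k : ℕ) (s : ℝ) (A : ℝ → ℂ) : 0 ≤ wSobolevNorm k s A :=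
  Finset.sum_nonneg fun _ _ => ENNReal.toReal_nonneg

section
variable {A B : ℝ → ℂ} {a b : Jet}

theorem eLpNorm_ctrlW_le (hA : MemWSobolev 2 (5 / 2) A) (hB : MemWSobolev 2 (5 / 2) B)
    (ha : Represents a A) (hb : Represents b B) :
    eLpNorm (ctrlW a b) 2 volume ≤
      ENNReal.ofReal (wSobolevNorm 2 (5 / 2) A + wSobolevNorm 2 (5 / 2) B) := by
  have e : ctrlW a b = (fun z => jbr z ^ (5 / 2 : ℝ) * (‖a.f z‖ + ‖a.f₁ z‖ + ‖a.f₂ z‖))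
      + fun z => jbr z ^ (5 / 2 : ℝ) * (‖b.f z‖ + ‖b.f₁ z‖ + ‖b.f₂ z‖) := by
    funext z
    simp only [ctrlW, ctrlH, ctrlK, Pi.add_apply]; ring
  have hm : ∀ J : Jet, AEStronglyMeasurable
      (fun z => jbr z ^ (5 / 2 : ℝ) * (‖J.f z‖ + ‖J.f₁ z‖ + ‖J.f₂ z‖)) volume := by
    intro J
    have h0 := continuous_jbr.measurable
    have h1 := J.continuous.measurable
    have h2 := J.continuous₁.measurable
    have h3 := J.meas
    exact Measurable.aestronglyMeasurable (by fun_prop)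
  rw [e, ENNReal.ofReal_add (wSobolevNorm_nonneg _ _ _) (wSobolevNorm_nonneg _ _ _)]
  exact (eLpNorm_add_le (hm a) (hm b) (by norm_num)).trans
    (add_le_add (eLpNorm_jet_le hA ha) (eLpNorm_jet_le hB hb))

/-- The embedding applied to (1 + z²) g. Differentiating the weight costs nothing, since 2|z| ≤
⟨z⟩². -/
theorem jbr_sq_mul_norm_le {g g' : ℝ → ℂ} {W : ℝ → ℝ} {M : ℝ} (hg : LocAC g)
    (hd : ∀ᵐ z, HasDerivAt g (g' z) z) (hm : Measurable g') (hM : 0 ≤ M)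
    (hWm : Measurable W) (hW : eLpNorm W 2 volume ≤ ENNReal.ofReal M)
    (hle : ∀ z, jbr z ^ 2 * (‖g z‖ + ‖g' z‖) ≤ W z) (z : ℝ) : jbr z ^ 2 * ‖g z‖ ≤ 3 * M := by
  have hWL : MemLp W 2 volume := ⟨hWm.aestronglyMeasurable, hW.trans_lt ENNReal.ofReal_lt_top⟩
  have h1 : ∀ z : ℝ, HasDerivAt (fun z : ℝ => ((1 + z ^ 2 : ℝ) : ℂ)) ((2 * z : ℝ) : ℂ) z := by
    intro z
    have : HasDerivAt (fun z : ℝ => 1 + z ^ 2) (2 * z) z := by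
      simpa using ((hasDerivAt_pow 2 z).const_add 1)
    exact this.ofReal_comp
  have hac : LocAC fun z => ((1 + z ^ 2 : ℝ) : ℂ) * g z :=
    (LocAC.of_hasDerivAt h1 (by fun_prop)).mul hg
  have hgm := hg.continuous.measurable
  have main := norm_le_eLpNorm_of_locAC (H := fun z => 3 * W z) hac
    (f' := fun z => ((2 * z : ℝ) : ℂ) * g z + ((1 + z ^ 2 : ℝ) : ℂ) * g' z)
    (hd.mono fun z hz => (h1 z).fun_mul hz) (Measurable.aestronglyMeasurable (by fun_prop))
    (hWL.const_mul 3) (fun z => ?_) z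
  · rw [norm_mul, Complex.norm_real, ← jbr_sq, Real.norm_of_nonneg (sq_nonneg _)] at main
    refine main.trans ?_
    have : (fun z => 3 * W z) = (3 : ℝ) • W := rfl
    rw [this, eLpNorm_const_smul, ENNReal.toReal_mul, toReal_enorm, Real.norm_ofNat]
    have := ENNReal.toReal_mono ENNReal.ofReal_ne_top hW
    rw [ENNReal.toReal_ofReal hM] at this
    linarith
  · have hz2 : 2 * |z| ≤ jbr z ^ 2 := by
      rw [jbr_sq]; nlinarith [sq_nonneg (|z| - 1), sq_abs z]
    have n1 : ‖((1 + z ^ 2 : ℝ) : ℂ)‖ = jbr z ^ 2 := by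
      rw [Complex.norm_real, ← jbr_sq, Real.norm_of_nonneg (sq_nonneg _)]
    have n2 : ‖((2 * z : ℝ) : ℂ)‖ ≤ jbr z ^ 2 := by
      rw [Complex.norm_real, Real.norm_eq_abs, abs_mul]; simpa using hz2
    have b1 : ‖((1 + z ^ 2 : ℝ) : ℂ) * g z‖ = jbr z ^ 2 * ‖g z‖ := by rw [norm_mul, n1]
    have b2 : ‖((2 * z : ℝ) : ℂ) * g z + ((1 + z ^ 2 : ℝ) : ℂ) * g' z‖
        ≤ jbr z ^ 2 * ‖g z‖ + jbr z ^ 2 * ‖g' z‖ :=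
      (norm_add_le _ _).trans (add_le_add (Mode.norm_mul_le_mul n2 le_rfl)
        (Mode.norm_mul_le_mul n1.le le_rfl))
    have := hle z
    have p1 : 0 ≤ jbr z ^ 2 * ‖g z‖ := by positivity
    have p2 : 0 ≤ jbr z ^ 2 * ‖g' z‖ := by positivity
    rw [b1]
    linarith

/-- 12 = 4 · 3: the weighted embedding is used for a, a', b, b'. Each use needs one further
derivative in L² with weight ⟨z⟩², which ⟨z⟩^{5/2} dominates. -/
theorem controls_of_eLpNorm_le {M : ℝ} (hM : 0 ≤ M)
    (hW : eLpNorm (ctrlW a b) 2 volume ≤ ENNReal.ofReal M) :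
    Controls (12 * M) (ctrlK a b) (ctrlH a b) := by
  refine ⟨ctrlK_nonneg a b, ctrlK_le_ctrlH a b, fun z => ?_⟩
  have hmW := measurable_ctrlW a b
  have hle : ∀ {x : ℝ} (z : ℝ), 0 ≤ x → x ≤ ctrlH a b z → jbr z ^ 2 * x ≤ ctrlW a b z := by
    intro x z hx hxle
    exact mul_le_mul (jbr_sq_le_rpow z) hxle hx (Real.rpow_pos_of_pos (jbr_pos z) _).le
  have na := fun z => norm_nonneg (a.f z)
  have na1 := fun z => norm_nonneg (a.f₁ z)
  have na2 := fun z => norm_nonneg (a.f₂ z)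
  have nb := fun z => norm_nonneg (b.f z)
  have nb1 := fun z => norm_nonneg (b.f₁ z)
  have nb2 := fun z => norm_nonneg (b.f₂ z)
  have q1 := jbr_sq_mul_norm_le a.locAC₀ (Eventually.of_forall a.hasDeriv)
    a.continuous₁.measurable hM hmW hW (fun z => hle z (by positivity) (by
      unfold ctrlH ctrlK; linarith [na2 z, nb z, nb1 z, nb2 z])) z
  have q2 := jbr_sq_mul_norm_le a.locAC a.ae_hasDeriv
    a.meas hM hmW hW (fun z => hle z (by positivity) (by
      unfold ctrlH ctrlK; linarith [na z, nb z, nb1 z, nb2 z])) z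
  have q3 := jbr_sq_mul_norm_le b.locAC₀ (Eventually.of_forall b.hasDeriv)
    b.continuous₁.measurable hM hmW hW (fun z => hle z (by positivity) (by
      unfold ctrlH ctrlK; linarith [na z, na1 z, na2 z, nb2 z])) z
  have q4 := jbr_sq_mul_norm_le b.locAC b.ae_hasDeriv
    b.meas hM hmW hW (fun z => hle z (by positivity) (by
      unfold ctrlH ctrlK; linarith [na z, na1 z, na2 z, nb z])) z
  unfold ctrlK
  linarith

theorem jetBound_left (K : ℝ) (a b : Jet) : JetBound K (ctrlK a b) (ctrlH a b) 1 0 a := by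
  have n1 := fun z => norm_nonneg (a.f z)
  have n2 := fun z => norm_nonneg (a.f₁ z)
  have n3 := fun z => norm_nonneg (b.f z)
  have n4 := fun z => norm_nonneg (b.f₁ z)
  have n5 := fun z => norm_nonneg (b.f₂ z)
  refine ⟨fun z => ?_, fun z => ?_, fun z => ?_⟩ <;> simp only [pow_zero, mul_one, one_mul, ctrlH,
    ctrlK] <;> linarith [n1 z, n2 z, n3 z, n4 z, n5 z]

theorem jetBound_right (K : ℝ) (a b : Jet) : JetBound K (ctrlK a b) (ctrlH a b) 1 0 b := by
  have n1 := fun z => norm_nonneg (a.f z)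
  have n2 := fun z => norm_nonneg (a.f₁ z)
  have n3 := fun z => norm_nonneg (b.f z)
  have n4 := fun z => norm_nonneg (b.f₁ z)
  have n5 := fun z => norm_nonneg (a.f₂ z)
  refine ⟨fun z => ?_, fun z => ?_, fun z => ?_⟩ <;> simp only [pow_zero, mul_one, one_mul, ctrlH,
    ctrlK] <;> linarith [n1 z, n2 z, n3 z, n4 z, n5 z]

theorem measurable_src (m : Mode) (t : ℝ) : Measurable (m.src t) := by
  have h0 := continuous_jbr.measurable
  have h1 := m.f.continuous.measurable
  have h2 := m.f.continuous₁.measurable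
  have h3 := m.f.meas
  have h4 := m.S.continuous.measurable
  have h5 := m.S.continuous₁.measurable
  have h6 := m.S.meas
  have h7 := (m.continuous_osc t).measurable
  unfold Mode.src Mode.rem
  fun_prop

theorem continuous_val (m : Mode) (t : ℝ) : Continuous (m.val t) := by
  have h1 := m.f.continuous
  have h2 := m.continuous_osc t
  unfold Mode.val
  fun_prop

/-- ⟨z⟩h is the product of ⟨z⟩^{5/2}h and ⟨z⟩^{-3/2}, both square integrable; the product is
dominated by the sum of the squares, the difference being a completed square. -/
theorem integrable_jbr_mul_ctrlH (hW : MemLp (ctrlW a b) 2 volume) :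
    Integrable (fun z => jbr z * ctrlH a b z) volume := by
  refine (hW.integrable_sq.add integrable_inv_jbr_cube).mono'
    (continuous_jbr.measurable.mul (measurable_ctrlH a b)).aestronglyMeasurable
    (Eventually.of_forall fun z => ?_)
  have hj := jbr_pos z
  have hh := ctrlH_nonneg a b z
  rw [Real.norm_of_nonneg (mul_nonneg hj.le hh)]
  have e1 : ctrlW a b z ^ 2 = jbr z ^ 5 * ctrlH a b z ^ 2 := by
    rw [ctrlW, mul_pow, ← Real.rpow_natCast, ← Real.rpow_mul hj.le]
    norm_num
  have e2 : jbr z ^ 5 * ctrlH a b z ^ 2 + (jbr z ^ 3)⁻¹ - jbr z * ctrlH a b z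
      = (jbr z ^ 3)⁻¹ * ((jbr z ^ 4 * ctrlH a b z - 1 / 2) ^ 2 + 3 / 4) := by
    field_simp; ring
  have : 0 ≤ (jbr z ^ 3)⁻¹ * ((jbr z ^ 4 * ctrlH a b z - 1 / 2) ^ 2 + 3 / 4) := by positivity
  simp only [Pi.add_apply, e1]
  linarith

/-- The source is of size ⟨z⟩⁴h at worst, and the Jacobian ⟨z⟩⁻³ reduces this to ⟨z⟩h. -/
theorem Mode.Controlled.integrable_src {m : Mode} {K c : ℝ} {p : ℕ}
    (H : Controls K (ctrlK a b) (ctrlH a b)) (hm : m.Controlled K (ctrlK a b) (ctrlH a b) c p)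
    (hW : MemLp (ctrlW a b) 2 volume) {t : ℝ} (ht : 0 < t) :
    Integrable (coneLift t (m.src t)) volume := by
  rw [integrable_coneLift_iff ht]
  have hc : 0 ≤ c := zero_le_one.trans hm.one_le
  have hK := H.K_nonneg
  set q := t ^ m.r / t
  set X := c * K ^ p
  set k1 := ‖1 + (Complex.I * m.κ) ^ 2‖
  set k2 := 2 * |m.κ| * (c * (1 + K ^ 2)) + |m.κ| * ‖(2 * m.r - 1 : ℂ)‖
  set k3 := 33 * (c * (1 + K ^ 2) * (1 + |Real.log t|)) ^ 2
  have hq : 0 ≤ q := div_nonneg (Real.rpow_nonneg ht.le _) ht.le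
  have hX : 0 ≤ X := by positivity
  refine ((integrable_jbr_mul_ctrlH hW).const_mul
    (t * (q * ((k1 + k2 / t + k3 / t ^ 2) * X)))).mono' ?_ (Eventually.of_forall fun z => ?_)
  · have h1 := measurable_src m t
    have h2 := continuous_jbr.measurable
    exact Measurable.aestronglyMeasurable (by fun_prop)
  have hj := jbr_pos z
  have hj1 := one_le_jbr z
  have hh := ctrlH_nonneg a b z
  have hf : ‖m.f.f z‖ ≤ X * ctrlH a b z := (hm.amp.b₀ z).trans (by
    have := H.le_h z; gcongr)
  have hr := hm.norm_rem_le H t z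
  have hS := (hm.S_le H z).1
  have nt : ‖(t : ℂ)‖ = t := by rw [Complex.norm_real, Real.norm_of_nonneg ht.le]
  have nj : ‖(jbr z : ℂ)‖ = jbr z := by rw [Complex.norm_real, Real.norm_of_nonneg hj.le]
  have j14 : 1 ≤ jbr z ^ 4 := one_le_pow₀ hj1
  have j4 : jbr z ≤ jbr z ^ 4 := le_self_pow₀ hj1 (by norm_num)
  have nκ : ‖Complex.I * (m.κ : ℂ)‖ = |m.κ| := by
    rw [norm_mul, Complex.norm_I, one_mul, Complex.norm_real, Real.norm_eq_abs]
  have hk2 : 0 ≤ k2 := by positivity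
  have main : ‖m.src t z‖ ≤ q * 1 * (k1 * (X * ctrlH a b z)
      + jbr z * k2 * (X * ctrlH a b z) / t + jbr z ^ 4 * k3 * (X * ctrlH a b z) / t ^ 2) := by
    refine Mode.norm_mul_le_mul (Mode.norm_mul_le_mul (Mode.norm_real_le
      (abs_of_nonneg hq).le) (m.norm_osc t z).le) ((norm_add₃_le).trans
        (add_le_add (add_le_add (Mode.norm_mul_le_mul le_rfl hf) ?_) ?_))
    · rw [norm_div, nt]
      gcongr
      refine Mode.norm_mul_le_mul (Mode.norm_mul_le_mul nj.le ((norm_add_le _ _).trans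
        (add_le_add (Mode.norm_mul_le_mul (Mode.norm_mul_le_mul (by simp) nκ.le) ?_)
          (Mode.norm_mul_le_mul nκ.le le_rfl)))) hf
      rw [norm_mul, Complex.norm_I, one_mul]; exact hS
    · rw [norm_div, norm_pow, nt]
      gcongr
      refine hr.trans (le_of_eq ?_)
      simp only [k3, X]; ring
  rw [norm_smul, Real.norm_of_nonneg (by positivity : 0 ≤ t * (jbr z ^ 3)⁻¹)]
  calc t * (jbr z ^ 3)⁻¹ * ‖m.src t z‖
      ≤ t * (jbr z ^ 3)⁻¹ * (q * 1 * (1 * k1 * (X * ctrlH a b z)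
      + jbr z * k2 * (X * ctrlH a b z) / t + jbr z ^ 4 * k3 * (X * ctrlH a b z) / t ^ 2)) := by
        rw [one_mul]; gcongr
    _ ≤ t * (jbr z ^ 3)⁻¹ * (q * 1 * (jbr z ^ 4 * k1 * (X * ctrlH a b z)
      + jbr z ^ 4 * k2 * (X * ctrlH a b z) / t + jbr z ^ 4 * k3 * (X * ctrlH a b z) / t ^ 2)) := by
        gcongr
    _ = t * (q * ((k1 + k2 / t + k3 / t ^ 2) * X)) * (jbr z * ctrlH a b z) := by
        field_simp

end

/-! ### The equation and the L² residual of the profile -/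

theorem coneLift_add (t : ℝ) (g g' : ℝ → ℂ) :
    coneLift t (fun z => g z + g' z) = fun x => coneLift t g x + coneLift t g' x := by
  funext x
  by_cases h : |x| < t <;> simp [coneLift, h]

theorem IsBoxPlusOne.add {T : ℝ} {u u' G G' : ℝ → ℝ → ℂ} (h : IsBoxPlusOne T u G)
    (h' : IsBoxPlusOne T u' G') :
    IsBoxPlusOne T (fun t x => u t x + u' t x) (fun t x => G t x + G' t x) := by
  refine ⟨fun t ht => ⟨(h.1 t ht).1.add (h'.1 t ht).1, (h.1 t ht).2.add (h'.1 t ht).2⟩,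
    fun φ hφ hc => ?_⟩
  obtain ⟨p, hp⟩ := h.2 φ hφ hc
  obtain ⟨p', hp'⟩ := h'.2 φ hφ hc
  have hφ'' : Continuous (iteratedDeriv 2 φ) := by
    rw [iteratedDeriv_succ, iteratedDeriv_one]
    exact (contDiff_infty_iff_deriv.1 (contDiff_infty_iff_deriv.1 hφ).2).2.continuous
  have hc'' : HasCompactSupport (iteratedDeriv 2 φ) := by
    rw [iteratedDeriv_succ, iteratedDeriv_one]
    exact hc.deriv.deriv
  have hs : ∀ {ψ : ℝ → ℝ} {v w : ℝ → ℂ}, Continuous ψ → HasCompactSupport ψ →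
      LocallyIntegrable v volume → LocallyIntegrable w volume →
      ∫ x, ψ x • (v x + w x) = (∫ x, ψ x • v x) + ∫ x, ψ x • w x := by
    intro ψ v w h1 h2 h3 h4
    simp only [smul_add]
    exact integral_add (h3.integrable_smul_left_of_hasCompactSupport h1 h2)
      (h4.integrable_smul_left_of_hasCompactSupport h1 h2)
  refine ⟨fun t => p t + p' t, fun t ht => ⟨?_, ?_⟩⟩
  · refine ((hp t ht).1.fun_add (hp' t ht).1).congr_of_eventuallyEq ?_
    filter_upwards [lt_mem_nhds ht] with s hts
    exact hs hφ.continuous hc (h.1 s hts).1 (h'.1 s hts).1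
  · refine ((hp t ht).2.fun_add (hp' t ht).2).congr_deriv ?_
    rw [hs hφ'' hc'' (h.1 t ht).1 (h'.1 t ht).1, hs hφ.continuous hc (h.1 t ht).1 (h'.1 t ht).1,
      hs hφ.continuous hc (h.1 t ht).2 (h'.1 t ht).2]
    ring

/-- Passes from the modes, built on regular representatives, to the profile of the original data:
pairings do not see null sets. -/
theorem IsBoxPlusOne.congr {T : ℝ} {u u' G : ℝ → ℝ → ℂ} (h : IsBoxPlusOne T u G)
    (hu : ∀ t, T < t → u t =ᵐ[volume] u' t) : IsBoxPlusOne T u' G := by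
  refine ⟨fun t ht => ⟨(locallyIntegrable_congr (hu t ht)).1 (h.1 t ht).1, (h.1 t ht).2⟩,
    fun φ hφ hc => ?_⟩
  obtain ⟨p, hp⟩ := h.2 φ hφ hc
  have hs : ∀ (ψ : ℝ → ℝ) t, T < t → ∫ x, ψ x • u' t x = ∫ x, ψ x • u t x := fun ψ t ht =>
    integral_congr_ae ((hu t ht).mono fun x hx => by simp only [hx])
  refine ⟨p, fun t ht => ⟨?_, ?_⟩⟩
  · refine (hp t ht).1.congr_of_eventuallyEq ?_
    filter_upwards [lt_mem_nhds ht] with s hts using hs φ s hts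
  · rw [hs _ t ht, hs _ t ht]
    exact (hp t ht).2

theorem cubic_zero (lam : ℝ) : cubic lam 0 = 0 := by simp [cubic]

/-- The exponents of the theorem: 1/2 - 1/2 - 2 = -2 for t and 4 - 3/2 = 5/2 for ⟨z⟩. -/
theorem sqrt_weight {t : ℝ} (ht : 0 < t) (z : ℝ) :
    Real.sqrt (t * (jbr z ^ 3)⁻¹) * (t ^ (-(1 / 2) : ℝ) / t ^ 2) * jbr z ^ 4
      = t ^ (-2 : ℝ) * jbr z ^ (5 / 2 : ℝ) := by
  have hj := jbr_pos z
  rw [Real.sqrt_mul ht.le, Real.sqrt_inv, Real.sqrt_eq_rpow, Real.sqrt_eq_rpow,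
    ← Real.rpow_natCast (jbr z) 3, ← Real.rpow_natCast (jbr z) 4, ← Real.rpow_mul hj.le,
    Real.rpow_neg ht.le, Real.rpow_neg ht.le]
  have e1 : jbr z ^ ((4 : ℕ) : ℝ) = jbr z ^ (((3 : ℕ) : ℝ) * (1 / 2)) * jbr z ^ (5 / 2 : ℝ) := by
    rw [← Real.rpow_add hj]; norm_num
  have e2 : t ^ (2 : ℝ) = t ^ 2 := by rw [← Real.rpow_natCast]; norm_num
  have h1 := (Real.rpow_pos_of_pos hj (((3 : ℕ) : ℝ) * (1 / 2))).ne'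
  have h2 := (Real.rpow_pos_of_pos ht (1 / 2)).ne'
  rw [e1, e2]
  field_simp

section
variable {A B : ℝ → ℂ} {a b : Jet} {lam : ℝ}

/-- The residual of the profile in the coordinates `(t, z)`. -/
def residualZ (lam : ℝ) (a b : Jet) (t z : ℝ) : ℂ :=
  sourceZ lam a b t z - cubic lam (profileZ lam a.f b.f t z)

theorem measurable_sourceZ (lam : ℝ) (a b : Jet) (t : ℝ) : Measurable (sourceZ lam a b t) :=
  (((measurable_src _ t).add (measurable_src _ t)).add (measurable_src _ t)).add
    (measurable_src _ t)

theorem continuous_profileZ (lam : ℝ) (a b : Jet) {t : ℝ} (ht : 0 < t) :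
    Continuous (profileZ lam a.f b.f t) := by
  rw [show profileZ lam a.f b.f t = _ from funext (profileZ_eq_modes lam a b ht)]
  exact (((continuous_val _ t).add (continuous_val _ t)).add (continuous_val _ t)).add
    (continuous_val _ t)

theorem continuous_cubic (lam : ℝ) : Continuous (cubic lam) := by
  unfold cubic
  fun_prop

theorem measurable_residualZ (lam : ℝ) (a b : Jet) {t : ℝ} (ht : 0 < t) :
    Measurable (residualZ lam a b t) :=
  (measurable_sourceZ lam a b t).sub
    ((continuous_cubic lam).comp (continuous_profileZ lam a b ht)).measurable

theorem eLpNorm_residual_le {M K : ℝ}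
    (H : Controls K (ctrlK a b) (ctrlH a b))
    (hW : eLpNorm (ctrlW a b) 2 volume ≤ ENNReal.ofReal M) {t : ℝ} (ht : 1 ≤ t) :
    eLpNorm (coneLift t (residualZ lam a b t)) 2 volume ≤
      ENNReal.ofReal (180 * modeConst lam ^ 4 * (1 + |Real.log t|) ^ 2 * (1 + K ^ 2) ^ 4
        * t ^ (-2 : ℝ) * M) := by
  have ht0 : 0 < t := by linarith
  have hc : 0 ≤ modeConst lam := zero_le_one.trans (one_le_modeConst lam)
  set Q := 180 * modeConst lam ^ 4 * (1 + |Real.log t|) ^ 2 * (1 + K ^ 2) ^ 4 * t ^ (-2 : ℝ)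
    with hQ
  have hQ0 : 0 ≤ Q := by have := Real.rpow_nonneg ht0.le (-2); positivity
  rw [eLpNorm_coneLift ht0 _ (fun x hx => by simp [coneLift, hx])]
  have hle : ∀ z, ‖Real.sqrt (t * (jbr z ^ 3)⁻¹) • coneLift t (residualZ lam a b t) (t * vel z)‖
      ≤ ‖(Q • ctrlW a b) z‖ := by
    intro z
    rw [coneLift_vel ht0, norm_smul, Real.norm_of_nonneg (Real.sqrt_nonneg _)]
    refine (mul_le_mul_of_nonneg_left (norm_sourceZ_sub_cubic_le H (jetBound_left K a b)
      (jetBound_right K a b) ht z) (Real.sqrt_nonneg _)).trans (le_trans (le_of_eq ?_)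
        (Real.le_norm_self _))
    have := sqrt_weight ht0 z
    simp only [Pi.smul_apply, smul_eq_mul, ctrlW, hQ]
    linear_combination (180 * modeConst lam ^ 4 * (1 + |Real.log t|) ^ 2 * (1 + K ^ 2) ^ 4
      * ctrlH a b z) * this
  refine (eLpNorm_mono hle).trans ?_
  rw [eLpNorm_const_smul, Real.enorm_eq_ofReal hQ0, ENNReal.ofReal_mul hQ0]
  gcongr

theorem isBoxPlusOne_profile {K : ℝ} (H : Controls K (ctrlK a b) (ctrlH a b))
    (hW : MemLp (ctrlW a b) 2 volume) (hA : a.f =ᵐ[volume] A) (hB : b.f =ᵐ[volume] B) :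
    IsBoxPlusOne 1 (profile lam A B) (fun t => coneLift t (sourceZ lam a b t)) := by
  have ha := jetBound_left K a b
  have hb := jetBound_right K a b
  have cA := controlled_modeA (lam := lam) H ha hb
  have cB := controlled_modeB (lam := lam) H ha hb
  have cA2 := controlled_modeA2 (lam := lam) H ha hb
  have cB2 := controlled_modeB2 (lam := lam) H ha hb
  have box : ∀ {m : Mode} {p : ℕ}, m.Controlled K (ctrlK a b) (ctrlH a b) (modeConst lam) p →
      IsBoxPlusOne 1 (fun t => coneLift t (m.val t)) (fun t => coneLift t (m.src t)) :=
    fun hm => Mode.isBoxPlusOne (hm.bounded H) fun t ht => hm.integrable_src H hW (by linarith)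
  have h := (((box cA).add (box cB)).add (box cA2)).add (box cB2)
  have e : (fun t => coneLift t (sourceZ lam a b t)) = fun t x =>
      coneLift t ((modeA lam a b).src t) x + coneLift t ((modeB lam a b).src t) x
        + coneLift t ((modeA2 lam a b).src t) x + coneLift t ((modeB2 lam a b).src t) x := by
    funext t
    unfold sourceZ
    rw [coneLift_add, coneLift_add, coneLift_add]
  rw [e]
  refine h.congr fun t ht => ?_
  have ht0 : 0 < t := by linarith
  refine EventuallyEq.trans (Eventually.of_forall fun x => ?_) (profile_congr_ae hA hB t)
  rw [profile_eq_coneLift,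
    show profileZ lam a.f b.f t = _ from funext (profileZ_eq_modes lam a b ht0)]
  rw [coneLift_add, coneLift_add, coneLift_add]

theorem residual_ae_eq (hA : a.f =ᵐ[volume] A) (hB : b.f =ᵐ[volume] B) (t : ℝ) :
    coneLift t (residualZ lam a b t) =ᵐ[volume]
      fun x => coneLift t (sourceZ lam a b t) x - cubic lam (profile lam A B t x) := by
  filter_upwards [profile_congr_ae (lam := lam) hA hB t] with x hx
  rw [← hx, profile_eq_coneLift]
  by_cases h : |x| < t <;> simp [coneLift, h, residualZ, cubic_zero]

end

/-! ### The sup bound and the estimates for general and small data -/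

theorem linftyNorm_nonneg (A : ℝ → ℂ) : 0 ≤ linftyNorm A := ENNReal.toReal_nonneg

theorem ae_norm_le_linftyNorm {A : ℝ → ℂ} (hA : MemLp A ∞ volume) :
    ∀ᵐ z, ‖A z‖ ≤ linftyNorm A := by
  have h := hA.2
  rw [eLpNorm_exponent_top] at h
  filter_upwards [ae_le_eLpNormEssSup (f := A) (μ := volume)] with z hz
  have := ENNReal.toReal_mono h.ne hz
  rwa [toReal_enorm, ← eLpNorm_exponent_top] at this

theorem norm_profileZ_le {lam : ℝ} {A B : ℝ → ℂ} {t z x y : ℝ} (ht : 1 ≤ t) (hA : ‖A z‖ ≤ x)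
    (hB : ‖B z‖ ≤ y) : ‖profileZ lam A B t z‖ ≤
      (1 + |lam|) * t ^ (-(1 / 2) : ℝ) * (x + y) * jbr (x + y) ^ 2 := by
  have ht0 : 0 < t := by linarith
  have hx : 0 ≤ x := (norm_nonneg _).trans hA
  have hy : 0 ≤ y := (norm_nonneg _).trans hB
  have hl := abs_nonneg lam
  have h1 := Real.rpow_nonneg ht0.le (-(1 / 2))
  have h3 := Real.rpow_nonneg ht0.le (-(3 / 2))
  have h31 : t ^ (-(3 / 2) : ℝ) ≤ t ^ (-(1 / 2) : ℝ) :=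
    Real.rpow_le_rpow_of_exponent_le ht (by norm_num)
  have nc : ∀ {w : ℂ} {c p : ℝ}, ‖w‖ ≤ c → ‖w * cis p‖ ≤ c := fun hw => by
    rwa [norm_mul, norm_cis, mul_one]
  have nl : ‖-((lam : ℂ) / 8)‖ = |lam| / 8 := by
    rw [norm_neg, norm_div, Complex.norm_real, Complex.norm_ofNat, Real.norm_eq_abs]
  have a2 : ‖ampA2 lam A B z‖ ≤ |lam| / 8 * x ^ 2 * y := by
    refine Mode.norm_mul_le_mul (Mode.norm_mul_le_mul nl.le ?_) ?_
    · rw [norm_pow]; gcongr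
    · rwa [RCLike.norm_conj]
  have b2 : ‖ampB2 lam A B z‖ ≤ |lam| / 8 * x * y ^ 2 := by
    refine Mode.norm_mul_le_mul (Mode.norm_mul_le_mul nl.le ?_) ?_
    · rwa [RCLike.norm_conj]
    · rw [norm_pow]; gcongr
  have main : ‖profileZ lam A B t z‖ ≤ t ^ (-(1 / 2) : ℝ) * (x + y)
      + t ^ (-(3 / 2) : ℝ) * (|lam| / 8 * x ^ 2 * y + |lam| / 8 * x * y ^ 2) := by
    refine (norm_add_le _ _).trans (add_le_add
      (Mode.norm_mul_le_mul (Mode.norm_real_le (abs_of_nonneg h1).le)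
        ((norm_add_le _ _).trans (add_le_add (nc hA) (nc hB))))
      (Mode.norm_mul_le_mul (Mode.norm_real_le (abs_of_nonneg h3).le)
        ((norm_add_le _ _).trans (add_le_add (nc a2) (nc b2)))))
  refine main.trans ?_
  rw [jbr_sq]
  have e1 : |lam| / 8 * x ^ 2 * y + |lam| / 8 * x * y ^ 2 ≤ |lam| * (x + y) ^ 3 := by
    have : 0 ≤ x ^ 2 * y := by positivity
    have : 0 ≤ x * y ^ 2 := by positivity
    have : 0 ≤ x ^ 3 := by positivity
    have : 0 ≤ y ^ 3 := by positivity
    have e : 1 / 8 * x ^ 2 * y + 1 / 8 * x * y ^ 2 ≤ (x + y) ^ 3 := by nlinarith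
    calc _ = |lam| * (1 / 8 * x ^ 2 * y + 1 / 8 * x * y ^ 2) := by ring
      _ ≤ _ := by gcongr
  calc _ ≤ t ^ (-(1 / 2) : ℝ) * (x + y) + t ^ (-(1 / 2) : ℝ) * (|lam| * (x + y) ^ 3) := by
        gcongr
    -- The cross terms are added so that the sum factors as (1 + |λ|)(x + y)(1 + (x + y)²).
    _ ≤ t ^ (-(1 / 2) : ℝ) * (x + y) + t ^ (-(1 / 2) : ℝ) * (|lam| * (x + y) ^ 3)
        + t ^ (-(1 / 2) : ℝ) * ((x + y) ^ 3 + |lam| * (x + y)) := by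
        have : 0 ≤ t ^ (-(1 / 2) : ℝ) * ((x + y) ^ 3 + |lam| * (x + y)) := by positivity
        linarith
    _ = _ := by ring

theorem aestronglyMeasurable_profile {lam : ℝ} {A B : ℝ → ℂ} {a b : Jet}
    (hA : a.f =ᵐ[volume] A) (hB : b.f =ᵐ[volume] B) {t : ℝ} (ht : 0 < t) :
    AEStronglyMeasurable (profile lam A B t) volume := by
  refine AEStronglyMeasurable.congr ?_ (profile_congr_ae hA hB t)
  rw [profile_eq_coneLift]
  exact (measurable_coneLift t (continuous_profileZ lam a b ht).measurable).aestronglyMeasurable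

theorem eLpNorm_profile_top_le {lam : ℝ} {A B : ℝ → ℂ} (hA : MemLp A ∞ volume)
    (hB : MemLp B ∞ volume) {t : ℝ} (ht : 1 ≤ t) :
    eLpNorm (profile lam A B t) ∞ volume ≤ ENNReal.ofReal ((1 + |lam|) * t ^ (-(1 / 2) : ℝ) *
      (linftyNorm A + linftyNorm B) * jbr (linftyNorm A + linftyNorm B) ^ 2) := by
  rw [eLpNorm_exponent_top]
  refine eLpNormEssSup_le_of_ae_bound ?_
  have h := ae_mu_of_ae t ((ae_norm_le_linftyNorm hA).and (ae_norm_le_linftyNorm hB))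
  filter_upwards [h] with x hx
  rw [profile_eq_coneLift]
  by_cases hxt : |x| < t
  · rw [coneLift, if_pos hxt]
    exact norm_profileZ_le ht (hx hxt).1 (hx hxt).2
  · rw [coneLift, if_neg hxt, norm_zero]
    have := linftyNorm_nonneg A
    have := linftyNorm_nonneg B
    have := Real.rpow_nonneg (by linarith : 0 ≤ t) (-(1 / 2))
    positivity

/-- Regular representatives of the data and the bounds that they satisfy. -/
theorem exists_jets {A B : ℝ → ℂ} (hA : MemWSobolev 2 (5 / 2) A) (hB : MemWSobolev 2 (5 / 2) B) :
    ∃ a b : Jet, a.f =ᵐ[volume] A ∧ b.f =ᵐ[volume] B ∧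
      eLpNorm (ctrlW a b) 2 volume ≤
        ENNReal.ofReal (wSobolevNorm 2 (5 / 2) A + wSobolevNorm 2 (5 / 2) B) ∧
      Controls (12 * (wSobolevNorm 2 (5 / 2) A + wSobolevNorm 2 (5 / 2) B))
        (ctrlK a b) (ctrlH a b) := by
  obtain ⟨a, ha, ha'⟩ := hA.exists_jet
  obtain ⟨b, hb, hb'⟩ := hB.exists_jet
  have hW := eLpNorm_ctrlW_le hA hB ha' hb'
  exact ⟨a, b, ha, hb, hW, controls_of_eLpNorm_le
    (add_nonneg (wSobolevNorm_nonneg _ _ _) (wSobolevNorm_nonneg _ _ _)) hW⟩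

theorem memLp_top_of_controls {A : ℝ → ℂ} {K : ℝ} {k h : ℝ → ℝ} {a : Jet} (H : Controls K k h)
    (ha : JetBound K k h 1 0 a) (hA : a.f =ᵐ[volume] A) : MemLp A ∞ volume := by
  refine MemLp.ae_eq hA (memLp_top_of_bound a.continuous.aestronglyMeasurable K
    (Eventually.of_forall fun z => (ha.b₀ z).trans ?_))
  simpa using H.le_K z

theorem profile_estimates (lam : ℝ) :
    ∃ C : ℝ, 0 < C ∧ ∀ A B : ℝ → ℂ, MemWSobolev 2 (5 / 2) A → MemWSobolev 2 (5 / 2) B →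
      (∀ t : ℝ, 3 ≤ t →
        MemLp (profile lam A B t) ∞ volume ∧
        eLpNorm (profile lam A B t) ∞ volume ≤
          ENNReal.ofReal (C * t ^ (-(1 / 2) : ℝ) * (linftyNorm A + linftyNorm B) *
            jbr (linftyNorm A + linftyNorm B) ^ 2)) ∧
      ∃ G : ℝ → ℝ → ℂ, IsBoxPlusOne 1 (profile lam A B) G ∧
        ∀ t : ℝ, 3 ≤ t →
          MemLp (fun x => G t x - cubic lam (profile lam A B t x)) 2 volume ∧
          eLpNorm (fun x => G t x - cubic lam (profile lam A B t x)) 2 volume ≤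
            ENNReal.ofReal (C * t ^ (-2 : ℝ) * Real.log t ^ 2 *
              (wSobolevNorm 2 (5 / 2) A + wSobolevNorm 2 (5 / 2) B) *
              jbr (wSobolevNorm 2 (5 / 2) A + wSobolevNorm 2 (5 / 2) B) ^ 8) := by
  have hc := one_le_modeConst lam
  have hc0 : 0 ≤ modeConst lam := by linarith
  have hl := abs_nonneg lam
  have hC1 : 0 ≤ 180 * modeConst lam ^ 4 * 4 * 144 ^ 4 := by positivity
  -- One constant for both estimates: 1 + |λ| for the sup norm; for the residual, 4 from (1 + log
  -- t)² ≤ 4 log² t and 144⁴ from 1 + (12M)² ≤ 144⟨M⟩².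
  refine ⟨1 + |lam| + 180 * modeConst lam ^ 4 * 4 * 144 ^ 4, by positivity, fun A B hA hB => ?_⟩
  obtain ⟨a, b, ha, hb, hW, H⟩ := exists_jets hA hB
  have hM : 0 ≤ wSobolevNorm 2 (5 / 2) A + wSobolevNorm 2 (5 / 2) B :=
    add_nonneg (wSobolevNorm_nonneg _ _ _) (wSobolevNorm_nonneg _ _ _)
  generalize wSobolevNorm 2 (5 / 2) A + wSobolevNorm 2 (5 / 2) B = M at *
  have hAt := memLp_top_of_controls H (jetBound_left _ a b) ha
  have hBt := memLp_top_of_controls H (jetBound_right _ a b) hb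
  have hm : 0 ≤ linftyNorm A + linftyNorm B :=
    add_nonneg (linftyNorm_nonneg A) (linftyNorm_nonneg B)
  constructor
  · intro t ht
    have ht0 : 0 < t := by linarith
    have h1 := eLpNorm_profile_top_le (lam := lam) hAt hBt (by linarith : 1 ≤ t)
    refine ⟨⟨aestronglyMeasurable_profile ha hb ht0, h1.trans_lt ENNReal.ofReal_lt_top⟩,
      h1.trans (ENNReal.ofReal_le_ofReal ?_)⟩
    have := Real.rpow_nonneg ht0.le (-(1 / 2))
    gcongr ?_ * _ * _ * _
    linarith
  · have hWL : MemLp (ctrlW a b) 2 volume :=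
      ⟨(measurable_ctrlW a b).aestronglyMeasurable, hW.trans_lt ENNReal.ofReal_lt_top⟩
    refine ⟨_, isBoxPlusOne_profile H hWL ha hb, fun t ht => ?_⟩
    have ht0 : 0 < t := by linarith
    have h1 := eLpNorm_residual_le (lam := lam) H hW (by linarith : 1 ≤ t)
    rw [eLpNorm_congr_ae (residual_ae_eq ha hb t)] at h1
    refine ⟨⟨?_, h1.trans_lt ENNReal.ofReal_lt_top⟩, h1.trans (ENNReal.ofReal_le_ofReal ?_)⟩
    · exact (measurable_coneLift t (measurable_residualZ lam a b ht0)).aestronglyMeasurable.congr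
        (residual_ae_eq ha hb t)
    -- This uses t ≥ 3 > e.
    have hlog : 1 ≤ Real.log t := by
      rw [← Real.log_exp 1]
      exact Real.log_le_log (Real.exp_pos 1) (by linarith [Real.exp_one_lt_d9])
    have e1 : 1 + |Real.log t| ≤ 2 * Real.log t := by
      rw [abs_of_nonneg (by linarith)]; linarith
    have e2 : 1 + (12 * M) ^ 2 ≤ 144 * jbr M ^ 2 := by rw [jbr_sq]; nlinarith [sq_nonneg M]
    have ht2 := Real.rpow_nonneg ht0.le (-2)
    have hj := jbr_pos M
    calc 180 * modeConst lam ^ 4 * (1 + |Real.log t|) ^ 2 * (1 + (12 * M) ^ 2) ^ 4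
          * t ^ (-2 : ℝ) * M
        ≤ 180 * modeConst lam ^ 4 * (2 * Real.log t) ^ 2 * (144 * jbr M ^ 2) ^ 4
          * t ^ (-2 : ℝ) * M := by gcongr
      _ = (180 * modeConst lam ^ 4 * 4 * 144 ^ 4) * t ^ (-2 : ℝ) * Real.log t ^ 2 * M
          * jbr M ^ 8 := by ring
      _ ≤ _ := by gcongr; linarith

/-- log² t = o(t^{1-δ}) because δ < 1; the threshold ε/(Q + 1) also covers Q = 0. -/
theorem eventually_log_sq_le {δ : ℝ} (hδ : δ < 1) {Q ε : ℝ} (hQ : 0 ≤ Q) (hε : 0 < ε) :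
    ∀ᶠ t : ℝ in atTop, t ^ (-2 : ℝ) * Real.log t ^ 2 * Q ≤ ε * t ^ (-1 - δ) := by
  have h := (isLittleO_log_rpow_atTop (r := (1 - δ) / 2) (by linarith)).pow
    (show 0 < 2 by norm_num)
  have hc : 0 < ε / (Q + 1) := by positivity
  filter_upwards [h.def hc, eventually_gt_atTop 0] with t ht ht0
  have ht2 := Real.rpow_pos_of_pos ht0 (-2)
  have e : (t ^ ((1 - δ) / 2)) ^ 2 = t ^ (1 - δ) := by
    rw [← Real.rpow_natCast, ← Real.rpow_mul ht0.le]; norm_num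
  rw [e, Real.norm_of_nonneg (sq_nonneg _),
    Real.norm_of_nonneg (Real.rpow_nonneg ht0.le _)] at ht
  have hp := Real.rpow_nonneg ht0.le (-1 - δ)
  calc t ^ (-2 : ℝ) * Real.log t ^ 2 * Q
      ≤ t ^ (-2 : ℝ) * (ε / (Q + 1) * t ^ (1 - δ)) * Q := by gcongr
    _ = ε * (Q / (Q + 1)) * (t ^ (-2 : ℝ) * t ^ (1 - δ)) := by ring
    _ = ε * (Q / (Q + 1)) * t ^ (-1 - δ) := by
        rw [← Real.rpow_add ht0]; ring_nf
    _ ≤ ε * 1 * t ^ (-1 - δ) := by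
        gcongr
        rw [div_le_one (by positivity)]; linarith
    _ = _ := by ring

theorem small_profile_estimates (lam : ℝ) (ε : ℝ) (hε : 0 < ε) :
    ∃ η : ℝ, 0 < η ∧ ∀ A B : ℝ → ℂ, MemWSobolev 2 (5 / 2) A → MemWSobolev 2 (5 / 2) B →
      linftyNorm A + linftyNorm B ≤ η →
        ∀ δ : ℝ, δ < 1 → ∃ T : ℝ, 1 ≤ T ∧
          ∃ G : ℝ → ℝ → ℂ, IsBoxPlusOne 1 (profile lam A B) G ∧
            ∀ t : ℝ, T ≤ t →
              eLpNorm (profile lam A B t) ∞ volume ≤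
                ENNReal.ofReal (ε * t ^ (-(1 / 2) : ℝ)) ∧
              eLpNorm (fun x => G t x - cubic lam (profile lam A B t x)) 2 volume ≤
                ENNReal.ofReal (ε * t ^ (-1 - δ)) := by
  obtain ⟨C, hC, h⟩ := profile_estimates lam
  -- m ≤ 1 gives ⟨m⟩² ≤ 2, whence the second entry. The Sobolev size M need not be small; it affects
  -- only T.
  refine ⟨min 1 (ε / (2 * C)), by positivity, fun A B hA hB hη δ hδ => ?_⟩
  obtain ⟨h1, G, hG, h2⟩ := h A B hA hB
  have hm : 0 ≤ linftyNorm A + linftyNorm B :=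
    add_nonneg (linftyNorm_nonneg A) (linftyNorm_nonneg B)
  have hM : 0 ≤ wSobolevNorm 2 (5 / 2) A + wSobolevNorm 2 (5 / 2) B :=
    add_nonneg (wSobolevNorm_nonneg _ _ _) (wSobolevNorm_nonneg _ _ _)
  generalize linftyNorm A + linftyNorm B = m at *
  generalize wSobolevNorm 2 (5 / 2) A + wSobolevNorm 2 (5 / 2) B = M at *
  have hj := jbr_pos M
  obtain ⟨T, hT⟩ := eventually_atTop.1 (eventually_log_sq_le hδ
    (show 0 ≤ C * M * jbr M ^ 8 by positivity) hε)
  refine ⟨max T 3, le_max_of_le_right (by norm_num), G, hG, fun t ht => ?_⟩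
  have ht3 : 3 ≤ t := (le_max_right _ _).trans ht
  have hp := Real.rpow_nonneg (by linarith : 0 ≤ t) (-(1 / 2))
  refine ⟨(h1 t ht3).2.trans (ENNReal.ofReal_le_ofReal ?_),
    (h2 t ht3).2.trans (ENNReal.ofReal_le_ofReal ?_)⟩
  · have m1 : m ≤ 1 := hη.trans (min_le_left _ _)
    have m2 : m ≤ ε / (2 * C) := hη.trans (min_le_right _ _)
    rw [le_div_iff₀ (by positivity)] at m2
    have e : m * jbr m ^ 2 ≤ 2 * m := by rw [jbr_sq]; nlinarith
    calc C * t ^ (-(1 / 2) : ℝ) * m * jbr m ^ 2 = C * t ^ (-(1 / 2) : ℝ) * (m * jbr m ^ 2) := by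
          ring
      _ ≤ C * t ^ (-(1 / 2) : ℝ) * (2 * m) := by gcongr
      _ = (m * (2 * C)) * t ^ (-(1 / 2) : ℝ) := by ring
      _ ≤ ε * t ^ (-(1 / 2) : ℝ) := by gcongr
  · have := hT t ((le_max_left _ _).trans ht)
    linarith

/-! ### Lower bound for the imaginary part -/

theorem im_add_sq_ge (α β : ℂ) :
    1 / 2 * (‖α‖ - ‖β‖) ^ 2 + 1 / 2 * (2 * (α * (starRingEnd ℂ) β) - α ^ 2 - β ^ 2).re
      ≤ (α + β).im ^ 2 := by
  -- (Im w)² = (|w|² - Re w²)/2 with w = α + β. In the application the frequencies cancel in αβ, so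
  -- this product gains nothing from oscillation and is bounded by |α||β|; the products αβ̄, α², β²
  -- are retained.
  have h := (Complex.re_le_norm (α * β)).trans_eq (norm_mul α β)
  have h1 : ‖α‖ ^ 2 = α.re ^ 2 + α.im ^ 2 := by
    rw [← Complex.normSq_eq_norm_sq, Complex.normSq_apply]; ring
  have h2 : ‖β‖ ^ 2 = β.re ^ 2 + β.im ^ 2 := by
    rw [← Complex.normSq_eq_norm_sq, Complex.normSq_apply]; ring
  simp only [Complex.mul_re, Complex.sub_re, Complex.add_im, Complex.conj_re, Complex.conj_im,
    sq, Complex.re_ofNat, Complex.im_ofNat] at h ⊢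
  nlinarith

namespace Mode
variable {m : Mode} {D : ℝ}

theorem norm_le_inv_jbr_sq {x z : ℝ} (h : jbr z ^ 2 * x ≤ D) : x ≤ D * (jbr z ^ 2)⁻¹ := by
  rw [← div_eq_mul_inv, le_div_iff₀ (pow_pos (jbr_pos z) 2)]
  linarith

/-- Non-stationary phase: the weight `z²/⟨z⟩²` vanishes at the stationary point `z = 0`. -/
theorem norm_integral_osc_le (h : m.Bounded D) {t : ℝ} (ht : 0 < t) :
    |m.κ| * t * ‖∫ z, ((vel z ^ 2 * (jbr z ^ 3)⁻¹ : ℝ) : ℂ) * (m.f.f z * m.osc t z)‖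
      ≤ (2 * D + D * (D * |Real.log t|)) * ∫ z, (jbr z ^ 2)⁻¹ := by
  have hD := h.nonneg
  have cj := continuous_jbr
  have hjne : ∀ z : ℝ, (jbr z : ℂ) ≠ 0 := fun z => by exact_mod_cast jbr_ne_zero z
  have co := m.continuous_osc t
  have cf := m.f.continuous
  have cf₁ := m.f.continuous₁
  have cS₁ := m.S.continuous₁
  have cv := continuous_vel
  have c3 := continuous_inv_jbr_cube
  have d0 : ∀ z : ℝ, HasDerivAt (fun z : ℝ => ((z / jbr z ^ 2 : ℝ) : ℂ))
      (((1 - z ^ 2) / jbr z ^ 4 : ℝ) : ℂ) z := by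
    intro z
    have hj := jbr_ne_zero z
    have h2 := jbr_sq z
    refine ((hasDerivAt_id' z).fun_div ((hasDerivAt_jbr z).fun_pow 2)
      (pow_ne_zero 2 hj)).ofReal_comp.congr_deriv (congrArg _ ?_)
    field_simp
    push_cast
    linear_combination (jbr z) * h2
  set R : ℝ → ℂ := fun z => m.osc t z * ((((1 - z ^ 2) / jbr z ^ 4 : ℝ) : ℂ) * m.f.f z
    + ((z / jbr z ^ 2 : ℝ) : ℂ) * m.f.f₁ z
    + ((z / jbr z ^ 2 : ℝ) : ℂ) * (m.f.f z * (Complex.I * m.S.f₁ z * Real.log t))) with hR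
  set I : ℝ → ℂ := fun z => ((vel z ^ 2 * (jbr z ^ 3)⁻¹ : ℝ) : ℂ) * (m.f.f z * m.osc t z) with hI
  have cR : Continuous R := by
    have k1 : Continuous fun z : ℝ => (1 - z ^ 2) / jbr z ^ 4 :=
      Continuous.div (by fun_prop) (by fun_prop) fun z => pow_ne_zero 4 (jbr_ne_zero z)
    have k2 : Continuous fun z : ℝ => z / jbr z ^ 2 :=
      Continuous.div (by fun_prop) (by fun_prop) fun z => pow_ne_zero 2 (jbr_ne_zero z)
    fun_prop
  have cI : Continuous I := by fun_prop
  have b1 : ∀ z : ℝ, ‖(((1 - z ^ 2) / jbr z ^ 4 : ℝ) : ℂ)‖ ≤ 1 := by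
    intro z
    refine norm_real_le ?_
    have hj := one_le_jbr z
    have h2 := jbr_sq z
    rw [abs_div, abs_of_pos (pow_pos (jbr_pos z) 4), div_le_one (pow_pos (jbr_pos z) 4)]
    refine le_trans ?_ (pow_le_pow_right₀ hj (by norm_num : 2 ≤ 4))
    rw [abs_le]
    constructor <;> nlinarith [sq_nonneg z]
  have b2 : ∀ z : ℝ, ‖((z / jbr z ^ 2 : ℝ) : ℂ)‖ ≤ 1 := by
    intro z
    refine norm_real_le ?_
    rw [abs_div, abs_of_pos (pow_pos (jbr_pos z) 2), div_le_one (pow_pos (jbr_pos z) 2)]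
    exact (abs_le_jbr z).trans (le_self_pow₀ (one_le_jbr z) (by norm_num))
  have bR : ∀ z, ‖R z‖ ≤ (2 * D + D * (D * |Real.log t|)) * (jbr z ^ 2)⁻¹ := by
    intro z
    have f0 := norm_le_inv_jbr_sq (h.f_le z)
    have f1 := norm_le_inv_jbr_sq (h.f₁_le z)
    have s1 : ‖Complex.I * m.S.f₁ z * Real.log t‖ ≤ D * |Real.log t| := by
      refine norm_mul_le_mul ?_ (norm_real_le le_rfl)
      rw [norm_mul, Complex.norm_I, one_mul]; exact h.S₁_le z
    refine (norm_mul_le_mul (m.norm_osc t z).le (norm_add₃_le.trans (add_le_add (add_le_add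
      (norm_mul_le_mul (b1 z) f0) (norm_mul_le_mul (b2 z) f1))
        (norm_mul_le_mul (b2 z) (norm_mul_le_mul f0 s1))))).trans (le_of_eq ?_)
    ring
  have iR : Integrable R volume := (integrable_inv_jbr_sq.const_mul _).mono'
    cR.aestronglyMeasurable (Eventually.of_forall bR)
  have bI : ∀ z, ‖I z‖ ≤ D * (jbr z ^ 3)⁻¹ := by
    intro z
    have hp : 0 ≤ (jbr z ^ 3)⁻¹ := (inv_pos.2 (pow_pos (jbr_pos z) 3)).le
    have e : |vel z ^ 2 * (jbr z ^ 3)⁻¹| ≤ 1 * (jbr z ^ 3)⁻¹ := by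
      rw [abs_mul, abs_of_nonneg hp, abs_of_nonneg (sq_nonneg _)]
      gcongr
      rw [sq_le_one_iff_abs_le_one]; exact (abs_vel_lt_one z).le
    refine (norm_mul_le_mul (norm_real_le e) (norm_mul_le_mul (h.norm_f_le z)
      (m.norm_osc t z).le)).trans (le_of_eq ?_)
    ring
  have iI : Integrable I volume := (integrable_inv_jbr_cube.const_mul _).mono'
    cI.aestronglyMeasurable (Eventually.of_forall bI)
  -- The factor z/⟨z⟩² times the phase derivative -iκtz/⟨z⟩³ is -iκt v²⟨z⟩⁻³ with v = z/⟨z⟩. The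
  -- weighted integrand thus appears without division by z.
  have hF : ∀ z, HasDerivAt (fun z => ((z / jbr z ^ 2 : ℝ) : ℂ) * (m.f.f z * m.osc t z))
      (R z - Complex.I * m.κ * t * I z) z := by
    intro z
    refine ((d0 z).fun_mul ((m.f.hasDeriv z).fun_mul (m.hasDerivAt_osc_space t z))).congr_deriv ?_
    have hj := hjne z
    simp only [hR, hI, vel]
    push_cast
    field_simp
    ring
  have cF' : Continuous fun z => R z - Complex.I * m.κ * t * I z := by fun_prop
  have bF : ∀ z, ‖((z / jbr z ^ 2 : ℝ) : ℂ) * (m.f.f z * m.osc t z)‖ ≤ D * (jbr z)⁻¹ := by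
    intro z
    refine (norm_mul_le_mul (b2 z) (norm_mul_le_mul (norm_le_inv_jbr_sq (h.f_le z))
      (m.norm_osc t z).le)).trans ?_
    rw [one_mul, mul_one]
    gcongr
    · exact jbr_pos z
    · exact le_self_pow₀ (one_le_jbr z) (by norm_num)
  have hz := (LocAC.of_hasDerivAt hF cF').integral_deriv_eq_zero (Eventually.of_forall hF)
    (iR.sub (iI.const_mul _)) (tendsto_zero_of_le_inv_jbr bF).1 (tendsto_zero_of_le_inv_jbr bF).2
  rw [integral_sub iR (iI.const_mul _), integral_const_mul, sub_eq_zero] at hz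
  have hn : |m.κ| * t * ‖∫ z, I z‖ = ‖∫ z, R z‖ := by
    rw [hz, norm_mul, norm_mul, norm_mul, Complex.norm_I, one_mul, Complex.norm_real,
      Complex.norm_real, Real.norm_eq_abs, Real.norm_of_nonneg ht.le]
  rw [hn, ← integral_const_mul]
  exact norm_integral_le_of_norm_le (integrable_inv_jbr_sq.const_mul _) (Eventually.of_forall bR)

/-- The integration by parts gains 1/t and loses one logarithm through S log t. -/
theorem tendsto_integral_osc (h : m.Bounded D) (hκ : m.κ ≠ 0) :
    Tendsto (fun t : ℝ => ∫ z, ((vel z ^ 2 * (jbr z ^ 3)⁻¹ : ℝ) : ℂ) * (m.f.f z * m.osc t z))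
      atTop (nhds 0) := by
  have hκ' : 0 < |m.κ| := abs_pos.2 hκ
  set J := ∫ z, (jbr z ^ 2)⁻¹
  have hlim : Tendsto (fun t : ℝ => |m.κ|⁻¹ * J * (2 * D * t⁻¹ + D * D * (Real.log t / t)))
      atTop (nhds 0) := by
    have h1 : Tendsto (fun t : ℝ => Real.log t / t) atTop (nhds 0) :=
      Real.isLittleO_log_id_atTop.tendsto_div_nhds_zero
    have h2 := ((tendsto_inv_atTop_zero (𝕜 := ℝ)).const_mul (2 * D)).add (h1.const_mul (D * D))
    simpa using h2.const_mul (|m.κ|⁻¹ * J)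
  refine squeeze_zero_norm' ?_ hlim
  filter_upwards [eventually_ge_atTop 1] with t ht
  have ht0 : 0 < t := by linarith
  have := norm_integral_osc_le h ht0
  rw [abs_of_nonneg (Real.log_nonneg ht)] at this
  rw [← mul_le_mul_iff_right₀ (mul_pos hκ' ht0)]
  refine this.trans (le_of_eq ?_)
  change (2 * D + D * (D * Real.log t)) * J = _
  clear_value J
  field_simp

end Mode

/-- The mode of `2 A \bar B` in the square of the leading profile. -/
def crossMode (lam : ℝ) (a b : Jet) : Mode :=
  ⟨0, -2, (a.mul b.conj).smul 2, (jetSA lam a b).add ((jetSB lam a b).smul (-1)), fun z => by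
    change ((jetSA lam a b).f z + (-1) * (jetSB lam a b).f z).im = 0
    simp [jetSA_real, jetSB_real]⟩

/-- The mode of `A²` in the square of the leading profile. -/
def squareModeA (lam : ℝ) (a b : Jet) : Mode :=
  ⟨0, -2, a.mul a, (jetSA lam a b).smul 2, fun z => by
    change (2 * (jetSA lam a b).f z).im = 0
    simp [jetSA_real]⟩

/-- The mode of `B²` in the square of the leading profile. -/
def squareModeB (lam : ℝ) (a b : Jet) : Mode :=
  ⟨0, 2, b.mul b, (jetSB lam a b).smul 2, fun z => by
    change (2 * (jetSB lam a b).f z).im = 0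
    simp [jetSB_real]⟩

section
variable {K lam : ℝ} {k h : ℝ → ℝ} {a b : Jet}

theorem controlled_crossMode (H : Controls K k h) (ha : JetBound K k h 1 0 a)
    (hb : JetBound K k h 1 0 b) : (crossMode lam a b).Controlled K k h (modeConst lam) 1 := by
  refine ⟨one_le_modeConst lam, by simp [crossMode],
    ((JetBound.mul H zero_le_one zero_le_one ha hb.conj).smul 2).mono H ?_,
    ((jetBound_SA H ha hb).add ((jetBound_SB H ha hb).smul (-1))).mono H ?_⟩
  · simp only [Complex.norm_ofNat]
    unfold modeConst; linarith [abs_nonneg lam]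
  · simp only [norm_neg, norm_one]
    unfold modeConst; linarith [abs_nonneg lam]

theorem controlled_squareModeA (H : Controls K k h) (ha : JetBound K k h 1 0 a)
    (hb : JetBound K k h 1 0 b) : (squareModeA lam a b).Controlled K k h (modeConst lam) 1 := by
  refine ⟨one_le_modeConst lam, by simp [squareModeA],
    (JetBound.mul H zero_le_one zero_le_one ha ha).mono H ?_,
    ((jetBound_SA H ha hb).smul 2).mono H ?_⟩
  · unfold modeConst; linarith [abs_nonneg lam]
  · simp only [Complex.norm_ofNat]
    unfold modeConst; linarith [abs_nonneg lam]

theorem controlled_squareModeB (H : Controls K k h) (ha : JetBound K k h 1 0 a)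
    (hb : JetBound K k h 1 0 b) : (squareModeB lam a b).Controlled K k h (modeConst lam) 1 := by
  refine ⟨one_le_modeConst lam, by simp [squareModeB],
    (JetBound.mul H zero_le_one zero_le_one hb hb).mono H ?_,
    ((jetBound_SB H ha hb).smul 2).mono H ?_⟩
  · unfold modeConst; linarith [abs_nonneg lam]
  · simp only [Complex.norm_ofNat]
    unfold modeConst; linarith [abs_nonneg lam]

/-- Together with the two identities below, writes the products retained in `im_add_sq_ge` as modes
of frequency ±2, to which non-stationary phase applies. -/
theorem crossMode_eq (lam : ℝ) (a b : Jet) (t z : ℝ) :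
    (crossMode lam a b).f.f z * (crossMode lam a b).osc t z =
      2 * (a.f z * (modeA lam a b).osc t z
        * (starRingEnd ℂ) (b.f z * (modeB lam a b).osc t z)) := by
  have h : (crossMode lam a b).osc t z =
      (modeA lam a b).osc t z * (starRingEnd ℂ) ((modeB lam a b).osc t z) := by
    rw [oscA_eq, oscB_eq, conj_cis, ← cis_add]
    refine Mode.osc_eq_cis _ ?_
    simp only [crossMode, Jet.add, Jet.smul, jetSA_f, jetSB_f]; push_cast; ring
  rw [h, map_mul]
  change 2 * (a.f z * (starRingEnd ℂ) (b.f z)) * _ = _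
  ring

theorem squareModeA_eq (lam : ℝ) (a b : Jet) (t z : ℝ) :
    (squareModeA lam a b).f.f z * (squareModeA lam a b).osc t z =
      (a.f z * (modeA lam a b).osc t z) ^ 2 := by
  have h : (squareModeA lam a b).osc t z = (modeA lam a b).osc t z ^ 2 := by
    rw [oscA_eq, sq, ← cis_add]
    refine Mode.osc_eq_cis _ ?_
    simp only [squareModeA, Jet.smul, jetSA_f]; push_cast; ring
  rw [h]
  change a.f z * a.f z * _ = _
  ring

theorem squareModeB_eq (lam : ℝ) (a b : Jet) (t z : ℝ) :
    (squareModeB lam a b).f.f z * (squareModeB lam a b).osc t z =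
      (b.f z * (modeB lam a b).osc t z) ^ 2 := by
  have h : (squareModeB lam a b).osc t z = (modeB lam a b).osc t z ^ 2 := by
    rw [oscB_eq, sq, ← cis_add]
    refine Mode.osc_eq_cis _ ?_
    simp only [squareModeB, Jet.smul, jetSB_f]; push_cast; ring
  rw [h]
  change b.f z * b.f z * _ = _
  ring

/-- Pointwise lower bound of the imaginary part of the profile. -/
theorem im_profileZ_sq_ge {D t : ℝ} (ht : 0 < t) (hA : (modeA2 lam a b).Bounded D)
    (hB : (modeB2 lam a b).Bounded D) (z : ℝ) :
    1 / 4 * (‖a.f z‖ - ‖b.f z‖) ^ 2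
      + 1 / 4 * ((crossMode lam a b).f.f z * (crossMode lam a b).osc t z
        - (squareModeA lam a b).f.f z * (squareModeA lam a b).osc t z
        - (squareModeB lam a b).f.f z * (squareModeB lam a b).osc t z).re - 4 * D ^ 2 / t ^ 2
      ≤ t * (profileZ lam a.f b.f t z).im ^ 2 := by
  rw [crossMode_eq, squareModeA_eq, squareModeB_eq, profileZ_eq_modes lam a b ht]
  set α := a.f z * (modeA lam a b).osc t z with hα
  set β := b.f z * (modeB lam a b).osc t z with hβ
  have nα : ‖α‖ = ‖a.f z‖ := by rw [hα, norm_mul, Mode.norm_osc, mul_one]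
  have nβ : ‖β‖ = ‖b.f z‖ := by rw [hβ, norm_mul, Mode.norm_osc, mul_one]
  have key := im_add_sq_ge α β
  rw [nα, nβ] at key
  have eU : (modeA lam a b).val t z + (modeB lam a b).val t z
      = ((t ^ (-(1 / 2) : ℝ) : ℝ) : ℂ) * (α + β) := by
    simp only [Mode.val, hα, hβ]
    rw [show t ^ (modeA lam a b).r / t = _ from rpow_half_div ht,
      show t ^ (modeB lam a b).r / t = _ from rpow_half_div ht]
    simp only [modeA, modeB]; ring
  set ρ := t ^ (-(1 / 2) : ℝ) with hρ
  have hρ2 : t * ρ ^ 2 = 1 := by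
    rw [hρ, ← Real.rpow_natCast, ← Real.rpow_mul ht.le]
    norm_num
    rw [Real.rpow_neg_one, mul_inv_cancel₀ ht.ne']
  have hρ0 : 0 ≤ ρ := Real.rpow_nonneg ht.le _
  set V := (modeA2 lam a b).val t z + (modeB2 lam a b).val t z with hV
  have nV : ‖V‖ ≤ 2 * (ρ / t * D) := by
    have nv : ∀ m : Mode, m.r = -(1 / 2) → m.Bounded D → ‖m.val t z‖ ≤ ρ / t * D := by
      intro m hr hm
      unfold Mode.val
      rw [norm_mul, m.norm_osc, mul_one, hr]
      exact Mode.norm_mul_le_mul (Mode.norm_real_le (abs_of_nonneg (by positivity)).le)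
        (hm.norm_f_le z)
    refine (norm_add_le _ _).trans ?_
    linarith [nv (modeA2 lam a b) rfl hA, nv (modeB2 lam a b) rfl hB]
  have hVim : t * V.im ^ 2 ≤ 4 * D ^ 2 / t ^ 2 := by
    have h1 : V.im ^ 2 ≤ (2 * (ρ / t * D)) ^ 2 := by
      rw [← sq_abs]
      have := (Complex.abs_im_le_norm V).trans nV
      gcongr
    calc t * V.im ^ 2 ≤ t * (2 * (ρ / t * D)) ^ 2 := by gcongr
      _ = (t * ρ ^ 2) * (4 * D ^ 2 / t ^ 2) := by ring
      _ = _ := by rw [hρ2, one_mul]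
  rw [show (modeA lam a b).val t z + (modeB lam a b).val t z + (modeA2 lam a b).val t z
    + (modeB2 lam a b).val t z = (ρ : ℂ) * (α + β) + V by rw [← eU, hV]; ring]
  rw [Complex.add_im, Complex.im_ofReal_mul]
  have e2 : t * (ρ * (α + β).im) ^ 2 = (α + β).im ^ 2 := by
    calc _ = (t * ρ ^ 2) * (α + β).im ^ 2 := by ring
      _ = _ := by rw [hρ2, one_mul]
  -- (x + y)² ≥ x²/2 - y², from (x + 2y)² ≥ 0: the correction is discarded at the cost of half of
  -- the main term.
  have e3 : t * (ρ * (α + β).im + V.im) ^ 2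
      ≥ 1 / 2 * (t * (ρ * (α + β).im) ^ 2) - t * V.im ^ 2 := by
    nlinarith [mul_nonneg ht.le (sq_nonneg (ρ * (α + β).im + 2 * V.im))]
  rw [e2] at e3
  linarith

theorem exists_norm_profileZ_le (H : Controls K k h) (ha : JetBound K k h 1 0 a)
    (hb : JetBound K k h 1 0 b) {t : ℝ} (ht : 1 ≤ t) :
    ∃ Q, ∀ z, ‖profileZ lam a.f b.f t z‖ ≤ Q := by
  have e : ∀ z, 1 * K ^ 0 * k z ≤ K := fun z => by simpa using H.le_K z
  exact ⟨_, fun z => norm_profileZ_le ht ((ha.b₀ z).trans (e z)) ((hb.b₀ z).trans (e z))⟩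

theorem memLp_profile_two {A B : ℝ → ℂ} (H : Controls K k h) (ha : JetBound K k h 1 0 a)
    (hb : JetBound K k h 1 0 b) (hA : a.f =ᵐ[volume] A) (hB : b.f =ᵐ[volume] B) {t : ℝ}
    (ht : 1 ≤ t) : MemLp (profile lam A B t) 2 volume := by
  have ht0 : 0 < t := by linarith
  refine ⟨aestronglyMeasurable_profile hA hB ht0, ?_⟩
  rw [← eLpNorm_congr_ae (profile_congr_ae hA hB t), profile_eq_coneLift,
    eLpNorm_coneLift ht0 _ (fun x hx => by simp [coneLift, hx])]
  obtain ⟨Q, hQ⟩ := exists_norm_profileZ_le (lam := lam) H ha hb ht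
  have c3 := Mode.continuous_inv_jbr_cube
  have hpos : ∀ z, 0 ≤ t * (jbr z ^ 3)⁻¹ := fun z =>
    (mul_pos ht0 (inv_pos.2 (pow_pos (jbr_pos z) 3))).le
  have hm : MemLp (fun z => Real.sqrt (t * (jbr z ^ 3)⁻¹)) 2 volume := by
    rw [memLp_two_iff_integrable_sq (Continuous.aestronglyMeasurable (by fun_prop))]
    simp only [Real.sq_sqrt (hpos _)]
    exact integrable_inv_jbr_cube.const_mul t
  refine lt_of_le_of_lt (eLpNorm_mono fun z => ?_) (hm.const_mul Q).2
  rw [coneLift_vel ht0, norm_smul, mul_comm, norm_mul]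
  gcongr
  exact (hQ z).trans (Real.le_norm_self Q)

/-- The squared norm is the integral of t⟨z⟩⁻³(Im)² in z, so any integrable minorant of this density
bounds it from below. -/
theorem integral_le_eLpNorm_sq {t : ℝ} (H : Controls K k h) (ha : JetBound K k h 1 0 a)
    (hb : JetBound K k h 1 0 b) (ht : 1 ≤ t) {q : ℝ → ℝ} (hq : Integrable q volume)
    (hle : ∀ z, q z ≤ (jbr z ^ 3)⁻¹ * (t * (profileZ lam a.f b.f t z).im ^ 2)) :
    ENNReal.ofReal (∫ z, q z) ^ (1 / 2 : ℝ) ≤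
      eLpNorm (fun x => (profile lam a.f b.f t x).im) 2 volume := by
  have ht0 : 0 < t := by linarith
  have c3 := Mode.continuous_inv_jbr_cube
  have cP := continuous_profileZ lam a b ht0
  obtain ⟨Q, hQ⟩ := exists_norm_profileZ_le (lam := lam) H ha hb ht
  have hp : ∀ z, 0 ≤ (jbr z ^ 3)⁻¹ := fun z => (inv_pos.2 (pow_pos (jbr_pos z) 3)).le
  have hR : Integrable (fun z => (jbr z ^ 3)⁻¹ * (t * (profileZ lam a.f b.f t z).im ^ 2))
      volume := by
    refine (integrable_inv_jbr_cube.mul_const (t * Q ^ 2)).mono'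
      (Continuous.aestronglyMeasurable (c3.mul (continuous_const.mul
        ((Complex.continuous_im.comp cP).pow 2)))) (Eventually.of_forall fun z => ?_)
    have := hp z
    rw [Real.norm_of_nonneg (by positivity)]
    have h1 : (profileZ lam a.f b.f t z).im ^ 2 ≤ Q ^ 2 := by
      rw [← sq_abs]
      have := (Complex.abs_im_le_norm _).trans (hQ z)
      gcongr
    gcongr
  rw [eLpNorm_two_sq, lintegral_coneLift ht0 _ (fun x hx => by simp [profile, uap, vap, hx])]
  gcongr
  refine (ENNReal.ofReal_le_ofReal (integral_mono hq hR hle)).trans (le_of_eq ?_)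
  rw [ofReal_integral_eq_lintegral_ofReal hR (Eventually.of_forall fun z => by
    have := hp z
    positivity)]
  refine lintegral_congr fun z => ?_
  rw [profile_eq_coneLift, coneLift_vel ht0, Real.enorm_eq_ofReal_abs,
    ← ENNReal.ofReal_pow (abs_nonneg _), sq_abs, ← ENNReal.ofReal_mul
      (mul_nonneg ht0.le (hp z))]
  congr 1
  ring

theorem Mode.Bounded.integrable_weight {m : Mode} {D : ℝ} (hm : m.Bounded D) (t : ℝ) :
    Integrable (fun z => ((vel z ^ 2 * (jbr z ^ 3)⁻¹ : ℝ) : ℂ) * (m.f.f z * m.osc t z))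
      volume := by
  have c3 := Mode.continuous_inv_jbr_cube
  have cv := continuous_vel
  have cf := m.f.continuous
  have co := m.continuous_osc t
  refine (integrable_inv_jbr_cube.mul_const D).mono'
    (Continuous.aestronglyMeasurable (by fun_prop)) (Eventually.of_forall fun z => ?_)
  have hp : 0 ≤ (jbr z ^ 3)⁻¹ := (inv_pos.2 (pow_pos (jbr_pos z) 3)).le
  have e : |vel z ^ 2 * (jbr z ^ 3)⁻¹| ≤ 1 * (jbr z ^ 3)⁻¹ := by
    rw [abs_mul, abs_of_nonneg hp, abs_of_nonneg (sq_nonneg _)]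
    gcongr
    rw [sq_le_one_iff_abs_le_one]; exact (abs_vel_lt_one z).le
  refine (Mode.norm_mul_le_mul (Mode.norm_real_le e) (Mode.norm_mul_le_mul (hm.norm_f_le z)
    (m.norm_osc t z).le)).trans (le_of_eq ?_)
  ring

end

theorem liminf_im_profile_pos (lam : ℝ) {A B : ℝ → ℂ} (hA : MemWSobolev 2 (5 / 2) A)
    (hB : MemWSobolev 2 (5 / 2) B) (hne : 0 < volume {ξ : ℝ | ‖A ξ‖ ≠ ‖B ξ‖}) :
    (∀ t : ℝ, 3 ≤ t → MemLp (profile lam A B t) 2 volume) ∧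
      0 < liminf (fun t : ℝ => eLpNorm (fun x => (profile lam A B t x).im) 2 volume) atTop := by
  obtain ⟨a, b, ha, hb, -, H⟩ := exists_jets hA hB
  generalize 12 * (wSobolevNorm 2 (5 / 2) A + wSobolevNorm 2 (5 / 2) B) = K at H
  have ja := jetBound_left K a b
  have jb := jetBound_right K a b
  refine ⟨fun t ht => memLp_profile_two H ja jb ha hb (by linarith), ?_⟩
  have hD2 := (controlled_modeA2 (lam := lam) H ja jb).bounded H
  have hD3 := (controlled_modeB2 (lam := lam) H ja jb).bounded H
  have hC := (controlled_crossMode (lam := lam) H ja jb).bounded H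
  have hSA := (controlled_squareModeA (lam := lam) H ja jb).bounded H
  have hSB := (controlled_squareModeB (lam := lam) H ja jb).bounded H
  generalize modeConst lam * K ^ 2 * K + modeConst lam * (1 + K ^ 2) = D at hD2 hD3
  have lC := Mode.tendsto_integral_osc hC (by simp [crossMode])
  have lA := Mode.tendsto_integral_osc hSA (by simp [squareModeA])
  have lB := Mode.tendsto_integral_osc hSB (by simp [squareModeB])
  have c3 := Mode.continuous_inv_jbr_cube
  have cv := continuous_vel
  have ca := a.continuous
  have cb := b.continuous
  have hp : ∀ z, 0 < (jbr z ^ 3)⁻¹ := fun z => inv_pos.2 (pow_pos (jbr_pos z) 3)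
  have hv : ∀ z, vel z ^ 2 ≤ 1 := fun z => by
    rw [sq_le_one_iff_abs_le_one]; exact (abs_vel_lt_one z).le
  -- The weight lies below the Jacobian density ⟨z⟩⁻³, so it is admissible for a lower bound, and it
  -- vanishes at the stationary point z = 0.
  set w : ℝ → ℝ := fun z => vel z ^ 2 * (jbr z ^ 3)⁻¹ with hw
  have hw0 : ∀ z, 0 ≤ w z := fun z => mul_nonneg (sq_nonneg _) (hp z).le
  have iw : Integrable w volume := by
    refine integrable_inv_jbr_cube.mono' (Continuous.aestronglyMeasurable (by fun_prop))
      (Eventually.of_forall fun z => ?_)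
    rw [Real.norm_of_nonneg (hw0 z)]
    exact mul_le_of_le_one_left (hp z).le (hv z)
  have hna : ∀ z, ‖a.f z‖ ≤ K := fun z => (ja.b₀ z).trans (by simpa using H.le_K z)
  have hnb : ∀ z, ‖b.f z‖ ≤ K := fun z => (jb.b₀ z).trans (by simpa using H.le_K z)
  have iN : Integrable (fun z => w z * (‖a.f z‖ - ‖b.f z‖) ^ 2) volume := by
    refine (iw.mul_const (K ^ 2)).mono' (Continuous.aestronglyMeasurable (by fun_prop))
      (Eventually.of_forall fun z => ?_)
    rw [Real.norm_of_nonneg (mul_nonneg (hw0 z) (sq_nonneg _))]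
    refine mul_le_mul_of_nonneg_left ?_ (hw0 z)
    rw [sq_le_sq, abs_of_nonneg H.K_nonneg, abs_le]
    constructor <;> linarith [hna z, hnb z, norm_nonneg (a.f z), norm_nonneg (b.f z)]
  set N := ∫ z, w z * (‖a.f z‖ - ‖b.f z‖) ^ 2 with hN
  -- The weight vanishes only at z = 0, a null set, so it does not affect positivity.
  have hNpos : 0 < N := by
    rw [hN, integral_pos_iff_support_of_nonneg (fun z => mul_nonneg (hw0 z) (sq_nonneg _)) iN]
    refine hne.trans_le (measure_mono_ae ?_)
    have h0 : ∀ᵐ z : ℝ, z ≠ 0 := by simp [ae_iff]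
    filter_upwards [ha, hb, h0] with z h1 h2 h3 h4
    have h5 : ‖a.f z‖ ≠ ‖b.f z‖ := by rw [h1, h2]; exact h4
    have h6 : vel z ≠ 0 := div_ne_zero h3 (jbr_ne_zero z)
    exact mul_ne_zero (mul_ne_zero (pow_ne_zero 2 h6) (hp z).ne')
      (pow_ne_zero 2 (sub_ne_zero.2 h5))
  -- Φ is the integral of the minorant: a constant N/4, oscillating integrals tending to zero, and
  -- the error of the corrections.
  set Φ : ℝ → ℝ := fun t => 1 / 4 * N + 1 / 4 * (
    (∫ z, (w z : ℂ) * ((crossMode lam a b).f.f z * (crossMode lam a b).osc t z))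
    - (∫ z, (w z : ℂ) * ((squareModeA lam a b).f.f z * (squareModeA lam a b).osc t z))
    - ∫ z, (w z : ℂ) * ((squareModeB lam a b).f.f z * (squareModeB lam a b).osc t z)).re
    - 4 * D ^ 2 / t ^ 2 * ∫ z, w z with hΦ
  have lΦ : Tendsto Φ atTop (nhds (1 / 4 * N)) := by
    have h1 : Tendsto (fun t : ℝ => 4 * D ^ 2 / t ^ 2) atTop (nhds 0) :=
      Tendsto.div_atTop tendsto_const_nhds (tendsto_pow_atTop two_ne_zero)
    have h2 := (Complex.continuous_re.tendsto _).comp ((lC.sub lA).sub lB)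
    have h3 := ((h2.const_mul (1 / 4)).const_add (1 / 4 * N)).sub
      (h1.mul_const (∫ z, w z))
    simp only [sub_zero, Complex.zero_re, mul_zero, add_zero, zero_mul] at h3
    exact h3
  -- Any positive level below the limit N/4 would do.
  have hpos : 0 < ENNReal.ofReal (N / 8) ^ (1 / 2 : ℝ) :=
    ENNReal.rpow_pos (ENNReal.ofReal_pos.2 (by linarith)) ENNReal.ofReal_ne_top
  refine hpos.trans_le (le_liminf_of_le (by isBoundedDefault) ?_)
  filter_upwards [lΦ.eventually (lt_mem_nhds (show N / 8 < 1 / 4 * N by linarith)),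
    eventually_ge_atTop 1] with t ht ht1
  have ht0 : 0 < t := by linarith
  have hcongr : eLpNorm (fun x => (profile lam A B t x).im) 2 volume
      = eLpNorm (fun x => (profile lam a.f b.f t x).im) 2 volume :=
    eLpNorm_congr_ae ((profile_congr_ae (lam := lam) ha hb t).mono fun x hx => by
      simp only [hx])
  rw [hcongr]
  have i1 := hC.integrable_weight t
  have i2 := hSA.integrable_weight t
  have i3 := hSB.integrable_weight t
  set q : ℝ → ℝ := fun z => 1 / 4 * (w z * (‖a.f z‖ - ‖b.f z‖) ^ 2)
    + 1 / 4 * ((w z : ℂ) * ((crossMode lam a b).f.f z * (crossMode lam a b).osc t z)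
      - (w z : ℂ) * ((squareModeA lam a b).f.f z * (squareModeA lam a b).osc t z)
      - (w z : ℂ) * ((squareModeB lam a b).f.f z * (squareModeB lam a b).osc t z)).re
    - 4 * D ^ 2 / t ^ 2 * w z with hq
  have i123 := (i1.sub i2).sub i3
  have ire : Integrable (fun z => ((w z : ℂ) *
      ((crossMode lam a b).f.f z * (crossMode lam a b).osc t z)
      - (w z : ℂ) * ((squareModeA lam a b).f.f z * (squareModeA lam a b).osc t z)
      - (w z : ℂ) * ((squareModeB lam a b).f.f z * (squareModeB lam a b).osc t z)).re) volume :=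
    i123.re
  have iq : Integrable q volume :=
    ((iN.const_mul _).add (ire.const_mul _)).sub (iw.const_mul _)
  have eq : ∫ z, q z = Φ t := by
    have e1 : ∫ z, ((w z : ℂ) * ((crossMode lam a b).f.f z * (crossMode lam a b).osc t z)
        - (w z : ℂ) * ((squareModeA lam a b).f.f z * (squareModeA lam a b).osc t z)
        - (w z : ℂ) * ((squareModeB lam a b).f.f z * (squareModeB lam a b).osc t z)).re =
        ((∫ z, (w z : ℂ) * ((crossMode lam a b).f.f z * (crossMode lam a b).osc t z))
        - (∫ z, (w z : ℂ) * ((squareModeA lam a b).f.f z * (squareModeA lam a b).osc t z))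
        - ∫ z, (w z : ℂ) * ((squareModeB lam a b).f.f z * (squareModeB lam a b).osc t z)).re := by
      have s := (integral_sub (i1.sub i2) i3).trans
        (congrArg (fun y : ℂ => y - ∫ z, (w z : ℂ) * ((squareModeB lam a b).f.f z *
          (squareModeB lam a b).osc t z)) (integral_sub i1 i2))
      exact (integral_re i123).trans (congrArg Complex.re s)
    have s₁ := integral_add (iN.const_mul (1 / 4)) (ire.const_mul (1 / 4))
    rw [integral_const_mul, integral_const_mul, e1] at s₁
    have s₂ := integral_sub ((iN.const_mul (1 / 4)).add (ire.const_mul (1 / 4)))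
      (iw.const_mul (4 * D ^ 2 / t ^ 2))
    rw [integral_const_mul] at s₂
    exact s₂.trans (congrArg (fun y => y - 4 * D ^ 2 / t ^ 2 * ∫ z, w z) s₁)
  have hle : ∀ z, q z ≤ (jbr z ^ 3)⁻¹ * (t * (profileZ lam a.f b.f t z).im ^ 2) := by
    intro z
    have h1 := mul_le_mul_of_nonneg_left (im_profileZ_sq_ge ht0 hD2 hD3 z) (hw0 z)
    refine le_trans (le_of_eq ?_) (h1.trans ?_)
    · simp only [hq]
      rw [← mul_sub, ← mul_sub, Complex.re_ofReal_mul]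
      ring
    · refine mul_le_mul_of_nonneg_right ?_ (by positivity)
      exact mul_le_of_le_one_left (hp z).le (hv z)
  refine le_trans ?_ (integral_le_eLpNorm_sq H ja jb ht1 iq hle)
  rw [eq]
  gcongr

end KG

end

theorem propositionP (lam : ℝ) :
    (∃ C : ℝ, 0 < C ∧ ∀ A B : ℝ → ℂ,
      KG.MemWSobolev 2 (5 / 2) A → KG.MemWSobolev 2 (5 / 2) B →
        (∀ t : ℝ, 3 ≤ t →
          MemLp (KG.profile lam A B t) ∞ volume ∧
          eLpNorm (KG.profile lam A B t) ∞ volume ≤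
            ENNReal.ofReal (C * t ^ (-(1 / 2) : ℝ) *
              (KG.linftyNorm A + KG.linftyNorm B) *
              KG.jbr (KG.linftyNorm A + KG.linftyNorm B) ^ 2)) ∧
        ∃ G : ℝ → ℝ → ℂ, KG.IsBoxPlusOne 1 (KG.profile lam A B) G ∧
          ∀ t : ℝ, 3 ≤ t →
            MemLp (fun x => G t x - KG.cubic lam (KG.profile lam A B t x)) 2 volume ∧
            eLpNorm (fun x => G t x - KG.cubic lam (KG.profile lam A B t x)) 2 volume ≤
              ENNReal.ofReal (C * t ^ (-2 : ℝ) * Real.log t ^ 2 *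
                (KG.wSobolevNorm 2 (5 / 2) A + KG.wSobolevNorm 2 (5 / 2) B) *
                KG.jbr (KG.wSobolevNorm 2 (5 / 2) A + KG.wSobolevNorm 2 (5 / 2) B) ^ 8)) ∧
    (∀ ε : ℝ, 0 < ε → ∃ η : ℝ, 0 < η ∧ ∀ A B : ℝ → ℂ,
      KG.MemWSobolev 2 (5 / 2) A → KG.MemWSobolev 2 (5 / 2) B →
      KG.linftyNorm A + KG.linftyNorm B ≤ η →
        ∀ δ : ℝ, δ < 1 → ∃ T : ℝ, 1 ≤ T ∧
          ∃ G : ℝ → ℝ → ℂ, KG.IsBoxPlusOne 1 (KG.profile lam A B) G ∧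
            ∀ t : ℝ, T ≤ t →
              eLpNorm (KG.profile lam A B t) ∞ volume ≤
                ENNReal.ofReal (ε * t ^ (-(1 / 2) : ℝ)) ∧
              eLpNorm (fun x => G t x - KG.cubic lam (KG.profile lam A B t x)) 2 volume ≤
                ENNReal.ofReal (ε * t ^ (-1 - δ))) ∧
    (∀ A B : ℝ → ℂ,
      KG.MemWSobolev 2 (5 / 2) A → KG.MemWSobolev 2 (5 / 2) B →
      0 < volume {ξ : ℝ | ‖A ξ‖ ≠ ‖B ξ‖} →
        (∀ t : ℝ, 3 ≤ t → MemLp (KG.profile lam A B t) 2 volume) ∧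
        0 < liminf (fun t : ℝ => eLpNorm (fun x => (KG.profile lam A B t x).im) 2 volume)
          atTop) := by
  exact ⟨KG.profile_estimates lam, KG.small_profile_estimates lam,
    fun _ _ hA hB hne => KG.liminf_im_profile_pos lam hA hB hne⟩
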